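/- **Theorem.** Let $d\ge 1$, $k\ge 1$ be integers, $\mathcal Q=[0,1]^d$, and let $p$ be a probability density on $\mathbb R^d$ that vanishes outside $\mathcal Q$ and satisfies: (a) $p$ is continuous on $\mathcal Q$; (b) $C_1:=\inf_{x\in\mathcal Q}p(x)>0$; (c) $p$ is differentiable on the interior $\mathcal Q^o$ with $C_2:=\sup_{x\in\mathcal Q^o}\|\nabla p(x)\|_1<\infty$. Let $H(X)=-\int p\log p$. Let $x^{(1)},\dots,x^{(N)}$, $N>k$, be i.i.d. with density $p$. For each $i$ take the $k$ nearest neighbours of $x^{(i)}$ among the other sample points in the norm $\|\cdot\|_\infty$, and for $j=1,\dots,d$ let $\epsilon_{i,j}$ be twice the largest of the distances $|x^{(l)}_j-x^{(i)}_j|$ over these $k$ neighbours $x^{(l)}$. Let $$\zeta_{i,j}=\min\{x^{(i)}_j+\epsilon_{i,j}/2,\,1\}-\max\{x^{(i)}_j-\epsilon_{i,j}/2,\,0\},$$ and, with $\psi=\Gamma'/\Gamma$, define the truncated KSG estimator $$\widehat H_{\mathrm{tKSG}}(X)=-\psi(k)+\psi(N)+\frac{d-1}{k}+\frac1N\sum_{i=1}^N\sum_{j=1}^d\log\zeta_{i,j}.$$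 Then $\widehat H_{\mathrm{tKSG}}(X)$ is square integrable, and there are constants $C,C'>0$, depending only on $d$, $k$ and an upper bound for $C_2$ (in particular not on $N$ or $C_1$), such that for all $N>k$ $$\bigl|\mathbb E[\widehat H_{\mathrm{tKSG}}(X)]-H(X)\bigr|\le C\,\frac{(\log N)^{k+2}}{C_1^{k+1}N^{1/d}},\qquad \mathrm{Var}[\widehat H_{\mathrm{tKSG}}(X)]\le C'\,\frac{(\log N)^{k+2}}{N}.$$ -/

import Mathlib

open MeasureTheory ProbabilityTheory

noncomputable section

namespace TKSG

/-- The unit cube `[0,1]^d`. Points are functions `Fin d → ℝ`, so that `dist` is the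
maximum-norm distance and `volume` is Lebesgue measure. -/
def unitCube (d : ℕ) : Set (Fin d → ℝ) := Set.Icc 0 1

/-- The `1`-norm of the gradient of `p` at `x`, the sum of the absolute values of the partial
derivatives. -/
def gradL1 {d : ℕ} (p : (Fin d → ℝ) → ℝ) (x : Fin d → ℝ) : ℝ :=
  ∑ j, |fderiv ℝ p x (Pi.single j 1)|

/-- The constant `C₁`, the infimum of `p` over the cube. -/
def lowerConst {d : ℕ} (p : (Fin d → ℝ) → ℝ) : ℝ := sInf (p '' unitCube d)

/-- The constant `C₂`, the supremum of the `1`-norm of the gradient over the open cube. -/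
def gradConst {d : ℕ} (p : (Fin d → ℝ) → ℝ) : ℝ := sSup (gradL1 p '' interior (unitCube d))

/-- `p` is a probability density supported on the unit cube and continuous on it, bounded away
from zero there, differentiable in the interior with uniformly bounded gradient. -/
structure IsAdmissibleDensity {d : ℕ} (p : (Fin d → ℝ) → ℝ) : Prop where
  eq_zero_of_notMem : ∀ x, x ∉ unitCube d → p x = 0
  continuousOn : ContinuousOn p (unitCube d)
  lowerConst_pos : 0 < lowerConst p
  integral_eq_one : ∫ x, p x = 1
  differentiableOn : DifferentiableOn ℝ p (interior (unitCube d))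
  gradient_bounded : BddAbove (gradL1 p '' interior (unitCube d))

/-- The probability measure with Lebesgue density `p`. -/
def densityMeasure {d : ℕ} (p : (Fin d → ℝ) → ℝ) : Measure (Fin d → ℝ) :=
  volume.withDensity fun x => ENNReal.ofReal (p x)

/-- The differential entropy `H(X) = -∫ p log p` of a random vector `X` with density `p`. -/
def entropy {d : ℕ} (p : (Fin d → ℝ) → ℝ) : ℝ := -∫ x, Real.log (p x) * p x

/-- The digamma function `Γ'/Γ` on the reals. -/
def digamma (x : ℝ) : ℝ := deriv Real.Gamma x / Real.Gamma x

/-- The (indices of the) `k` nearest neighbours of `x i` among the other sample points in the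
maximum norm: the points `x l`, `l ≠ i`, such that fewer than `k` of the other sample points are
strictly closer to `x i`. If the distances to `x i` are distinct, which holds almost surely for
i.i.d. points with a density, these are exactly the `k` nearest points (for `k < N`). -/
def neighbors {d N : ℕ} (k : ℕ) (x : Fin N → Fin d → ℝ) (i : Fin N) : Finset (Fin N) :=
  {l | l ≠ i ∧
    (Finset.univ.filter fun m : Fin N => m ≠ i ∧ dist (x m) (x i) < dist (x l) (x i)).card < k}

/-- The side length `ε_{i,j}` of the nearest-neighbour rectangle centred at `x i`: twice the largest
distance along the coordinate `j` from `x i` to one of its `k` nearest neighbours. -/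
def sideLength {d N : ℕ} (k : ℕ) (x : Fin N → Fin d → ℝ) (i : Fin N) (j : Fin d) : ℝ :=
  2 * (((neighbors k x i).sup fun l => nndist (x l j) (x i j) : NNReal) : ℝ)

/-- The side length `ζ_{i,j}` of that rectangle after it has been clipped to the unit cube. -/
def clippedSideLength {d N : ℕ} (k : ℕ) (x : Fin N → Fin d → ℝ) (i : Fin N) (j : Fin d) : ℝ :=
  min (x i j + sideLength k x i j / 2) 1 - max (x i j - sideLength k x i j / 2) 0

/-- The truncated KSG entropy estimator on the sample `x`. -/
def estimator {d N : ℕ} (k : ℕ) (x : Fin N → Fin d → ℝ) : ℝ :=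
  -digamma k + digamma N + ((d : ℝ) - 1) / k
    + (1 / (N : ℝ)) * ∑ i, ∑ j, Real.log (clippedSideLength k x i j)

end TKSG

end

noncomputable section

namespace TKSG

/-! ### Beta integrals with a logarithm, and the probability integral transform. -/

section OneDim

open Set

/-! Bias. Fix a sample point x and let R be the distance from x to its (k+1)-st nearest neighbour.
Given x and R, the k nearer points are independent with density proportional to p on the ball of
radius R clipped to the cube. This region is a box, and `p` is Lipschitz, so their law is nearly
uniform on it. For exactly uniform points the j-th clipped side length, relative to the side of the
box, has distribution function t^k, whose mean logarithm is exactly -1/k (`integral_log_boxLen`);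
clipping is what makes this exact at the boundary as well. Writing m for the mass of the ball, the
volume of the box is about m / p(x), so the sum of the logarithms of the side lengths has
conditional mean log m - log p(x) - d/k up to an error of order R (`abs_setIntegral_log_boxLen_le`).

By the probability integral transform m has the Beta law with density proportional to u^k
(1-u)^(N-k-2) (`lintegral_config`). Its mean logarithm is a difference of harmonic numbers
(`natBetaLog_eq`), equal to ψ(k+1) - ψ(N), and this cancels the digamma terms of the estimator; -log
p(x) averages to the entropy. Since m is at least C₁ R^d, the mean of R is of order 1 / (C₁ N^(1/d))
(`setIntegral_dist_le`). No conditional laws are needed: the sample space is split, up to a null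
set, into the events that name the (k+1)-st neighbour and the set of the k nearest ones
(`existsUnique_config`), and on each event Fubini applies. The case N = k + 1 has no (k+1)-st
neighbour and is bounded crudely.

Variance. The Efron–Stein inequality (`variance_pi_le_sum`) compares the estimator with its
leave-one-out versions. Removing a point affects its own term and the terms of those points which
have it as a neighbour, at most k 2^d of them (`card_indegree_le`). Each logarithm has second moment
of order (log N)^2 (`integral_logLenBound_le`), which gives (log N)^2 / N.

Both bounds are thus sharper in log N than required; the surplus powers are restored at the end from
N ≥ 2. -/

lemma intervalIntegrable_pow_mul_log (k n : ℕ) :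
    IntervalIntegrable (fun u : ℝ => u ^ k * (1 - u) ^ n * Real.log u) volume 0 1 :=
  intervalIntegral.intervalIntegrable_log'.continuousOn_mul (by fun_prop)

/-- The Beta integral with natural exponents. -/
def natBeta (k n : ℕ) : ℝ := ∫ u in (0 : ℝ)..1, u ^ k * (1 - u) ^ n

/-- The logarithmic Beta integral with natural exponents. -/
def natBetaLog (k n : ℕ) : ℝ := ∫ u in (0 : ℝ)..1, u ^ k * (1 - u) ^ n * Real.log u

lemma natBeta_zero (k : ℕ) : natBeta k 0 = 1 / (k + 1) := by
  simp [natBeta]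

lemma natBeta_succ (k n : ℕ) : natBeta k (n + 1) = natBeta k n - natBeta (k + 1) n := by
  unfold natBeta
  rw [← intervalIntegral.integral_sub]
  · congr 1; ext u; ring
  all_goals exact Continuous.intervalIntegrable (by fun_prop) _ _

/-- The functional equation of the Beta function. Read as a ratio, it is the mean of the Beta law
that later governs the mass of a ball. -/
lemma natBeta_succ_left (k n : ℕ) :
    natBeta (k + 1) n = natBeta k n * ((k + 1) / (k + n + 2)) := by
  induction n generalizing k with
  | zero =>
    rw [natBeta_zero, natBeta_zero]
    push_cast
    field_simp
    ring
  | succ n ih =>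
    rw [natBeta_succ, natBeta_succ, ih (k + 1), ih k]
    push_cast
    field_simp
    ring

lemma natBetaLog_zero (k : ℕ) : natBetaLog k 0 = -(1 / (k + 1) ^ 2) := by
  unfold natBetaLog
  -- The antiderivative is grouped as u^k (u log u), so that it is visibly continuous at 0.
  have h : ∀ u ∈ Ioo (0 : ℝ) 1, HasDerivAt
      (fun u : ℝ => u ^ k * (u * Real.log u) / (k + 1) - u ^ (k + 1) / (k + 1) ^ 2)
      (u ^ k * (1 - u) ^ 0 * Real.log u) u := by
    intro u hu
    have hu0 : u ≠ 0 := hu.1.ne'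
    have h1 : HasDerivAt (fun u : ℝ => u ^ (k + 1) * Real.log u)
        (((k + 1 : ℕ) : ℝ) * u ^ k * Real.log u + u ^ (k + 1) * u⁻¹) u := by
      exact (hasDerivAt_pow (k + 1) u).fun_mul (Real.hasDerivAt_log hu0)
    have h2 := (h1.div_const ((k : ℝ) + 1)).fun_sub
      ((hasDerivAt_pow (k + 1) u).div_const (((k : ℝ) + 1) ^ 2))
    refine (h2.congr_deriv ?_).congr_of_eventuallyEq (Filter.Eventually.of_forall fun v => ?_)
    · push_cast
      field_simp
      ring
    · ring
  have hc : ContinuousOn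
      (fun u : ℝ => u ^ k * (u * Real.log u) / (k + 1) - u ^ (k + 1) / (k + 1) ^ 2)
      (Icc 0 1) := by
    have := Real.continuous_mul_log
    fun_prop
  rw [intervalIntegral.integral_eq_sub_of_hasDerivAt_of_le zero_le_one hc h
    (by simpa using intervalIntegrable_pow_mul_log k 0)]
  simp

lemma natBetaLog_succ (k n : ℕ) :
    natBetaLog k (n + 1) = natBetaLog k n - natBetaLog (k + 1) n := by
  unfold natBetaLog
  rw [← intervalIntegral.integral_sub (intervalIntegrable_pow_mul_log _ _)
    (intervalIntegrable_pow_mul_log _ _)]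
  congr 1; ext u; ring

/-- Both integrals satisfy the same recursion in the exponent of 1 - u, so induction reduces the
claim to the case of exponent 0. With k + n + 2 = N the bracket is ψ(k+1) - ψ(N). -/
lemma natBetaLog_eq (k n : ℕ) :
    natBetaLog k n = natBeta k n * ((harmonic k : ℝ) - harmonic (k + n + 1)) := by
  induction n generalizing k with
  | zero =>
    rw [natBetaLog_zero, natBeta_zero, add_zero, harmonic_succ]
    push_cast
    field_simp
    ring
  | succ n ih =>
    rw [natBetaLog_succ, ih, ih, natBeta_succ, natBeta_succ_left,
      show k + 1 + n + 1 = k + n + 1 + 1 by ring, show k + (n + 1) + 1 = k + n + 1 + 1 by ring,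
      harmonic_succ (k + n + 1), harmonic_succ k]
    push_cast
    field_simp
    ring

lemma digamma_succ (n : ℕ) : digamma ((n : ℝ) + 1) = -Real.eulerMascheroniConstant + harmonic n := by
  rw [digamma, Real.deriv_Gamma_nat, Real.Gamma_nat_eq_factorial]
  field_simp

/-- A random variable whose distribution function is linear on `[0,1]` is uniform. -/
lemma map_eq_uniform {α : Type*} [MeasurableSpace α] (ρ : Measure α) [IsFiniteMeasure ρ]
    {U : α → ℝ} (hU : AEMeasurable U ρ) {c : ℝ} (hc : 0 ≤ c)
    (h01 : ∀ᵐ a ∂ρ, U a ≤ 1)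
    (h : ∀ t ∈ Icc (0 : ℝ) 1, ρ {a | U a ≤ t} = ENNReal.ofReal (c * t)) :
    ρ.map U = ENNReal.ofReal c • volume.restrict (Icc 0 1) := by
  refine Measure.ext_of_Iic _ _ fun a => ?_
  rw [Measure.map_apply_of_aemeasurable hU measurableSet_Iic, Measure.smul_apply,
    Measure.restrict_apply measurableSet_Iic]
  have h1 : Iic a ∩ Icc (0 : ℝ) 1 = Icc 0 (min a 1) := by
    ext t; simp only [mem_inter_iff, mem_Iic, mem_Icc, le_min_iff]; tauto
  rw [h1, Real.volume_Icc, smul_eq_mul, ← ENNReal.ofReal_mul hc]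
  change ρ {b | U b ≤ a} = _
  rcases lt_or_ge a 0 with ha | ha
  · have : ρ {b | U b ≤ a} ≤ ρ {b | U b ≤ 0} := measure_mono fun b hb => le_trans hb ha.le
    rw [h 0 (by simp)] at this
    have h2 : min a 1 - 0 ≤ 0 := by simp [ha.le]
    rw [ENNReal.ofReal_of_nonpos (mul_nonpos_of_nonneg_of_nonpos hc h2)]
    simpa using this
  rcases le_or_gt a 1 with ha1 | ha1
  · rw [h a ⟨ha, ha1⟩, min_eq_left ha1, sub_zero]
  · rw [min_eq_right ha1.le, sub_zero, ← h 1 (by simp)]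
    refine measure_congr ?_
    filter_upwards [h01] with b hb
    exact propext ⟨fun _ => hb, fun _ => hb.trans ha1.le⟩

/-- The probability integral transform. -/
lemma map_measureReal_lt_eq_uniform {α : Type*} [MeasurableSpace α] (P : Measure α)
    [IsProbabilityMeasure P] {D : α → ℝ} (hD : Measurable D) (hD0 : ∀ a, 0 ≤ D a)
    (hnull : ∀ r, P {a | D a = r} = 0) :
    P.map (fun y => P.real {z | D z < D y}) = volume.restrict (Icc 0 1) := by
  set F : ℝ → ℝ := fun r => P.real {z | D z < r} with hF
  have : IsProbabilityMeasure (P.map D) := Measure.isProbabilityMeasure_map hD.aemeasurable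
  have hFc : ∀ r, F r = cdf (P.map D) r := by
    intro r
    rw [cdf_eq_real, map_measureReal_apply hD measurableSet_Iic, hF]
    refine measureReal_congr ?_
    have h1 : ∀ᵐ a ∂P, D a ≠ r := by rw [ae_iff]; simpa using hnull r
    filter_upwards [h1] with a ha
    exact propext ⟨fun h => le_of_lt h, fun h => lt_of_le_of_ne h ha⟩
  have hmono : Monotone F := fun r s hrs => measureReal_mono fun z hz => lt_of_lt_of_le hz hrs
  -- The distribution function is right continuous, and its jumps are the atoms, which are excluded
  -- by `hnull`.
  have hcont : Continuous F := by
    have : F = cdf (P.map D) := funext hFc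
    rw [this]
    refine continuous_iff_continuousAt.2 fun r => ?_
    rw [(cdf (P.map D)).mono.continuousAt_iff_leftLim_eq_rightLim, (cdf (P.map D)).rightLim_eq]
    have h1 := (cdf (P.map D)).measure_singleton r
    rw [measure_cdf, Measure.map_apply hD (measurableSet_singleton r)] at h1
    have h2 : P (D ⁻¹' {r}) = 0 := hnull r
    rw [h2] at h1
    have h3 := ENNReal.ofReal_eq_zero.1 h1.symm
    exact le_antisymm ((cdf (P.map D)).mono.leftLim_le le_rfl) (by linarith)
  have hmeas : Measurable (fun y => P.real {z | D z < D y}) := hmono.measurable.comp hD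
  have h1 := map_eq_uniform P hmeas.aemeasurable zero_le_one
    (Filter.Eventually.of_forall fun y => measureReal_le_one) ?_
  · simpa using h1
  intro t ht
  -- The value t = 1 is treated apart because the sublevel set `A` below is then unbounded.
  rcases eq_or_lt_of_le ht.2 with rfl | ht1
  · have : {a | P.real {z | D z < D a} ≤ 1} = univ := eq_univ_of_forall fun a => measureReal_le_one
    rw [this]; simp
  have hF0 : F 0 = 0 := by
    have : {z | D z < 0} = ∅ := by ext z; simpa using hD0 z
    simp [hF, this]
  -- The supremum of `A` is the generalised inverse of `F` at t: by continuity `F` takes the value t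
  -- there, and the event becomes a sublevel set of `D`.
  set A : Set ℝ := {r | F r ≤ t} with hA
  have hAcl : IsClosed A := isClosed_le hcont continuous_const
  have hA0 : (0 : ℝ) ∈ A := by simp [hA, hF0, ht.1]
  have hAb : BddAbove A := by
    have h2 := (tendsto_cdf_atTop (P.map D)).eventually (lt_mem_nhds ht1)
    obtain ⟨r, hr⟩ := h2.exists
    refine ⟨r, fun s hs => ?_⟩
    by_contra hlt
    have := hmono (not_le.1 hlt).le
    rw [← hFc] at hr
    have hs' : F s ≤ t := hs
    linarith
  have hs : sSup A ∈ A := hAcl.csSup_mem ⟨0, hA0⟩ hAb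
  have hs2 : t ≤ F (sSup A) := by
    have h3 : Filter.Tendsto F (nhdsWithin (sSup A) (Ioi (sSup A))) (nhds (F (sSup A))) :=
      (hcont.tendsto _).mono_left nhdsWithin_le_nhds
    refine ge_of_tendsto h3 ?_
    filter_upwards [self_mem_nhdsWithin] with r hr
    by_contra hlt
    exact absurd (le_csSup hAb (show r ∈ A from (not_le.1 hlt).le)) (not_le.2 hr)
  have hset : {a | P.real {z | D z < D a} ≤ t} = {a | D a ≤ sSup A} := by
    ext a
    exact ⟨fun h => le_csSup hAb h, fun h => (hmono h).trans hs⟩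
  rw [hset, one_mul, le_antisymm hs2 hs, hFc, cdf_eq_real,
    map_measureReal_apply hD measurableSet_Iic, ofReal_measureReal]
  rfl

/-- If the distribution function of `T ∈ [0,1]` is `c t ^ k`, the mean of `log T` is `-c / k`. -/
lemma integral_log_of_cdf_pow {α : Type*} [MeasurableSpace α] (ρ : Measure α) [IsFiniteMeasure ρ]
    {T : α → ℝ} (hT : Measurable T) {c : ℝ} (hc : 0 ≤ c) {k : ℕ} (hk : 1 ≤ k)
    (h0 : ∀ a, 0 ≤ T a) (h1 : ∀ᵐ a ∂ρ, T a ≤ 1)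
    (h : ∀ t ∈ Icc (0 : ℝ) 1, ρ {a | T a ≤ t} = ENNReal.ofReal (c * t ^ k)) :
    Integrable (fun a => Real.log (T a)) ρ ∧ ∫ a, Real.log (T a) ∂ρ = -c / k := by
  have hk0 : (k : ℝ) ≠ 0 := by positivity
  have hk0' : k ≠ 0 := by positivity
  have hm : Measurable fun a => T a ^ k := hT.pow_const k
  -- The k-th power of `T` has c times the uniform law, so the claim reduces to the integral of log
  -- over [0,1], which is -1.
  have hmap := map_eq_uniform ρ hm.aemeasurable hc
    (by filter_upwards [h1] with a ha using pow_le_one₀ (h0 a) ha) (by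
      intro t ht
      have ht' : t ^ ((k : ℝ)⁻¹) ∈ Icc (0 : ℝ) 1 :=
        ⟨Real.rpow_nonneg ht.1 _, Real.rpow_le_one ht.1 ht.2 (by positivity)⟩
      have := h _ ht'
      rw [Real.rpow_inv_natCast_pow ht.1 hk0'] at this
      rw [← this]
      congr 1
      ext a
      simp only [mem_ofPred_eq]
      rw [Real.le_rpow_inv_iff_of_pos (h0 a) ht.1 (by positivity), Real.rpow_natCast])
  have hlog : ∀ a, Real.log (T a) = (k : ℝ)⁻¹ * Real.log (T a ^ k) := by
    intro a; rw [Real.log_pow]; field_simp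
  have hint : Integrable Real.log (ρ.map fun a => T a ^ k) := by
    rw [hmap]
    refine Integrable.smul_measure ?_ ENNReal.ofReal_ne_top
    rw [← IntegrableOn, integrableOn_Icc_iff_integrableOn_Ioc,
      ← intervalIntegrable_iff_integrableOn_Ioc_of_le zero_le_one]
    exact intervalIntegral.intervalIntegrable_log'
  constructor
  · simp_rw [hlog]
    exact ((integrable_map_measure Real.measurable_log.aestronglyMeasurable hm.aemeasurable).1
      hint).const_mul _
  · simp_rw [hlog]
    rw [integral_const_mul]
    have := integral_map (μ := ρ) hm.aemeasurable (f := Real.log)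
      Real.measurable_log.aestronglyMeasurable
    rw [← this, hmap, integral_smul_measure, integral_Icc_eq_integral_Ioc,
      ← intervalIntegral.integral_of_le zero_le_one, integral_log, ENNReal.toReal_ofReal hc]
    simp
    field_simp

/-- The function `|s|^(-1/2)` is integrable near the origin. -/
lemma lintegral_rpow_abs_ne_top :
    ∫⁻ s in Icc (-1 : ℝ) 1, ENNReal.ofReal (|s| ^ (-(1 / 2) : ℝ)) ≠ ⊤ := by
  have h0 : IntervalIntegrable (fun s : ℝ => |s| ^ (-(1 / 2) : ℝ)) volume 0 1 :=
    (intervalIntegral.intervalIntegrable_rpow' (r := -(1 / 2)) (by norm_num)).congr_uIoo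
      (by intro s hs; rw [uIoo_of_le zero_le_one] at hs; simp [abs_of_pos hs.1])
  have h1 : IntervalIntegrable (fun s : ℝ => |s| ^ (-(1 / 2) : ℝ)) volume (-1) 0 := by
    have := h0.comp_sub_left 0
    simpa using this.symm
  have h2 := h1.trans h0
  rw [intervalIntegrable_iff_integrableOn_Icc_of_le (by norm_num)] at h2
  have h3 := h2.lintegral_lt_top
  exact h3.ne

end OneDim

/-! ### Consequences of admissibility: Lipschitz bound, upper bound, null sets, entropy. -/

section Density

variable {d : ℕ} {p : (Fin d → ℝ) → ℝ}

lemma measurableSet_unitCube : MeasurableSet (unitCube d) := measurableSet_Icc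

lemma isCompact_unitCube : IsCompact (unitCube d) := isCompact_Icc

lemma volume_unitCube : volume (unitCube d) = 1 := by
  simp [unitCube, Real.volume_Icc_pi]

lemma mem_unitCube {x : Fin d → ℝ} : x ∈ unitCube d ↔ ∀ j, 0 ≤ x j ∧ x j ≤ 1 := by
  simp only [unitCube, Set.mem_Icc, Pi.le_def, Pi.zero_apply, Pi.one_apply, forall_and]

lemma interior_unitCube : interior (unitCube d) = Set.univ.pi fun _ => Set.Ioo (0 : ℝ) 1 := by
  rw [unitCube, ← Set.pi_univ_Icc, interior_pi_set Set.finite_univ]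
  simp

lemma dist_le_one {x y : Fin d → ℝ} (hx : x ∈ unitCube d) (hy : y ∈ unitCube d) :
    dist x y ≤ 1 := by
  rw [dist_pi_le_iff zero_le_one]
  intro j
  have h1 := mem_unitCube.1 hx j
  have h2 := mem_unitCube.1 hy j
  rw [Real.dist_eq, abs_le]
  constructor <;> linarith

lemma nonempty_interior_unitCube : (interior (unitCube d)).Nonempty := by
  refine ⟨fun _ => 1 / 2, ?_⟩
  rw [interior_unitCube]
  intro j _
  norm_num

namespace IsAdmissibleDensity

lemma lowerConst_le (hp : IsAdmissibleDensity p) {x : Fin d → ℝ} (hx : x ∈ unitCube d) :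
    lowerConst p ≤ p x :=
  csInf_le (isCompact_unitCube.image_of_continuousOn hp.continuousOn).bddBelow ⟨x, hx, rfl⟩

lemma pos (hp : IsAdmissibleDensity p) {x : Fin d → ℝ} (hx : x ∈ unitCube d) : 0 < p x :=
  hp.lowerConst_pos.trans_le (hp.lowerConst_le hx)

lemma nonneg (hp : IsAdmissibleDensity p) (x : Fin d → ℝ) : 0 ≤ p x := by
  by_cases hx : x ∈ unitCube d
  · exact (hp.pos hx).le
  · rw [hp.eq_zero_of_notMem x hx]

lemma indicator_eq (hp : IsAdmissibleDensity p) : (unitCube d).indicator p = p := by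
  ext x
  by_cases hx : x ∈ unitCube d
  · simp [hx]
  · simp [hx, hp.eq_zero_of_notMem x hx]

lemma measurable (hp : IsAdmissibleDensity p) : Measurable p := by
  classical
  rw [← hp.indicator_eq, ← Set.piecewise_eq_indicator]
  exact hp.continuousOn.measurable_piecewise continuousOn_const measurableSet_unitCube

lemma integrableOn (hp : IsAdmissibleDensity p) : IntegrableOn p (unitCube d) :=
  hp.continuousOn.integrableOn_compact isCompact_unitCube

lemma integrable (hp : IsAdmissibleDensity p) : Integrable p := by
  rw [← hp.indicator_eq]
  exact hp.integrableOn.integrable_indicator measurableSet_unitCube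

lemma setIntegral_eq_one (hp : IsAdmissibleDensity p) : ∫ x in unitCube d, p x = 1 := by
  rw [← integral_indicator measurableSet_unitCube, hp.indicator_eq, hp.integral_eq_one]

lemma gradConst_nonneg (hp : IsAdmissibleDensity p) : 0 ≤ gradConst p := by
  obtain ⟨x, hx⟩ := nonempty_interior_unitCube (d := d)
  refine le_trans ?_ (le_csSup hp.gradient_bounded ⟨x, hx, rfl⟩)
  exact Finset.sum_nonneg fun j _ => abs_nonneg _

/-- The 1-norm of the gradient is dual to the maximum norm. -/
lemma norm_fderiv_le (hp : IsAdmissibleDensity p) {x : Fin d → ℝ}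
    (hx : x ∈ interior (unitCube d)) : ‖fderiv ℝ p x‖ ≤ gradConst p := by
  refine ContinuousLinearMap.opNorm_le_bound _ hp.gradConst_nonneg fun v => ?_
  have h1 : gradL1 p x ≤ gradConst p := le_csSup hp.gradient_bounded ⟨x, hx, rfl⟩
  have h2 : fderiv ℝ p x v = ∑ j, v j * fderiv ℝ p x (Pi.single j 1) := by
    have h3 : v = ∑ j, v j • (Pi.single j (1 : ℝ) : Fin d → ℝ) := by
      ext i; simp [Finset.sum_apply, Pi.single_apply]
    conv_lhs => rw [h3]
    rw [map_sum]
    simp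
  calc ‖fderiv ℝ p x v‖ ≤ ∑ j, ‖v‖ * |fderiv ℝ p x (Pi.single j 1)| := by
        rw [h2]
        refine (norm_sum_le _ _).trans (Finset.sum_le_sum fun j _ => ?_)
        rw [norm_mul, Real.norm_eq_abs (fderiv ℝ p x _)]
        gcongr
        exact norm_le_pi_norm v j
    _ = gradL1 p x * ‖v‖ := by rw [← Finset.mul_sum, mul_comm]; rfl
    _ ≤ gradConst p * ‖v‖ := by gcongr

/-- The mean value inequality holds on the open cube, which is convex, and passes to the closed cube
by continuity. -/
lemma abs_sub_le (hp : IsAdmissibleDensity p) {x y : Fin d → ℝ} (hx : x ∈ unitCube d)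
    (hy : y ∈ unitCube d) : |p x - p y| ≤ gradConst p * dist x y := by
  have hconv : Convex ℝ (unitCube d) := convex_Icc 0 1
  have hcl : closure (interior (unitCube d)) = unitCube d := by
    rw [hconv.closure_interior_eq_closure_of_nonempty_interior nonempty_interior_unitCube]
    exact isClosed_Icc.closure_eq
  have h1 : LipschitzOnWith (Real.toNNReal (gradConst p)) p (interior (unitCube d)) := by
    refine hconv.interior.lipschitzOnWith_of_nnnorm_fderiv_le (𝕜 := ℝ) ?_ ?_
    · intro z hz
      exact (hp.differentiableOn z hz).differentiableAt (isOpen_interior.mem_nhds hz)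
    · intro z hz
      rw [← NNReal.coe_le_coe, coe_nnnorm, Real.coe_toNNReal _ hp.gradConst_nonneg]
      exact hp.norm_fderiv_le hz
  have h2 : LipschitzOnWith (Real.toNNReal (gradConst p)) p (closure (interior (unitCube d))) :=
    h1.closure (by rw [hcl]; exact hp.continuousOn)
  rw [hcl] at h2
  have h3 := h2.dist_le_mul x hx y hy
  rwa [Real.coe_toNNReal _ hp.gradConst_nonneg, Real.dist_eq] at h3

lemma lowerConst_le_one (hp : IsAdmissibleDensity p) : lowerConst p ≤ 1 := by
  rw [← hp.setIntegral_eq_one]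
  have h1 : ∫ _ in unitCube d, lowerConst p = lowerConst p := by
    simp [measureReal_def, volume_unitCube]
  rw [← h1]
  refine setIntegral_mono_on ?_ hp.integrableOn measurableSet_unitCube fun x hx => ?_
  · exact integrableOn_const (by simp [volume_unitCube])
  · exact hp.lowerConst_le hx

/-- The cube has diameter at most one and volume one, so integrating the Lipschitz lower bound p(y)
≥ p(x) - C₂ against total mass one bounds p(x). -/
lemma le_upper (hp : IsAdmissibleDensity p) (x : Fin d → ℝ) : p x ≤ 1 + gradConst p := by
  by_cases hx : x ∈ unitCube d
  swap
  · rw [hp.eq_zero_of_notMem x hx]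
    linarith [hp.gradConst_nonneg]
  have h1 : ∫ _ in unitCube d, (p x - gradConst p) = p x - gradConst p := by
    simp [measureReal_def, volume_unitCube]
  have h2 : p x - gradConst p ≤ 1 := by
    rw [← h1, ← hp.setIntegral_eq_one]
    refine setIntegral_mono_on ?_ hp.integrableOn measurableSet_unitCube fun y hy => ?_
    · exact integrableOn_const (by simp [volume_unitCube])
    · have h3 := (abs_le.1 (hp.abs_sub_le hx hy)).2
      have h4 := mul_le_mul_of_nonneg_left (dist_le_one hx hy) hp.gradConst_nonneg
      linarith
  linarith

lemma isProbabilityMeasure (hp : IsAdmissibleDensity p) :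
    IsProbabilityMeasure (densityMeasure p) := by
  constructor
  rw [densityMeasure, withDensity_apply _ MeasurableSet.univ, Measure.restrict_univ,
    ← ofReal_integral_eq_lintegral_ofReal hp.integrable
      (Filter.Eventually.of_forall hp.nonneg), hp.integral_eq_one, ENNReal.ofReal_one]

lemma densityMeasure_eq (hp : IsAdmissibleDensity p) :
    densityMeasure p
      = (volume.restrict (unitCube d)).withDensity fun x => ENNReal.ofReal (p x) := by
  rw [← withDensity_indicator measurableSet_unitCube, densityMeasure]
  congr 1
  ext x
  by_cases hx : x ∈ unitCube d
  · simp [hx]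
  · simp [hx, hp.eq_zero_of_notMem x hx]

lemma ae_mem_unitCube (hp : IsAdmissibleDensity p) :
    ∀ᵐ x ∂densityMeasure p, x ∈ unitCube d := by
  rw [hp.densityMeasure_eq]
  exact (withDensity_absolutelyContinuous _ _).ae_le (ae_restrict_mem measurableSet_unitCube)

lemma densityMeasure_le (hp : IsAdmissibleDensity p) :
    densityMeasure p
      ≤ ENNReal.ofReal (1 + gradConst p) • volume.restrict (unitCube d) := by
  rw [hp.densityMeasure_eq, ← withDensity_const]
  exact withDensity_mono (Filter.Eventually.of_forall fun x =>
    ENNReal.ofReal_le_ofReal (hp.le_upper x))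

/-- This rules out ties between distances and atoms of the distance law. It needs d ≥ 1: in
dimension 0 the whole space is a sphere of radius 0. -/
lemma densityMeasure_sphere (hd : 1 ≤ d) (x : Fin d → ℝ) (r : ℝ) :
    densityMeasure p {y | dist y x = r} = 0 := by
  have : Nonempty (Fin d) := ⟨⟨0, hd⟩⟩
  exact withDensity_absolutelyContinuous _ _ (Measure.addHaar_sphere volume x r)

lemma densityMeasure_hyperplane (j : Fin d) (a : ℝ) :
    densityMeasure p {y | y j = a} = 0 := by
  refine withDensity_absolutelyContinuous _ _ ?_
  rw [volume_pi]
  exact Measure.pi_hyperplane (fun _ : Fin d => (volume : Measure ℝ)) j a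

lemma integral_densityMeasure (hp : IsAdmissibleDensity p) (f : (Fin d → ℝ) → ℝ) :
    ∫ x, f x ∂densityMeasure p = ∫ x, f x * p x := by
  rw [densityMeasure, integral_withDensity_eq_integral_toReal_smul
    (by exact hp.measurable.ennreal_ofReal) (by simp)]
  congr 1
  ext x
  rw [ENNReal.toReal_ofReal (hp.nonneg x), smul_eq_mul, mul_comm]

lemma integral_log_eq (hp : IsAdmissibleDensity p) :
    ∫ x, Real.log (p x) ∂densityMeasure p = -entropy p := by
  rw [hp.integral_densityMeasure, entropy, neg_neg]

lemma integrable_log (hp : IsAdmissibleDensity p) :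
    Integrable (fun x => Real.log (p x)) (densityMeasure p) := by
  have := hp.isProbabilityMeasure
  refine Integrable.of_bound (C := |Real.log (lowerConst p)| + |Real.log (1 + gradConst p)|)
    (hp.measurable.log.aestronglyMeasurable) ?_
  filter_upwards [hp.ae_mem_unitCube] with x hx
  have h1 := Real.log_le_log hp.lowerConst_pos (hp.lowerConst_le hx)
  have h2 := Real.log_le_log (hp.pos hx) (hp.le_upper x)
  rw [Real.norm_eq_abs, abs_le]
  constructor
  · linarith [neg_abs_le (Real.log (lowerConst p)), abs_nonneg (Real.log (1 + gradConst p))]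
  · linarith [le_abs_self (Real.log (1 + gradConst p)), abs_nonneg (Real.log (lowerConst p))]

/-- The entropy is bounded in terms of the gradient only. -/
lemma abs_entropy_le (hp : IsAdmissibleDensity p) :
    |entropy p| ≤ 1 + (1 + gradConst p) ^ 2 := by
  rw [entropy, abs_neg]
  have h0 : ∀ x, Real.log (p x) * p x = (unitCube d).indicator (fun x => Real.log (p x) * p x) x := by
    intro x
    by_cases hx : x ∈ unitCube d
    · simp [hx]
    · simp [hx, hp.eq_zero_of_notMem x hx]
  rw [integral_congr_ae (Filter.Eventually.of_forall h0), integral_indicator measurableSet_unitCube]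
  have h1 := norm_setIntegral_le_of_norm_le_const (μ := volume) (s := unitCube d)
    (f := fun x => Real.log (p x) * p x) (C := 1 + (1 + gradConst p) ^ 2)
    (by simp [volume_unitCube]) (fun x hx => by
      have hpx := hp.pos hx
      have hle := hp.le_upper x
      -- The inequality log s ≤ s - 1 at s = p(x) and at s = 1 / p(x) encloses p log p between p - 1
      -- and p² - p, without involving C₁.
      have h2 := Real.log_le_sub_one_of_pos hpx
      have h3 := Real.log_le_sub_one_of_pos (inv_pos.2 hpx)
      rw [Real.log_inv] at h3
      have h4 := mul_le_mul_of_nonneg_right h2 hpx.le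
      have h5 := mul_le_mul_of_nonneg_right h3 hpx.le
      rw [sub_mul, inv_mul_cancel₀ hpx.ne'] at h5
      have h6 : p x * p x ≤ (1 + gradConst p) ^ 2 := by nlinarith
      rw [Real.norm_eq_abs, abs_le]
      constructor <;> nlinarith)
  simpa [measureReal_def, volume_unitCube] using h1

end IsAdmissibleDensity

end Density

/-! ### Intervals clipped to [0,1]. -/

section ClippedLength

open Set

/-- The length of `[c - e, c + e]` after clipping to `[0,1]`. -/
def clipLen (c e : ℝ) : ℝ := min (c + e) 1 - max (c - e) 0

lemma clipLen_mono (c : ℝ) : Monotone (clipLen c) := by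
  intro e e' h
  unfold clipLen
  gcongr

lemma continuous_clipLen (c : ℝ) : Continuous (clipLen c) := by
  unfold clipLen; fun_prop

lemma clipLen_zero {c : ℝ} (hc : c ∈ Icc (0 : ℝ) 1) : clipLen c 0 = 0 := by
  simp [clipLen, hc.1, hc.2]

lemma clipLen_le_one (c e : ℝ) : clipLen c e ≤ 1 := by
  unfold clipLen
  linarith [min_le_right (c + e) 1, le_max_right (c - e) 0]

lemma clipLen_nonneg {c e : ℝ} (hc : c ∈ Icc (0 : ℝ) 1) (he : 0 ≤ e) : 0 ≤ clipLen c e := by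
  rw [← clipLen_zero hc]; exact clipLen_mono c he

/-- If an end is not clipped, the half of the interval on its side survives; if both are, all of
[0,1] remains. -/
lemma le_clipLen {c e : ℝ} (hc : c ∈ Icc (0 : ℝ) 1) (he : 0 ≤ e) (he1 : e ≤ 1) :
    e ≤ clipLen c e := by
  unfold clipLen
  have h1 := hc.1
  have h2 := hc.2
  rcases min_cases (c + e) 1 with h | h <;> rcases max_cases (c - e) 0 with h' | h' <;>
    rw [h.1, h'.1] <;> linarith

/-- The end of the interval at `w` lies in [0,1] and is not clipped, so shrinking the interval moves
that end and shortens it strictly. -/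
lemma clipLen_le_iff {c w e : ℝ} (hw : w ∈ Icc (0 : ℝ) 1) :
    clipLen c |w - c| ≤ clipLen c e ↔ |w - c| ≤ e := by
  refine ⟨fun h => ?_, fun h => clipLen_mono c h⟩
  by_contra hlt
  rw [not_le] at hlt
  refine absurd h (not_le.2 ?_)
  unfold clipLen
  rcases le_total c w with hcw | hcw
  · rw [abs_of_nonneg (sub_nonneg.2 hcw)] at hlt ⊢
    have h1 : min (c + e) 1 < min (c + (w - c)) 1 := by
      rw [min_eq_left (by linarith [hw.2]), min_eq_left (by linarith [hw.2])]
      linarith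
    have h2 : max (c - (w - c)) 0 ≤ max (c - e) 0 := by gcongr
    linarith
  · rw [abs_of_nonpos (sub_nonpos.2 hcw)] at hlt ⊢
    have h1 : max (c - -(w - c)) 0 < max (c - e) 0 := by
      rw [max_eq_left (by linarith [hw.1]), max_eq_left (by linarith [hw.1])]
      linarith
    have h2 : min (c + e) 1 ≤ min (c + -(w - c)) 1 := by gcongr
    linarith

lemma volume_clipped_inter {c e R : ℝ} (heR : e ≤ R) :
    volume ((Metric.ball c R ∩ Icc 0 1) ∩ {w | |w - c| ≤ e}) = ENNReal.ofReal (clipLen c e) := by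
  have h1 : ((Metric.ball c R ∩ Icc 0 1) ∩ {w | |w - c| ≤ e} : Set ℝ)
      =ᵐ[volume] (Icc (max (c - e) 0) (min (c + e) 1) : Set ℝ) := by
    rw [Real.ball_eq_Ioo]
    have h2 : (Icc (c - R) (c + R) ∩ Icc 0 1) ∩ {w | |w - c| ≤ e}
        = Icc (max (c - e) 0) (min (c + e) 1) := by
      ext w
      simp only [mem_inter_iff, mem_Icc, mem_ofPred_eq, abs_le, max_le_iff, le_min_iff]
      constructor
      · rintro ⟨⟨_, _, _⟩, _, _⟩
        refine ⟨⟨?_, ?_⟩, ?_, ?_⟩ <;> linarith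
      · rintro ⟨⟨_, _⟩, _, _⟩
        refine ⟨⟨⟨?_, ?_⟩, ?_, ?_⟩, ?_, ?_⟩ <;> linarith
    rw [← h2]
    exact (Ioo_ae_eq_Icc.inter (ae_eq_refl _)).inter (ae_eq_refl _)
  rw [measure_congr h1, Real.volume_Icc]
  rfl

lemma volume_clipped {c R : ℝ} :
    volume (Metric.ball c R ∩ Icc 0 1) = ENNReal.ofReal (clipLen c R) := by
  rw [← volume_clipped_inter le_rfl]
  congr 1
  ext w
  simp only [mem_inter_iff, mem_ofPred_eq, Metric.mem_ball, Real.dist_eq]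
  exact ⟨fun h => ⟨h, h.1.le⟩, fun h => h.1⟩

/-- The clipped distance to `c` of a uniform point of the clipped interval is uniform. -/
lemma volume_clipLen_le {c R t : ℝ} (hc : c ∈ Icc (0 : ℝ) 1) (hR : 0 ≤ R)
    (ht : t ∈ Icc (0 : ℝ) 1) :
    volume ((Metric.ball c R ∩ Icc 0 1) ∩ {w | clipLen c |w - c| ≤ t * clipLen c R})
      = ENNReal.ofReal (t * clipLen c R) := by
  have h0 := clipLen_nonneg hc hR
  obtain ⟨e, he, hte⟩ : t * clipLen c R ∈ clipLen c '' Icc 0 R := by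
    refine intermediate_value_Icc hR (continuous_clipLen c).continuousOn ⟨?_, ?_⟩
    · rw [clipLen_zero hc]; exact mul_nonneg ht.1 h0
    · exact mul_le_of_le_one_left h0 ht.2
  rw [← hte, ← volume_clipped_inter he.2]
  congr 1
  ext w
  simp only [mem_inter_iff, mem_ofPred_eq]
  refine ⟨fun h => ⟨h.1, (clipLen_le_iff h.1.2).1 h.2⟩,
    fun h => ⟨h.1, (clipLen_le_iff h.1.2).2 h.2⟩⟩

end ClippedLength

/-! ### Product densities. -/

section PiDensity

open Set

lemma pi_withDensity_ofReal {ι α : Type*} [Fintype ι] [MeasurableSpace α] (ν : Measure α)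
    [IsFiniteMeasure ν] {f : α → ℝ} (hf : Integrable f ν) (hf0 : ∀ a, 0 ≤ f a) :
    Measure.pi (fun _ : ι => ν.withDensity fun a => ENNReal.ofReal (f a))
      = (Measure.pi fun _ : ι => ν).withDensity fun w => ENNReal.ofReal (∏ i, f (w i)) := by
  have := isFiniteMeasure_withDensity_ofReal hf.2
  refine Measure.pi_eq fun s hs => ?_
  rw [withDensity_apply _ (MeasurableSet.univ_pi hs), Measure.restrict_pi_pi,
    ← ofReal_integral_eq_lintegral_ofReal, integral_fintype_prod_eq_prod (fun _ => f),
    ENNReal.ofReal_prod_of_nonneg]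
  · refine Finset.prod_congr rfl fun i _ => ?_
    rw [withDensity_apply _ (hs i), ofReal_integral_eq_lintegral_ofReal hf.integrableOn
      (Filter.Eventually.of_forall hf0)]
  · exact fun i _ => integral_nonneg hf0
  · exact Integrable.fintype_prod_dep fun i => hf.integrableOn
  · exact Filter.Eventually.of_forall fun w => Finset.prod_nonneg fun i _ => hf0 _

/-- The factors are replaced one at a time. The truncated exponent `s.card - 1` is harmless for
empty `s`, where the prefactor vanishes. -/
lemma abs_prod_sub_pow_le {ι : Type*} (s : Finset ι) {a : ι → ℝ} {b A δ : ℝ}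
    (ha0 : ∀ i ∈ s, 0 ≤ a i) (haA : ∀ i ∈ s, a i ≤ A) (hb0 : 0 ≤ b) (hbA : b ≤ A)
    (hδ : ∀ i ∈ s, |a i - b| ≤ δ) :
    |∏ i ∈ s, a i - b ^ s.card| ≤ s.card * (A ^ (s.card - 1) * δ) := by
  classical
  induction s using Finset.induction_on with
  | empty => simp
  | insert i s his ih =>
    have ih' := ih (fun j hj => ha0 j (Finset.mem_insert_of_mem hj))
      (fun j hj => haA j (Finset.mem_insert_of_mem hj))
      (fun j hj => hδ j (Finset.mem_insert_of_mem hj))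
    rw [Finset.prod_insert his, Finset.card_insert_of_notMem his]
    have hδ0 : 0 ≤ δ := (abs_nonneg _).trans (hδ i (Finset.mem_insert_self i s))
    have h1 : a i * ∏ j ∈ s, a j - b ^ (s.card + 1)
        = (a i - b) * ∏ j ∈ s, a j + b * (∏ j ∈ s, a j - b ^ s.card) := by ring
    have hP0 : 0 ≤ ∏ j ∈ s, a j :=
      Finset.prod_nonneg fun j hj => ha0 j (Finset.mem_insert_of_mem hj)
    have hP : ∏ j ∈ s, a j ≤ A ^ s.card := by
      refine (Finset.prod_le_prod (fun j hj => ha0 j (Finset.mem_insert_of_mem hj))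
        (fun j hj => haA j (Finset.mem_insert_of_mem hj))).trans ?_
      simp
    have h2 : |(a i - b) * ∏ j ∈ s, a j| ≤ δ * A ^ s.card := by
      rw [abs_mul, abs_of_nonneg hP0]
      exact mul_le_mul (hδ i (Finset.mem_insert_self i s)) hP hP0 hδ0
    have h3 : |b * (∏ j ∈ s, a j - b ^ s.card)| ≤ A * (s.card * (A ^ (s.card - 1) * δ)) := by
      rw [abs_mul, abs_of_nonneg hb0]
      exact mul_le_mul hbA ih' (abs_nonneg _) (hb0.trans hbA)
    have h4 : A * (s.card * (A ^ (s.card - 1) * δ)) = s.card * (A ^ s.card * δ) := by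
      rcases Nat.eq_zero_or_pos s.card with h | h
      · simp [h]
      · obtain ⟨n, hn⟩ := Nat.exists_eq_succ_of_ne_zero h.ne'
        rw [hn]; simp; ring
    rw [h1]
    refine (abs_add_le _ _).trans ?_
    rw [h4] at h3
    push_cast
    nlinarith

end PiDensity

lemma measurable_finset_sup {ι α β : Type*} [MeasurableSpace α] [MeasurableSpace β]
    [SemilatticeSup β] [OrderBot β] [MeasurableSup₂ β] (s : Finset ι) {f : ι → α → β}
    (hf : ∀ i ∈ s, Measurable (f i)) : Measurable fun a => s.sup fun i => f i a := by
  classical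
  induction s using Finset.induction_on with
  | empty => simp
  | insert i s his ih =>
    simp_rw [Finset.sup_insert]
    exact (hf i (Finset.mem_insert_self i s)).sup
      (ih fun j hj => hf j (Finset.mem_insert_of_mem hj))

/-! ### Uniform points in a clipped ball. -/

section Box

open Set

variable {d : ℕ}

/-- The part of the ball around `x` that lies in the unit cube. -/
def clippedBall (x : Fin d → ℝ) (R : ℝ) : Set (Fin d → ℝ) := Metric.ball x R ∩ unitCube d

lemma clippedBall_eq {x : Fin d → ℝ} {R : ℝ} (hR : 0 < R) :
    clippedBall x R = univ.pi fun j => Metric.ball (x j) R ∩ Icc 0 1 := by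
  rw [clippedBall, ball_pi x hR, unitCube, ← pi_univ_Icc, pi_inter_distrib]
  rfl

lemma measurableSet_clippedBall {x : Fin d → ℝ} {R : ℝ} : MeasurableSet (clippedBall x R) :=
  measurableSet_ball.inter measurableSet_unitCube

lemma restrict_clippedBall {x : Fin d → ℝ} {R : ℝ} (hR : 0 < R) :
    (volume : Measure (Fin d → ℝ)).restrict (clippedBall x R)
      = Measure.pi fun j => (volume : Measure ℝ).restrict (Metric.ball (x j) R ∩ Icc 0 1) := by
  rw [clippedBall_eq hR, volume_pi, Measure.restrict_pi_pi]

lemma volume_clippedBall {x : Fin d → ℝ} {R : ℝ} (hx : x ∈ unitCube d) (hR : 0 < R) :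
    volume (clippedBall x R) = ENNReal.ofReal (∏ j, clipLen (x j) R) := by
  rw [clippedBall_eq hR, volume_pi_pi, ENNReal.ofReal_prod_of_nonneg
    fun j _ => clipLen_nonneg (mem_unitCube.1 hx j) hR.le]
  simp_rw [volume_clipped]

/-- The clipped side length in direction `j` of the box around `x` that is spanned by the
points `w`. -/
def boxLen {ι : Type*} [Fintype ι] (x : Fin d → ℝ) (w : ι → Fin d → ℝ) (j : Fin d) : ℝ :=
  clipLen (x j) ((Finset.univ.sup fun i => nndist (w i j) (x j) : NNReal) : ℝ)

lemma boxLen_nonneg {ι : Type*} [Fintype ι] {x : Fin d → ℝ} (hx : x ∈ unitCube d)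
    (w : ι → Fin d → ℝ) (j : Fin d) : 0 ≤ boxLen x w j :=
  clipLen_nonneg (mem_unitCube.1 hx j) NNReal.zero_le_coe

lemma measurable_boxLen {ι : Type*} [Fintype ι] (x : Fin d → ℝ) (j : Fin d) :
    Measurable fun w : ι → Fin d → ℝ => boxLen x w j := by
  unfold boxLen
  refine (continuous_clipLen _).measurable.comp (measurable_coe_nnreal_real.comp ?_)
  refine measurable_finset_sup _ fun i _ => ?_
  fun_prop

/-- Clipping is monotone and the supremum is attained, so a bound on the side length is a product
event in the points `w i`. This is why its distribution function is a k-th power. -/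
lemma boxLen_le_iff {ι : Type*} [Fintype ι] [Nonempty ι] (x : Fin d → ℝ)
    (w : ι → Fin d → ℝ) (j : Fin d) (s : ℝ) :
    boxLen x w j ≤ s ↔ ∀ i, clipLen (x j) |w i j - x j| ≤ s := by
  have habs : ∀ i, |w i j - x j| = ((nndist (w i j) (x j) : NNReal) : ℝ) := fun i => by
    rw [coe_nndist, Real.dist_eq]
  constructor
  · intro h i
    refine (clipLen_mono _ ?_).trans h
    rw [habs, NNReal.coe_le_coe]
    exact Finset.le_sup (f := fun i => nndist (w i j) (x j)) (Finset.mem_univ i)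
  · intro h
    obtain ⟨i, -, hi⟩ := Finset.exists_mem_eq_sup Finset.univ Finset.univ_nonempty
      (fun i => nndist (w i j) (x j))
    rw [boxLen, hi, ← habs]
    exact h i

/-- The clipped ball is a product of clipped intervals and the event constrains only the coordinate
`j`, so `volume_clipLen_le` applies to that factor. -/
lemma restrict_clippedBall_clipLen_le {x : Fin d → ℝ} {R t : ℝ} (hx : x ∈ unitCube d)
    (hR : 0 < R) (ht : t ∈ Icc (0 : ℝ) 1) (j : Fin d) :
    volume.restrict (clippedBall x R) {w | clipLen (x j) |w j - x j| ≤ t * clipLen (x j) R}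
      = ENNReal.ofReal (t * ∏ j, clipLen (x j) R) := by
  rw [restrict_clippedBall hR]
  have hm : MeasurableSet {w : ℝ | clipLen (x j) |w - x j| ≤ t * clipLen (x j) R} :=
    measurableSet_le ((continuous_clipLen _).measurable.comp (by fun_prop)) measurable_const
  have h1 := Measure.map_apply (μ := Measure.pi fun j =>
    (volume : Measure ℝ).restrict (Metric.ball (x j) R ∩ Icc 0 1)) (measurable_pi_apply j) hm
  rw [Measure.pi_map_eval, Measure.smul_apply, Measure.restrict_apply hm, inter_comm,
    volume_clipLen_le (mem_unitCube.1 hx j) hR.le ht] at h1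
  change Measure.pi _ ((fun f : Fin d → ℝ => f j) ⁻¹'
    {w : ℝ | clipLen (x j) |w - x j| ≤ t * clipLen (x j) R}) = _
  rw [← h1]
  simp only [Measure.restrict_apply_univ, volume_clipped, smul_eq_mul]
  rw [← ENNReal.ofReal_prod_of_nonneg fun j _ => clipLen_nonneg (mem_unitCube.1 hx j) hR.le,
    ← ENNReal.ofReal_mul (Finset.prod_nonneg
      fun j _ => clipLen_nonneg (mem_unitCube.1 hx j) hR.le),
    ← Finset.prod_erase_mul _ _ (Finset.mem_univ j)]
  congr 1
  ring

/-- For points uniform in the clipped box, the mean logarithm of the relative side length of the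
box spanned by them is `-1/k`. -/
lemma integral_log_boxLen {ι : Type*} [Fintype ι] {x : Fin d → ℝ} {R : ℝ}
    (hx : x ∈ unitCube d) (hR : 0 < R) (hR1 : R ≤ 1) (hι : 1 ≤ Fintype.card ι) (j : Fin d) :
    Integrable (fun w => Real.log (boxLen x w j / clipLen (x j) R))
        (Measure.pi fun _ : ι => volume.restrict (clippedBall x R)) ∧
      ∫ w, Real.log (boxLen x w j / clipLen (x j) R)
        ∂(Measure.pi fun _ : ι => volume.restrict (clippedBall x R))
        = -(∏ j, clipLen (x j) R) ^ Fintype.card ι / Fintype.card ι := by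
  have : Nonempty ι := Fintype.card_pos_iff.1 hι
  have hfin : IsFiniteMeasure (volume.restrict (clippedBall x R)) :=
    ⟨by rw [Measure.restrict_apply_univ, volume_clippedBall hx hR]; exact ENNReal.ofReal_lt_top⟩
  have hL : ∀ j, 0 < clipLen (x j) R := fun j =>
    hR.trans_le (le_clipLen (mem_unitCube.1 hx j) hR.le hR1)
  have hcdf : ∀ t ∈ Icc (0 : ℝ) 1,
      (Measure.pi fun _ : ι => volume.restrict (clippedBall x R))
        {w | boxLen x w j / clipLen (x j) R ≤ t}
        = ENNReal.ofReal ((∏ j, clipLen (x j) R) ^ Fintype.card ι * t ^ Fintype.card ι) := by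
    intro t ht
    have h1 : {w : ι → Fin d → ℝ | boxLen x w j / clipLen (x j) R ≤ t}
        = univ.pi fun _ => {w | clipLen (x j) |w j - x j| ≤ t * clipLen (x j) R} := by
      ext w
      simp only [mem_ofPred_eq, mem_pi, mem_univ, forall_const]
      rw [div_le_iff₀ (hL j), boxLen_le_iff]
    rw [h1, Measure.pi_pi]
    simp_rw [restrict_clippedBall_clipLen_le hx hR ht]
    rw [Finset.prod_const, Finset.card_univ, ← ENNReal.ofReal_pow, mul_comm t, mul_pow]
    exact mul_nonneg ht.1 (Finset.prod_nonneg fun j _ => (hL j).le)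
  refine integral_log_of_cdf_pow _ ((measurable_boxLen x j).div_const _)
    (pow_nonneg (Finset.prod_nonneg fun j _ => (hL j).le) _) hι
    (fun w => div_nonneg (boxLen_nonneg hx w j) (hL j).le) ?_ hcdf
  rw [ae_iff, ← nonpos_iff_eq_zero]
  have h2 := hcdf 1 (by simp)
  have hm : MeasurableSet {w : ι → Fin d → ℝ | boxLen x w j / clipLen (x j) R ≤ 1} :=
    measurableSet_le ((measurable_boxLen x j).div_const _) measurable_const
  have h3 := measure_compl hm (measure_ne_top (Measure.pi fun _ : ι =>
    volume.restrict (clippedBall x R)) _)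
  have h4 : {w : ι → Fin d → ℝ | ¬ boxLen x w j / clipLen (x j) R ≤ 1}
    = {w | boxLen x w j / clipLen (x j) R ≤ 1}ᶜ := rfl
  rw [h4, h3, h2, Measure.pi_univ]
  simp only [Measure.restrict_apply_univ, volume_clippedBall hx hR]
  rw [Finset.prod_const, Finset.card_univ, ← ENNReal.ofReal_pow
    (Finset.prod_nonneg fun j _ => (hL j).le)]
  simp

end Box

/-! ### The conditional mean of the logarithmic box volume. -/

section Inner

open Set

variable {d : ℕ} {p : (Fin d → ℝ) → ℝ}

lemma integral_withDensity_ofReal {α : Type*} [MeasurableSpace α] (μ : Measure α) {g : α → ℝ}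
    (hg : Measurable g) (hg0 : ∀ a, 0 ≤ g a) (f : α → ℝ) :
    ∫ a, f a ∂μ.withDensity (fun a => ENNReal.ofReal (g a)) = ∫ a, g a * f a ∂μ := by
  rw [integral_withDensity_eq_integral_toReal_smul (by exact hg.ennreal_ofReal) (by simp)]
  simp only [ENNReal.toReal_ofReal (hg0 _), smul_eq_mul]

lemma integrable_withDensity_ofReal_iff {α : Type*} [MeasurableSpace α] (μ : Measure α)
    {g : α → ℝ} (hg : Measurable g) (hg0 : ∀ a, 0 ≤ g a) (f : α → ℝ) :
    Integrable f (μ.withDensity fun a => ENNReal.ofReal (g a))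
      ↔ Integrable (fun a => g a * f a) μ := by
  rw [integrable_withDensity_iff_integrable_smul' (by exact hg.ennreal_ofReal) (by simp)]
  simp only [ENNReal.toReal_ofReal (hg0 _), smul_eq_mul]

/-- The mass that the density puts on the ball around `x` of radius `R`. -/
abbrev ballMass (p : (Fin d → ℝ) → ℝ) (x : Fin d → ℝ) (R : ℝ) : ℝ :=
  (densityMeasure p).real (Metric.ball x R)

lemma isFiniteMeasure_clippedBall (x : Fin d → ℝ) (R : ℝ) :
    IsFiniteMeasure ((volume : Measure (Fin d → ℝ)).restrict (clippedBall x R)) :=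
  ⟨by
    rw [Measure.restrict_apply_univ]
    refine (measure_mono inter_subset_right).trans_lt ?_
    rw [volume_unitCube]
    exact ENNReal.one_lt_top⟩

lemma measureReal_clippedBall {x : Fin d → ℝ} {R : ℝ} (hx : x ∈ unitCube d) (hR : 0 < R) :
    (volume.restrict (clippedBall x R)).real univ = ∏ j, clipLen (x j) R := by
  rw [measureReal_def, Measure.restrict_apply_univ, volume_clippedBall hx hR,
    ENNReal.toReal_ofReal
      (Finset.prod_nonneg fun j _ => clipLen_nonneg (mem_unitCube.1 hx j) hR.le)]

lemma abs_log_sub_log_le {a b c : ℝ} (hc : 0 < c) (ha : c ≤ a) (hb : c ≤ b) :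
    |Real.log a - Real.log b| ≤ |a - b| / c := by
  have key : ∀ {a b : ℝ}, c ≤ a → c ≤ b → Real.log a - Real.log b ≤ |a - b| / c := by
    intro a b ha hb
    have ha0 := hc.trans_le ha
    have hb0 := hc.trans_le hb
    rw [← Real.log_div ha0.ne' hb0.ne']
    refine (Real.log_le_sub_one_of_pos (div_pos ha0 hb0)).trans ?_
    have h1 : a / b - 1 = (a - b) / b := by field_simp
    rw [h1]
    calc (a - b) / b ≤ |a - b| / b := by gcongr; exact le_abs_self _
      _ ≤ |a - b| / c := by gcongr
  rw [abs_le]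
  constructor
  · have := key hb ha
    rw [abs_sub_comm] at this
    linarith
  · exact key ha hb

namespace IsAdmissibleDensity

lemma restrict_ball (hp : IsAdmissibleDensity p) (x : Fin d → ℝ) (R : ℝ) :
    (densityMeasure p).restrict (Metric.ball x R)
      = (volume.restrict (clippedBall x R)).withDensity fun y => ENNReal.ofReal (p y) := by
  rw [hp.densityMeasure_eq, restrict_withDensity measurableSet_ball,
    Measure.restrict_restrict measurableSet_ball]
  rfl

lemma ballMass_eq (hp : IsAdmissibleDensity p) (x : Fin d → ℝ) (R : ℝ) :
    ballMass p x R = ∫ y in clippedBall x R, p y := by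
  have h1 := integral_withDensity_ofReal (volume.restrict (clippedBall x R)) hp.measurable
    hp.nonneg (fun _ => 1)
  rw [← hp.restrict_ball] at h1
  simpa using h1

lemma integrableOn_clippedBall (hp : IsAdmissibleDensity p) (x : Fin d → ℝ) (R : ℝ) :
    IntegrableOn p (clippedBall x R) := hp.integrable.integrableOn

lemma mul_le_ballMass (hp : IsAdmissibleDensity p) {x : Fin d → ℝ} {R : ℝ}
    (hx : x ∈ unitCube d) (hR : 0 < R) :
    lowerConst p * ∏ j, clipLen (x j) R ≤ ballMass p x R := by
  have := isFiniteMeasure_clippedBall x R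
  rw [hp.ballMass_eq, ← measureReal_clippedBall hx hR]
  have h1 : ∫ _ in clippedBall x R, lowerConst p
      = lowerConst p * (volume.restrict (clippedBall x R)).real univ := by
    simp [mul_comm]
  rw [← h1]
  exact setIntegral_mono_on (integrable_const _) (hp.integrableOn_clippedBall x R)
    measurableSet_clippedBall fun y hy => hp.lowerConst_le hy.2

/-- Even at a corner of the cube every clipped side has length at least `R`. This later converts
mass into distance. -/
lemma pow_le_ballMass (hp : IsAdmissibleDensity p) {x : Fin d → ℝ} {R : ℝ}
    (hx : x ∈ unitCube d) (hR : 0 < R) (hR1 : R ≤ 1) :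
    lowerConst p * R ^ d ≤ ballMass p x R := by
  refine le_trans ?_ (hp.mul_le_ballMass hx hR)
  refine mul_le_mul_of_nonneg_left ?_ hp.lowerConst_pos.le
  calc R ^ d = ∏ _j : Fin d, R := by simp
    _ ≤ _ := Finset.prod_le_prod (fun _ _ => hR.le)
      fun j _ => le_clipLen (mem_unitCube.1 hx j) hR.le hR1

/-- On a clipped ball the density differs little from its mean. -/
lemma abs_sub_mean_le (hp : IsAdmissibleDensity p) {x y : Fin d → ℝ} {R : ℝ}
    (hx : x ∈ unitCube d) (hR : 0 < R) (hR1 : R ≤ 1) (hy : y ∈ clippedBall x R) :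
    |p y - ballMass p x R / ∏ j, clipLen (x j) R| ≤ 2 * gradConst p * R := by
  have := isFiniteMeasure_clippedBall x R
  have hV : 0 < ∏ j, clipLen (x j) R := Finset.prod_pos fun j _ =>
    hR.trans_le (le_clipLen (mem_unitCube.1 hx j) hR.le hR1)
  have h1 : p y - ballMass p x R / ∏ j, clipLen (x j) R
      = (∫ z in clippedBall x R, (p y - p z)) / ∏ j, clipLen (x j) R := by
    rw [integral_sub (integrable_const _) (hp.integrableOn_clippedBall x R), ← hp.ballMass_eq,
      integral_const, measureReal_clippedBall hx hR, smul_eq_mul]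
    field_simp
  have h2 := norm_setIntegral_le_of_norm_le_const (μ := volume) (s := clippedBall x R)
    (f := fun z => p y - p z) (C := 2 * gradConst p * R)
    (by simpa using measure_lt_top (volume.restrict (clippedBall x R)) univ)
    (fun z hz => by
      refine (hp.abs_sub_le hy.2 hz.2).trans ?_
      have h3 : dist y z ≤ 2 * R := by
        have h4 := Metric.mem_ball.1 hy.1
        have h5 := Metric.mem_ball'.1 hz.1
        linarith [dist_triangle y x z]
      nlinarith [hp.gradConst_nonneg])
  have h6 : volume.real (clippedBall x R) = ∏ j, clipLen (x j) R := by
    rw [← measureReal_clippedBall hx hR]; simp [measureReal_def]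
  rw [h6] at h2
  rw [h1, abs_div, abs_of_pos hV, div_le_iff₀ hV]
  exact h2

/-- The logarithmic volume of the box spanned by points sampled in a small ball is, on average,
determined by the density at the centre and the mass of the ball. -/
theorem abs_setIntegral_log_boxLen_le (hp : IsAdmissibleDensity p) {ι : Type*} [Fintype ι]
    (hι : 1 ≤ Fintype.card ι) {x : Fin d → ℝ} {R : ℝ} (hx : x ∈ unitCube d) (hR : 0 < R)
    (hR1 : R ≤ 1) :
    |∫ w in univ.pi fun _ : ι => Metric.ball x R,
        (∑ j, Real.log (boxLen x w j) + d / Fintype.card ι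
          - Real.log (ballMass p x R) + Real.log (p x)) ∂(Measure.pi fun _ => densityMeasure p)|
      ≤ (4 * d * gradConst p * (1 + gradConst p) ^ (Fintype.card ι - 1) + 2 * gradConst p)
          / lowerConst p ^ Fintype.card ι * R * ballMass p x R ^ Fintype.card ι := by
  set k := Fintype.card ι with hk
  set D := gradConst p with hD
  set c := lowerConst p with hc
  set m := ballMass p x R with hm
  set V := ∏ j, clipLen (x j) R with hVdef
  have hD0 : 0 ≤ D := hp.gradConst_nonneg
  have hc0 : 0 < c := hp.lowerConst_pos
  have hc1 : c ≤ 1 := hp.lowerConst_le_one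
  have : Nonempty ι := Fintype.card_pos_iff.1 hι
  have := hp.isProbabilityMeasure
  have := isFiniteMeasure_clippedBall x R
  have hk0 : (0 : ℝ) < k := by exact_mod_cast hι
  have hL : ∀ j, 0 < clipLen (x j) R := fun j =>
    hR.trans_le (le_clipLen (mem_unitCube.1 hx j) hR.le hR1)
  have hV : 0 < V := Finset.prod_pos fun j _ => hL j
  have hmV : c * V ≤ m := hp.mul_le_ballMass hx hR
  have hm0 : 0 < m := (mul_pos hc0 hV).trans_le hmV
  set ν := (volume : Measure (Fin d → ℝ)).restrict (clippedBall x R) with hν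
  set Q := Measure.pi fun _ : ι => ν with hQ
  set q : (ι → Fin d → ℝ) → ℝ := fun w => ∏ i, p (w i) with hq
  have hqm : Measurable q := Finset.measurable_fun_prod _ fun i _ =>
    hp.measurable.comp (measurable_pi_apply i)
  have hq0 : ∀ w, 0 ≤ q w := fun w => Finset.prod_nonneg fun i _ => hp.nonneg _
  have hrestr : (Measure.pi fun _ : ι => densityMeasure p).restrict
      (univ.pi fun _ : ι => Metric.ball x R) = Q.withDensity fun w => ENNReal.ofReal (q w) := by
    rw [Measure.restrict_pi_pi]
    simp_rw [hp.restrict_ball]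
    exact pi_withDensity_ofReal ν (hp.integrableOn_clippedBall x R) hp.nonneg
  rw [hrestr, integral_withDensity_ofReal _ hqm hq0]
  have hae : ∀ᵐ w ∂Q, ∀ i, w i ∈ clippedBall x R := by
    rw [ae_all_iff]
    intro i
    exact Measure.tendsto_eval_ae_ae.eventually (ae_restrict_mem measurableSet_clippedBall)
  have hqint : Integrable q Q := Integrable.fintype_prod_dep fun i =>
    hp.integrableOn_clippedBall x R
  have hqI : ∫ w, q w ∂Q = m ^ k := by
    rw [hq, hQ, integral_fintype_prod_eq_pow p, ← hp.ballMass_eq]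
  set G : Fin d → (ι → Fin d → ℝ) → ℝ :=
    fun j w => Real.log (boxLen x w j / clipLen (x j) R) + 1 / k with hG
  have hT := fun j => integral_log_boxLen hx hR hR1 hι j
  have hGint : ∀ j, Integrable (G j) Q := fun j => (hT j).1.add (integrable_const _)
  have hQuniv : Q.real univ = V ^ k := by
    rw [measureReal_def, hQ, Measure.pi_univ, ENNReal.toReal_prod]
    simp_rw [← measureReal_def]
    rw [measureReal_clippedBall hx hR]
    simp [hk, hVdef]
  have hGI : ∀ j, ∫ w, G j w ∂Q = 0 := by
    intro j
    rw [integral_add (hT j).1 (integrable_const _), (hT j).2, integral_const, hQuniv, smul_eq_mul]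
    simp only [← hk, ← hVdef]
    field_simp
    ring
  -- Positivity lets the logarithm of the quotient be split; the upper bound makes that logarithm
  -- nonpositive.
  have hTle : ∀ᵐ w ∂Q, ∀ j, 0 < boxLen x w j ∧ boxLen x w j ≤ clipLen (x j) R := by
    have h1 : ∀ᵐ w ∂Q, ∀ i j, w i j ≠ x j := by
      rw [ae_all_iff]
      intro i
      rw [ae_all_iff]
      intro j
      refine Measure.tendsto_eval_ae_ae.eventually
        (p := fun y : Fin d → ℝ => y j ≠ x j) ?_
      refine ae_restrict_of_ae ?_
      rw [volume_pi]
      exact Measure.ae_eval_ne (fun _ : Fin d => (volume : Measure ℝ)) j (x j)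
    filter_upwards [hae, h1] with w hw hne j
    constructor
    · obtain ⟨i⟩ := ‹Nonempty ι›
      have h2 := (boxLen_le_iff x w j _).1 le_rfl i
      refine lt_of_lt_of_le ?_ h2
      refine lt_of_lt_of_le (abs_pos.2 (sub_ne_zero.2 (hne i j))) (le_clipLen
        (mem_unitCube.1 hx j) (abs_nonneg _) ?_)
      rw [← Real.dist_eq]
      exact (dist_le_pi_dist (w i) x j).trans (dist_le_one (hw i).2 hx)
    · rw [boxLen_le_iff]
      intro i
      refine clipLen_mono _ ?_
      rw [← Real.dist_eq]
      exact (dist_le_pi_dist (w i) x j).trans (Metric.mem_ball.1 (hw i).1).le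
  have hpbar : |p x - m / V| ≤ 2 * D * R :=
    hp.abs_sub_mean_le hx hR hR1 ⟨Metric.mem_ball_self hR, hx⟩
  have hbar_lower : c ≤ m / V := by rwa [le_div_iff₀ hV]
  have hbar_upper : m / V ≤ 1 + D := by
    rw [div_le_iff₀ hV, hm, hp.ballMass_eq, hVdef, ← measureReal_clippedBall hx hR]
    have h1 : ∫ _ in clippedBall x R, (1 + D)
      = (1 + D) * (volume.restrict (clippedBall x R)).real univ := by simp [mul_comm]
    rw [← h1]
    exact integral_mono (hp.integrableOn_clippedBall x R) (integrable_const _)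
      fun y => hp.le_upper y
  set δ := (k : ℝ) * ((1 + D) ^ (k - 1) * (2 * D * R)) with hδ
  have hδ0 : 0 ≤ δ := by positivity
  have hqdiff : ∀ᵐ w ∂Q, |q w - (m / V) ^ k| ≤ δ := by
    filter_upwards [hae] with w hw
    have := abs_prod_sub_pow_le Finset.univ (a := fun i => p (w i)) (b := m / V) (A := 1 + D)
      (δ := 2 * D * R) (fun i _ => hp.nonneg _) (fun i _ => hp.le_upper _)
      (hc0.le.trans hbar_lower) hbar_upper
      (fun i _ => hp.abs_sub_mean_le hx hR hR1 (hw i))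
    rwa [Finset.card_univ] at this
  have hqle : ∀ᵐ w ∂Q, ‖q w‖ ≤ (1 + D) ^ k := by
    refine Filter.Eventually.of_forall fun w => ?_
    rw [Real.norm_of_nonneg (hq0 w)]
    refine (Finset.prod_le_prod (fun i _ => hp.nonneg _) (fun i _ => hp.le_upper _)).trans ?_
    simp [hk, hD]
  have hqGint : ∀ j, Integrable (fun w => q w * G j w) Q := fun j =>
    (hGint j).bdd_mul hqm.aestronglyMeasurable hqle
  -- Since the logarithm is nonpositive, |G| is at most its negative plus 1/k, and both terms have
  -- integral V^k / k.
  have hGabs : ∀ j, ∫ w, |G j w| ∂Q ≤ 2 * V ^ k / k := by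
    intro j
    have h1 : ∫ w, |G j w| ∂Q
        ≤ ∫ w, (-Real.log (boxLen x w j / clipLen (x j) R) + 1 / k) ∂Q := by
      refine integral_mono_ae (hGint j).abs ((hT j).1.neg.add (integrable_const _)) ?_
      filter_upwards [hTle] with w hw
      have h2 : Real.log (boxLen x w j / clipLen (x j) R) ≤ 0 :=
        Real.log_nonpos (div_nonneg (hw j).1.le (hL j).le) ((div_le_one (hL j)).2 (hw j).2)
      have h3 : (0 : ℝ) ≤ 1 / k := by positivity
      rw [hG, abs_le]
      constructor <;> simp only <;> linarith
    refine h1.trans (le_of_eq ?_)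
    rw [integral_add (f := fun w => -Real.log (boxLen x w j / clipLen (x j) R)) (hT j).1.neg
      (integrable_const _), integral_neg, (hT j).2, integral_const,
      hQuniv, smul_eq_mul]
    simp only [← hk, ← hVdef]
    ring
  have hqG : ∀ j, |∫ w, q w * G j w ∂Q| ≤ δ * (2 * V ^ k / k) := by
    intro j
    -- As `G j` has integral zero, the constant (m/V)^k may be subtracted from the weight, and only
    -- the oscillation of the density enters.
    have h1 : ∫ w, q w * G j w ∂Q = ∫ w, (q w - (m / V) ^ k) * G j w ∂Q := by
      simp_rw [sub_mul]
      rw [integral_sub (hqGint j) ((hGint j).const_mul _), integral_const_mul, hGI j]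
      ring
    rw [h1, ← Real.norm_eq_abs]
    refine (norm_integral_le_of_norm_le (g := fun w => δ * |G j w|)
      ((hGint j).abs.const_mul _) ?_).trans ?_
    · filter_upwards [hqdiff] with w hw
      rw [norm_mul, Real.norm_eq_abs, Real.norm_eq_abs]
      exact mul_le_mul_of_nonneg_right hw (abs_nonneg _)
    · rw [integral_const_mul]
      exact mul_le_mul_of_nonneg_left (hGabs j) hδ0
  -- The remaining error: the density at the centre against its mean over the clipped ball.
  set e : ℝ := Real.log (p x) - Real.log (m / V) with he
  have he_le : |e| ≤ 2 * D * R / c :=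
    (abs_log_sub_log_le hc0 (hp.lowerConst_le hx) hbar_lower).trans (by gcongr)
  have hdecomp : ∫ w, q w * (∑ j, Real.log (boxLen x w j) + d / k - Real.log m
      + Real.log (p x)) ∂Q = ∑ j, ∫ w, q w * G j w ∂Q + e * m ^ k := by
    rw [← hqI, ← integral_const_mul, ← integral_finsetSum _ fun j _ => hqGint j,
      ← integral_add (integrable_finsetSum _ fun j _ => hqGint j) (hqint.const_mul _)]
    refine integral_congr_ae ?_
    filter_upwards [hTle] with w hw
    have h1 : ∑ j, G j w = ∑ j, Real.log (boxLen x w j) - Real.log V + d / k := by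
      simp only [hG]
      rw [Finset.sum_add_distrib, hVdef, Real.log_prod fun j _ => (hL j).ne',
        ← Finset.sum_sub_distrib]
      congr 1
      · exact Finset.sum_congr rfl fun j _ => Real.log_div (hw j).1.ne' (hL j).ne'
      · simp; ring
    rw [← Finset.mul_sum, h1, he, Real.log_div hm0.ne' hV.ne']
    ring
  rw [hdecomp]
  have hVm : V ^ k ≤ m ^ k / c ^ k := by
    rw [le_div_iff₀ (pow_pos hc0 k), ← mul_pow]
    refine pow_le_pow_left₀ (by positivity) ?_ k
    linarith
  -- Since c ≤ 1 and k ≥ 1, both errors can carry the same power of `c`.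
  have hcc : 2 * D * R / c ≤ 2 * D * R / c ^ k := by
    refine div_le_div_of_nonneg_left (by positivity) (pow_pos hc0 k) ?_
    calc c ^ k ≤ c ^ 1 := pow_le_pow_of_le_one hc0.le hc1 hι
      _ = c := pow_one c
  calc |∑ j, ∫ w, q w * G j w ∂Q + e * m ^ k|
      ≤ ∑ _j : Fin d, δ * (2 * V ^ k / k) + 2 * D * R / c ^ k * m ^ k := by
        refine (abs_add_le _ _).trans (add_le_add ?_ ?_)
        · exact (Finset.abs_sum_le_sum_abs _ _).trans (Finset.sum_le_sum fun j _ => hqG j)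
        · rw [abs_mul, abs_of_pos (pow_pos hm0 k)]
          exact mul_le_mul_of_nonneg_right (he_le.trans hcc) (by positivity)
    _ = 4 * d * D * (1 + D) ^ (k - 1) * R * V ^ k + 2 * D * R / c ^ k * m ^ k := by
        rw [Finset.sum_const, Finset.card_univ, Fintype.card_fin, nsmul_eq_mul, hδ]
        field_simp
        ring
    _ ≤ 4 * d * D * (1 + D) ^ (k - 1) * R * (m ^ k / c ^ k) + 2 * D * R / c ^ k * m ^ k := by
        gcongr
    _ = _ := by field_simp

end IsAdmissibleDensity

end Inner

/-! ### Combinatorics and measurability of nearest neighbours; a majorant for the logarithms. -/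

section Neighbors

variable {d N : ℕ}

/-- The `k` nearest neighbours of `x i` among the points with index in `U`. -/
def neighborsIn (U : Finset (Fin N)) (k : ℕ) (x : Fin N → Fin d → ℝ) (i : Fin N) :
    Finset (Fin N) :=
  U.filter fun l => l ≠ i ∧
    (U.filter fun m => m ≠ i ∧ dist (x m) (x i) < dist (x l) (x i)).card < k

lemma mem_neighborsIn {U : Finset (Fin N)} {k : ℕ} {x : Fin N → Fin d → ℝ} {i l : Fin N} :
    l ∈ neighborsIn U k x i ↔ l ∈ U ∧ l ≠ i ∧
      (U.filter fun m => m ≠ i ∧ dist (x m) (x i) < dist (x l) (x i)).card < k := by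
  simp [neighborsIn]

lemma neighborsIn_univ (k : ℕ) (x : Fin N → Fin d → ℝ) (i : Fin N) :
    neighborsIn Finset.univ k x i = neighbors k x i := by
  ext l
  simp [neighborsIn, neighbors]

/-- The logarithm of the clipped side length that is formed with the points with index in `U`. -/
def logLen (U : Finset (Fin N)) (k : ℕ) (x : Fin N → Fin d → ℝ) (i : Fin N) (j : Fin d) : ℝ :=
  Real.log (clipLen (x i j)
    (((neighborsIn U k x i).sup fun l => nndist (x l j) (x i j) : NNReal) : ℝ))

lemma log_clippedSideLength (k : ℕ) (x : Fin N → Fin d → ℝ) (i : Fin N) (j : Fin d) :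
    Real.log (clippedSideLength k x i j) = logLen Finset.univ k x i j := by
  rw [logLen, neighborsIn_univ, clippedSideLength, sideLength, clipLen]
  congr 1
  ring_nf

/-- If `i` is not a neighbour of `l`, at least `k` other points are closer to `l` than `x i`.
Removing `i` can lower the rank only of points farther than `x i`, and these still have those `k`
points in front. -/
lemma neighborsIn_erase {k : ℕ} {x : Fin N → Fin d → ℝ} {i l : Fin N}
    (h : i ∉ neighborsIn Finset.univ k x l) :
    neighborsIn (Finset.univ.erase i) k x l = neighborsIn Finset.univ k x l := by
  by_cases hil : i = l
  · subst hil
    ext m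
    rw [mem_neighborsIn, mem_neighborsIn]
    have h1 : (Finset.univ.erase i).filter
          (fun m' => m' ≠ i ∧ dist (x m') (x i) < dist (x m) (x i))
        = Finset.univ.filter fun m' => m' ≠ i ∧ dist (x m') (x i) < dist (x m) (x i) := by
      ext m'; simp
    rw [h1]
    simp
  have hi : k ≤ (Finset.univ.filter
      fun m => m ≠ l ∧ dist (x m) (x l) < dist (x i) (x l)).card := by
    by_contra hlt
    exact h (mem_neighborsIn.2 ⟨Finset.mem_univ _, hil, not_le.1 hlt⟩)
  ext m
  rw [mem_neighborsIn, mem_neighborsIn]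
  constructor
  · rintro ⟨hm, hml, hcard⟩
    refine ⟨Finset.mem_univ _, hml, ?_⟩
    by_contra hge
    have hcl : dist (x i) (x l) < dist (x m) (x l) := by
      by_contra hnot
      refine hge (lt_of_le_of_lt (Finset.card_le_card ?_) hcard)
      intro m' hm'
      simp only [Finset.mem_filter, Finset.mem_univ, true_and, Finset.mem_erase, and_true] at hm' ⊢
      refine ⟨?_, hm'⟩
      rintro rfl
      exact hnot hm'.2
    refine absurd (hi.trans (Finset.card_le_card ?_)) (not_le.2 hcard)
    intro m' hm'
    simp only [Finset.mem_filter, Finset.mem_univ, true_and, Finset.mem_erase, and_true] at hm' ⊢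
    refine ⟨?_, hm'.1, hm'.2.trans hcl⟩
    rintro rfl
    exact lt_irrefl _ hm'.2
  · rintro ⟨-, hml, hcard⟩
    refine ⟨Finset.mem_erase.2 ⟨?_, Finset.mem_univ _⟩, hml, ?_⟩
    · rintro rfl
      exact h (mem_neighborsIn.2 ⟨Finset.mem_univ _, hml, hcard⟩)
    · refine lt_of_le_of_lt (Finset.card_le_card ?_) hcard
      exact Finset.filter_subset_filter _ (Finset.erase_subset _ _)

/-- All other neighbours are strictly closer than the farthest one, which has fewer than `k` closer
points. -/
lemma card_neighborsIn_le {U : Finset (Fin N)} {k : ℕ} {x : Fin N → Fin d → ℝ} {i : Fin N}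
    (hdist : ∀ m m', m ≠ i → m' ≠ i → m ≠ m' → dist (x m) (x i) ≠ dist (x m') (x i)) :
    (neighborsIn U k x i).card ≤ k := by
  rcases (neighborsIn U k x i).eq_empty_or_nonempty with h | h
  · simp [h]
  obtain ⟨l, hl, hmax⟩ := Finset.exists_max_image _ (fun l => dist (x l) (x i)) h
  have h1 := mem_neighborsIn.1 hl
  have h2 : (neighborsIn U k x i).erase l
      ⊆ U.filter fun m => m ≠ i ∧ dist (x m) (x i) < dist (x l) (x i) := by
    intro m hm
    obtain ⟨hml, hm⟩ := Finset.mem_erase.1 hm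
    have h3 := mem_neighborsIn.1 hm
    exact Finset.mem_filter.2 ⟨h3.1, h3.2.1,
      lt_of_le_of_ne (hmax m hm) (hdist m l h3.2.1 h1.2.1 hml)⟩
  have h3 := Finset.card_le_card h2
  rw [Finset.card_erase_of_mem hl] at h3
  have h4 := h1.2.2
  omega

/-- In dimension `d`, a point is among the `k` nearest neighbours of at most `k * 2 ^ d` others. -/
lemma card_indegree_le {k : ℕ} {x : Fin N → Fin d → ℝ} {i : Fin N} (hd : 1 ≤ d)
    (hcoord : ∀ m m', m ≠ m' → ∀ j, x m j ≠ x m' j) :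
    (Finset.univ.filter fun l => i ∈ neighborsIn Finset.univ k x l).card ≤ k * 2 ^ d := by
  classical
  set A := Finset.univ.filter fun l => i ∈ neighborsIn Finset.univ k x l with hA
  -- `σ` records the orthant at `x i` that contains a point. Within an orthant, let `l` be the
  -- farthest point with `x i` as a neighbour; every other such point is closer to `x l` than `x i`
  -- is, so fewer than `k` of them exist.
  set σ : Fin N → Fin d → Bool := fun l j => decide (x i j < x l j) with hσ
  have hfib : ∀ s : Fin d → Bool, (A.filter fun l => σ l = s).card ≤ k := by
    intro s
    rcases (A.filter fun l => σ l = s).eq_empty_or_nonempty with h | h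
    · simp [h]
    obtain ⟨l, hl, hmax⟩ := Finset.exists_max_image _ (fun l => dist (x l) (x i)) h
    obtain ⟨hlA, hls⟩ := Finset.mem_filter.1 hl
    have hil := mem_neighborsIn.1 (Finset.mem_filter.1 hlA).2
    have hpos : 0 < dist (x l) (x i) := by
      rw [dist_pos]
      intro h0
      exact hcoord i l hil.2.1 ⟨0, hd⟩ (by rw [h0])
    have h2 : (A.filter fun l => σ l = s).erase l
        ⊆ Finset.univ.filter fun m => m ≠ l ∧ dist (x m) (x l) < dist (x i) (x l) := by
      intro m hm
      obtain ⟨hml, hm⟩ := Finset.mem_erase.1 hm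
      obtain ⟨hmA, hms⟩ := Finset.mem_filter.1 hm
      have him := mem_neighborsIn.1 (Finset.mem_filter.1 hmA).2
      refine Finset.mem_filter.2 ⟨Finset.mem_univ _, hml, ?_⟩
      rw [dist_comm (x i), dist_pi_lt_iff hpos]
      intro j
      have hmi : |x m j - x i j| ≤ dist (x l) (x i) := by
        rw [← Real.dist_eq]; exact (dist_le_pi_dist (x m) (x i) j).trans (hmax m hm)
      have hli : |x l j - x i j| ≤ dist (x l) (x i) := by
        rw [← Real.dist_eq]; exact dist_le_pi_dist (x l) (x i) j
      have hs : (x i j < x m j) ↔ (x i j < x l j) := by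
        have : σ m j = σ l j := by rw [hms, hls]
        simpa [hσ] using this
      have hm0 := hcoord i m him.2.1 j
      have hl0 := hcoord i l hil.2.1 j
      rw [Real.dist_eq, abs_lt]
      rw [abs_le] at hmi hli
      by_cases hlt : x i j < x l j
      · have := hs.2 hlt
        constructor <;> linarith
      · have h3 : x l j < x i j := lt_of_le_of_ne (not_lt.1 hlt) hl0.symm
        have h4 : x m j < x i j := lt_of_le_of_ne (not_lt.1 fun h => hlt (hs.1 h)) hm0.symm
        constructor <;> linarith
    have h3 := Finset.card_le_card h2
    rw [Finset.card_erase_of_mem hl] at h3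
    have h4 := hil.2.2
    omega
  rw [Finset.card_eq_sum_card_fiberwise (f := σ) (t := Finset.univ) fun _ _ => by simp]
  refine (Finset.sum_le_sum fun s _ => hfib s).trans ?_
  simp [mul_comm]

/-- The points of index in `S` are those closer to `x i` than `x l`, apart from `x i` itself. -/
def IsInner (i l : Fin N) (S : Finset (Fin N)) (x : Fin N → Fin d → ℝ) : Prop :=
  ∀ m, m ≠ i → m ≠ l → (m ∈ S ↔ dist (x m) (x i) < dist (x l) (x i))

lemma IsInner.filter_eq {i l : Fin N} {S : Finset (Fin N)} {x : Fin N → Fin d → ℝ}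
    (h : IsInner i l S x) (hiS : i ∉ S) (hlS : l ∉ S) :
    (Finset.univ.filter fun m => m ≠ i ∧ dist (x m) (x i) < dist (x l) (x i)) = S := by
  ext m
  simp only [Finset.mem_filter, Finset.mem_univ, true_and]
  by_cases hmi : m = i
  · subst hmi; simp [hiS]
  by_cases hml : m = l
  · subst hml; simp [hlS]
  rw [h m hmi hml]
  exact and_iff_right hmi

/-- A point outside `S` is at least as far as `x l`, hence has all of `S` in front of it; a point of
`S` does not precede itself, so its rank is below `S.card`. -/
lemma IsInner.neighborsIn_eq {i l : Fin N} {S : Finset (Fin N)} {x : Fin N → Fin d → ℝ}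
    (h : IsInner i l S x) (hiS : i ∉ S) (hlS : l ∉ S) :
    neighborsIn Finset.univ S.card x i = S := by
  have hS := h.filter_eq hiS hlS
  ext m
  rw [mem_neighborsIn]
  constructor
  · rintro ⟨-, hmi, hcard⟩
    by_contra hmS
    have hle : dist (x l) (x i) ≤ dist (x m) (x i) := by
      by_cases hml : m = l
      · rw [hml]
      · exact not_lt.1 fun hlt => hmS ((h m hmi hml).2 hlt)
    refine absurd (Finset.card_le_card (?_ : S ⊆ _)) (not_le.2 hcard)
    intro m' hm'
    rw [← hS] at hm'
    obtain ⟨-, h1, h2⟩ := Finset.mem_filter.1 hm'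
    exact Finset.mem_filter.2 ⟨Finset.mem_univ _, h1, h2.trans_le hle⟩
  · intro hmS
    have hm := hmS
    rw [← hS] at hm
    obtain ⟨-, h1, h2⟩ := Finset.mem_filter.1 hm
    refine ⟨Finset.mem_univ _, h1, Finset.card_lt_card ?_⟩
    rw [Finset.ssubset_iff_of_subset]
    · exact ⟨m, hmS, by simp⟩
    · intro m' hm'
      obtain ⟨-, h3, h4⟩ := Finset.mem_filter.1 hm'
      rw [← hS]
      exact Finset.mem_filter.2 ⟨Finset.mem_univ _, h3, h4.trans h2⟩

/-- If the distances to `x i` are distinct, there is exactly one point with `k` points closer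
to `x i`, provided there are more than `k` points other than `x i`. -/
lemma existsUnique_card_filter {k : ℕ} {x : Fin N → Fin d → ℝ} {i : Fin N}
    (hdist : ∀ m m', m ≠ i → m' ≠ i → m ≠ m' → dist (x m) (x i) ≠ dist (x m') (x i))
    (hN : k + 2 ≤ N) :
    ∃! l, l ≠ i ∧ (Finset.univ.filter
      fun m => m ≠ i ∧ dist (x m) (x i) < dist (x l) (x i)).card = k := by
  classical
  set r : Fin N → ℕ := fun l => (Finset.univ.filter
      fun m => m ≠ i ∧ dist (x m) (x i) < dist (x l) (x i)).card with hr
  set U := Finset.univ.erase i with hU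
  have hUcard : U.card = N - 1 := by simp [hU]
  have hlt : ∀ l ∈ U, ∀ m ∈ U, dist (x l) (x i) < dist (x m) (x i) → r l < r m := by
    intro l hl m hm h
    refine Finset.card_lt_card ?_
    rw [Finset.ssubset_iff_of_subset]
    · exact ⟨l, Finset.mem_filter.2 ⟨Finset.mem_univ _, Finset.ne_of_mem_erase hl, h⟩, by simp⟩
    · intro m' hm'
      obtain ⟨-, h3, h4⟩ := Finset.mem_filter.1 hm'
      exact Finset.mem_filter.2 ⟨Finset.mem_univ _, h3, h4.trans h⟩
  have hinj : Set.InjOn r U := by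
    intro l hl m hm hlm
    by_contra hne
    rcases lt_or_gt_of_ne (hdist l m (Finset.ne_of_mem_erase hl) (Finset.ne_of_mem_erase hm) hne)
      with h | h
    · exact absurd hlm (hlt l hl m hm h).ne
    · exact absurd hlm (hlt m hm l hl h).ne'
  have hmaps : ∀ l ∈ U, r l < N - 1 := by
    intro l hl
    rw [← hUcard]
    refine Finset.card_lt_card ?_
    rw [Finset.ssubset_iff_of_subset]
    · exact ⟨l, hl, by simp⟩
    · intro m' hm'
      obtain ⟨-, h3, h4⟩ := Finset.mem_filter.1 hm'
      exact Finset.mem_erase.2 ⟨h3, Finset.mem_univ _⟩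
  -- The rank is injective on N - 1 points and takes values below N - 1, so every rank occurs.
  have himg : U.image r = Finset.range (N - 1) := by
    refine Finset.eq_of_subset_of_card_le ?_ ?_
    · intro n hn
      obtain ⟨l, hl, rfl⟩ := Finset.mem_image.1 hn
      exact Finset.mem_range.2 (hmaps l hl)
    · rw [Finset.card_image_of_injOn hinj, hUcard, Finset.card_range]
  have hk : k ∈ U.image r := by rw [himg, Finset.mem_range]; omega
  obtain ⟨l, hl, hlk⟩ := Finset.mem_image.1 hk
  refine ⟨l, ⟨Finset.ne_of_mem_erase hl, hlk⟩, ?_⟩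
  rintro m ⟨hm, hmk⟩
  exact hinj (Finset.mem_coe.2 (Finset.mem_erase.2 ⟨hm, Finset.mem_univ _⟩)) hl
    (hmk.trans hlk.symm)

lemma measurableSet_mem_neighborsIn (U : Finset (Fin N)) (k : ℕ) (i l : Fin N) :
    MeasurableSet {x : Fin N → Fin d → ℝ | l ∈ neighborsIn U k x i} := by
  simp_rw [mem_neighborsIn]
  refine (MeasurableSet.const _).inter ((MeasurableSet.const _).inter ?_)
  have h : Measurable fun x : Fin N → Fin d → ℝ =>
      (U.filter fun m => m ≠ i ∧ dist (x m) (x i) < dist (x l) (x i)).card := by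
    simp_rw [Finset.card_filter]
    refine Finset.measurable_fun_sum _ fun m _ => ?_
    have h1 : MeasurableSet {x : Fin N → Fin d → ℝ | dist (x m) (x i) < dist (x l) (x i)} :=
      measurableSet_lt (by fun_prop) (by fun_prop)
    exact Measurable.ite ((MeasurableSet.const _).inter h1) measurable_const measurable_const
  exact measurableSet_lt h measurable_const

lemma measurable_logLen (U : Finset (Fin N)) (k : ℕ) (i : Fin N) (j : Fin d) :
    Measurable fun x : Fin N → Fin d → ℝ => logLen U k x i j := by
  classical
  -- The index set depends on the sample; padding with the bottom element 0 gives a supremum over a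
  -- fixed set.
  have h1 : ∀ x : Fin N → Fin d → ℝ, (neighborsIn U k x i).sup (fun l => nndist (x l j) (x i j))
      = Finset.univ.sup fun l => if l ∈ neighborsIn U k x i then nndist (x l j) (x i j) else 0 := by
    intro x
    refine le_antisymm (Finset.sup_le fun l hl => ?_) (Finset.sup_le fun l _ => ?_)
    · refine le_trans ?_ (Finset.le_sup (Finset.mem_univ l))
      rw [if_pos hl]
    · split_ifs with hl
      · exact Finset.le_sup (f := fun l => nndist (x l j) (x i j)) hl
      · exact zero_le
  unfold logLen clipLen
  simp_rw [h1]
  have h2 : Measurable fun x : Fin N → Fin d → ℝ => Finset.univ.sup fun l =>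
      if l ∈ neighborsIn U k x i then nndist (x l j) (x i j) else 0 := by
    refine measurable_finset_sup _ fun l _ => ?_
    refine Measurable.ite (measurableSet_mem_neighborsIn U k i l) ?_ measurable_const
    fun_prop
  have h3 : Measurable fun x : Fin N → Fin d → ℝ => x i j := by fun_prop
  have h4 := measurable_coe_nnreal_real.comp h2
  exact (((h3.add h4).min measurable_const).sub ((h3.sub h4).max measurable_const)).log

/-- With Y = -log t, the part of Y above 2 log n is controlled by an exponential: for z = (Y - 2 log
n)/2 ≥ 0, Y² ≤ 8 (log n)² + 8 z² and z²/2 ≤ exp z = t^(-1/2)/n. The factor 1/n later pays for a sum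
over all sample points. -/
lemma sq_log_le {t n : ℝ} (ht : 0 < t) (ht1 : t ≤ 1) (hn : 1 ≤ n) :
    Real.log t ^ 2 ≤ 8 * Real.log n ^ 2 + 16 / n * t ^ (-(1 / 2) : ℝ) := by
  have hn0 : 0 < n := by linarith
  set Y := -Real.log t with hY
  have hY0 : 0 ≤ Y := by rw [hY]; linarith [Real.log_nonpos ht.le ht1]
  have hL : 0 ≤ Real.log n := Real.log_nonneg hn
  have hlog : Real.log t ^ 2 = Y ^ 2 := by rw [hY]; ring
  have hpos : 0 ≤ 16 / n * t ^ (-(1 / 2) : ℝ) := by positivity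
  rw [hlog]
  rcases le_total Y (2 * Real.log n) with h | h
  · nlinarith
  · have h1 := Real.quadratic_le_exp_of_nonneg (x := (Y - 2 * Real.log n) / 2) (by linarith)
    have h2 : Real.exp ((Y - 2 * Real.log n) / 2) = 1 / n * t ^ (-(1 / 2) : ℝ) := by
      rw [Real.rpow_def_of_pos ht, show (Y - 2 * Real.log n) / 2
        = -Real.log n + Real.log t * (-(1 / 2)) by rw [hY]; ring, Real.exp_add, Real.exp_neg,
        Real.exp_log hn0]
      ring
    rw [h2] at h1
    have h3 : 16 / n * t ^ (-(1 / 2) : ℝ) = 16 * (1 / n * t ^ (-(1 / 2) : ℝ)) := by ring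
    rw [h3]
    nlinarith [sq_nonneg (Y - 4 * Real.log n)]

/-- A majorant for the squared logarithm of the clipped side length. -/
def logLenBound (x : Fin N → Fin d → ℝ) (i : Fin N) (j : Fin d) : ℝ :=
  8 * Real.log N ^ 2
    + 16 / N * ∑ m ∈ Finset.univ.erase i, |x m j - x i j| ^ (-(1 / 2) : ℝ)

lemma logLenBound_nonneg (x : Fin N → Fin d → ℝ) (i : Fin N) (j : Fin d) :
    0 ≤ logLenBound x i j := by
  unfold logLenBound
  have : 0 ≤ ∑ m ∈ Finset.univ.erase i, |x m j - x i j| ^ (-(1 / 2) : ℝ) :=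
    Finset.sum_nonneg fun m _ => by positivity
  positivity

/-- The clipped length is at least the coordinate distance to any neighbour. Which point is a
neighbour is not known, so the majorant sums over all of them; it then serves every `U` at once,
including the leave-one-out sets. -/
lemma sq_logLen_le {U : Finset (Fin N)} {k : ℕ} {x : Fin N → Fin d → ℝ} {i : Fin N} {j : Fin d}
    (hx : ∀ m, x m ∈ unitCube d) (hcoord : ∀ m m', m ≠ m' → ∀ j, x m j ≠ x m' j) :
    logLen U k x i j ^ 2 ≤ logLenBound x i j := by
  have hN : (1 : ℝ) ≤ N := by
    have : 0 < N := i.pos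
    exact_mod_cast this
  have hxi := mem_unitCube.1 (hx i) j
  rcases (neighborsIn U k x i).eq_empty_or_nonempty with h | ⟨m, hm⟩
  -- Without neighbours the length is 0, and the default `Real.log 0 = 0` applies. This occurs for a
  -- leave-one-out sample when N = 2.
  · have : logLen U k x i j = 0 := by
      rw [logLen, h, Finset.sup_empty, NNReal.bot_eq_zero, NNReal.coe_zero, clipLen_zero hxi,
        Real.log_zero]
    rw [this]
    simpa using logLenBound_nonneg x i j
  have hmi : m ≠ i := (mem_neighborsIn.1 hm).2.1
  set t := |x m j - x i j| with ht
  have ht0 : 0 < t := abs_pos.2 (sub_ne_zero.2 (hcoord m i hmi j))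
  have hxm := mem_unitCube.1 (hx m) j
  have ht1 : t ≤ 1 := by rw [ht, abs_le]; constructor <;> linarith
  have hle : t ≤ clipLen (x i j)
      (((neighborsIn U k x i).sup fun l => nndist (x l j) (x i j) : NNReal) : ℝ) := by
    refine (le_clipLen hxi ht0.le ht1).trans (clipLen_mono _ ?_)
    rw [ht, ← Real.dist_eq, ← coe_nndist, NNReal.coe_le_coe]
    exact Finset.le_sup (f := fun l => nndist (x l j) (x i j)) hm
  have h1 : Real.log t ≤ logLen U k x i j := Real.log_le_log ht0 hle
  have h2 : logLen U k x i j ≤ 0 :=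
    Real.log_nonpos (ht0.le.trans hle) (clipLen_le_one _ _)
  have h3 : logLen U k x i j ^ 2 ≤ Real.log t ^ 2 := by nlinarith
  refine h3.trans ((sq_log_le ht0 ht1 hN).trans ?_)
  unfold logLenBound
  gcongr
  exact Finset.single_le_sum (f := fun m => |x m j - x i j| ^ (-(1 / 2) : ℝ))
    (fun m _ => by positivity) (Finset.mem_erase.2 ⟨hmi, Finset.mem_univ _⟩)

end Neighbors

/-! ### The law of total variance and the Efron–Stein inequality. -/

section EfronStein

lemma sq_integral_le {B : Type*} [MeasurableSpace B] {ν : Measure B} [IsProbabilityMeasure ν]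
    {u : B → ℝ} (hu : MemLp u 2 ν) : (∫ b, u b ∂ν) ^ 2 ≤ ∫ b, u b ^ 2 ∂ν := by
  have h1 := variance_nonneg u ν
  rw [variance_eq_sub hu] at h1
  simpa using h1

variable {A B : Type*} [MeasurableSpace A] [MeasurableSpace B] {μ : Measure A} {ν : Measure B}
  [IsProbabilityMeasure μ] [IsProbabilityMeasure ν]

lemma memLp_section {f : A × B → ℝ} (hf : Measurable f) (hf2 : MemLp f 2 (μ.prod ν)) :
    ∀ᵐ a ∂μ, MemLp (fun b => f (a, b)) 2 ν := by
  filter_upwards [hf2.integrable_sq.prod_right_ae] with a ha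
  exact (memLp_two_iff_integrable_sq
    (hf.comp measurable_prodMk_left).aestronglyMeasurable).2 ha

lemma memLp_integral_section {f : A × B → ℝ} (hf : Measurable f) (hf2 : MemLp f 2 (μ.prod ν)) :
    MemLp (fun a => ∫ b, f (a, b) ∂ν) 2 μ := by
  have hm : AEStronglyMeasurable (fun a => ∫ b, f (a, b) ∂ν) μ :=
    (hf.stronglyMeasurable.integral_prod_right' (ν := ν)).aestronglyMeasurable
  rw [memLp_two_iff_integrable_sq hm]
  refine hf2.integrable_sq.integral_prod_left.mono' (hm.pow 2) ?_
  filter_upwards [memLp_section hf hf2] with a ha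
  rw [Real.norm_of_nonneg (sq_nonneg _)]
  exact sq_integral_le ha

lemma variance_section_ae {f : A × B → ℝ} (hf : Measurable f) (hf2 : MemLp f 2 (μ.prod ν)) :
    (fun a => variance (fun b => f (a, b)) ν)
      =ᵐ[μ] fun a => ∫ b, f (a, b) ^ 2 ∂ν - (∫ b, f (a, b) ∂ν) ^ 2 := by
  filter_upwards [memLp_section hf hf2] with a ha
  rw [variance_eq_sub ha]
  rfl

lemma integrable_variance_section {f : A × B → ℝ} (hf : Measurable f)
    (hf2 : MemLp f 2 (μ.prod ν)) : Integrable (fun a => variance (fun b => f (a, b)) ν) μ :=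
  (hf2.integrable_sq.integral_prod_left.sub (memLp_integral_section hf hf2).integrable_sq).congr
    (variance_section_ae hf hf2).symm

/-- The law of total variance on a product space. -/
lemma variance_prod {f : A × B → ℝ} (hf : Measurable f) (hf2 : MemLp f 2 (μ.prod ν)) :
    variance f (μ.prod ν) = ∫ a, variance (fun b => f (a, b)) ν ∂μ
      + variance (fun a => ∫ b, f (a, b) ∂ν) μ := by
  have hF := memLp_integral_section hf hf2
  rw [integral_congr_ae (variance_section_ae hf hf2),
    integral_sub hf2.integrable_sq.integral_prod_left hF.integrable_sq,
    variance_eq_sub hf2, variance_eq_sub hF]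
  simp only [Pi.pow_apply]
  rw [integral_prod _ hf2.integrable_sq, integral_prod _ (hf2.integrable one_le_two)]
  ring

/-- Integrating `h` over the second variable gives a constant `c`; the variance is at most the
second moment about `c`, and Jensen's inequality on each section gives the rest. -/
lemma variance_integral_section_le {f : A × B → ℝ} (hf : Measurable f)
    (hf2 : MemLp f 2 (μ.prod ν)) {h : B → ℝ} (hh : Measurable h)
    (hh2 : MemLp (fun z : A × B => h z.2) 2 (μ.prod ν)) :
    variance (fun a => ∫ b, f (a, b) ∂ν) μ ≤ ∫ z, (f z - h z.2) ^ 2 ∂μ.prod ν := by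
  have hF := memLp_integral_section hf hf2
  have hsub : MemLp (fun z : A × B => f z - h z.2) 2 (μ.prod ν) := hf2.sub hh2
  have hsubm : Measurable fun z : A × B => f z - h z.2 := hf.sub (hh.comp measurable_snd)
  obtain ⟨a0, ha0⟩ := (memLp_section (hh.comp measurable_snd) hh2).exists
  have hhint : Integrable h ν := MemLp.integrable one_le_two ha0
  set c := ∫ b, h b ∂ν
  rw [← variance_sub_const hF.1 c]
  refine (variance_le_expectation_sq (hF.1.sub aestronglyMeasurable_const)).trans ?_
  rw [integral_prod _ hsub.integrable_sq]
  refine integral_mono_ae (hF.sub (memLp_const c)).integrable_sq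
    hsub.integrable_sq.integral_prod_left ?_
  filter_upwards [memLp_section hf hf2, memLp_section hsubm hsub] with a ha ha'
  have h1 : ∫ b, f (a, b) ∂ν - c = ∫ b, (f (a, b) - h b) ∂ν :=
    (integral_sub (ha.integrable one_le_two) hhint).symm
  simp only [Pi.pow_apply, Pi.sub_apply]
  rw [h1]
  exact sq_integral_le ha'

/-- The **Efron–Stein inequality**, in the form where the `i`-th approximation of the function is
any function that does not depend on the `i`-th variable. -/
theorem variance_pi_le_sum {E : Type*} [MeasurableSpace E] (P : Measure E)
    [IsProbabilityMeasure P] (n : ℕ) {f : (Fin n → E) → ℝ} (hf : Measurable f)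
    (hf2 : MemLp f 2 (Measure.pi fun _ => P)) {g : Fin n → (Fin n → E) → ℝ}
    (hg : ∀ i, Measurable (g i)) (hg2 : ∀ i, MemLp (g i) 2 (Measure.pi fun _ => P))
    (hgi : ∀ i x a, g i (Function.update x i a) = g i x) :
    variance f (Measure.pi fun _ => P) ≤ ∑ i, ∫ x, (f x - g i x) ^ 2 ∂Measure.pi fun _ => P := by
  induction n with
  | zero =>
    have h1 : f = fun _ => f isEmptyElim := by
      ext x; rw [Subsingleton.elim x isEmptyElim]
    rw [h1, variance_eq_sub (memLp_const _)]
    simp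
  | succ n ih =>
    set e := (MeasurableEquiv.piFinSuccAbove (fun _ : Fin (n + 1) => E) 0).symm with he
    have hmp : MeasurePreserving e (P.prod (Measure.pi fun _ : Fin n => P))
        (Measure.pi fun _ : Fin (n + 1) => P) :=
      (measurePreserving_piFinSuccAbove (fun _ : Fin (n + 1) => P) 0).symm _
    have he_apply : ∀ a y, e (a, y) = Fin.cons a y := fun a y => by
      simp [he, MeasurableEquiv.piFinSuccAbove]
      rfl
    set Q := Measure.pi fun _ : Fin n => P with hQ
    have hfe : Measurable (f ∘ e) := hf.comp e.measurable
    have hfe2 : MemLp (f ∘ e) 2 (P.prod Q) := hf2.comp_measurePreserving hmp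
    have hge : ∀ i, Measurable (g i ∘ e) := fun i => (hg i).comp e.measurable
    have hge2 : ∀ i, MemLp (g i ∘ e) 2 (P.prod Q) := fun i => (hg2 i).comp_measurePreserving hmp
    have hint : ∀ i, ∫ x, (f x - g i x) ^ 2 ∂(Measure.pi fun _ => P)
        = ∫ z, ((f ∘ e) z - (g i ∘ e) z) ^ 2 ∂P.prod Q := fun i =>
      (hmp.integral_comp' (f := e) fun x => (f x - g i x) ^ 2).symm
    have hvar : variance f (Measure.pi fun _ => P) = variance (f ∘ e) (P.prod Q) := by
      rw [← hmp.map_eq, variance_map hf.aemeasurable e.measurable.aemeasurable]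
    obtain ⟨a0⟩ : Nonempty E := nonempty_of_isProbabilityMeasure P
    -- An arbitrary value in the first slot exhibits `g 0` as a function of the other variables.
    have hg0 : ∀ z : E × (Fin n → E), (g 0 ∘ e) z = g 0 (e (a0, z.2)) := by
      rintro ⟨a, y⟩
      simp only [Function.comp_apply, he_apply]
      rw [← hgi 0 (Fin.cons a y) a0, Fin.update_cons_zero]
    -- The variance of the conditional mean is charged to `g 0`; the mean conditional variance is
    -- bounded by the induction hypothesis on each section.
    rw [hvar, variance_prod hfe hfe2, Fin.sum_univ_succ, add_comm]
    simp_rw [hint]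
    refine add_le_add ?_ ?_
    · have h1 := variance_integral_section_le hfe hfe2 (h := fun y => g 0 (e (a0, y)))
        ((hge 0).comp measurable_prodMk_left) (by
          have := hge2 0
          rwa [funext hg0] at this)
      simp_rw [hg0]
      exact h1
    · have hs2 : ∀ i : Fin n, Integrable
          (fun z => ((f ∘ e) z - (g i.succ ∘ e) z) ^ 2) (P.prod Q) :=
        fun i => (hfe2.sub (hge2 i.succ)).integrable_sq
      simp_rw [fun i : Fin n => integral_prod _ (hs2 i)]
      rw [← integral_finsetSum _ fun i _ => (hs2 i).integral_prod_left]
      refine integral_mono_ae (integrable_variance_section hfe hfe2)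
        (integrable_finsetSum _ fun i _ => (hs2 i).integral_prod_left) ?_
      have hgsec : ∀ᵐ a ∂P, ∀ i : Fin n, MemLp (fun y => (g i.succ ∘ e) (a, y)) 2 Q :=
        ae_all_iff.2 fun i => memLp_section (hge i.succ) (hge2 i.succ)
      filter_upwards [memLp_section hfe hfe2, hgsec] with a ha hga
      refine ih (hfe.comp measurable_prodMk_left) ha
        (g := fun i y => (g i.succ ∘ e) (a, y))
        (fun i => (hge i.succ).comp measurable_prodMk_left) hga fun i y b => ?_
      simp only [Function.comp_apply, he_apply]
      rw [← hgi i.succ (Fin.cons a y) b, Fin.cons_update]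

end EfronStein

/-! ### Joint laws of two and three sample points. -/

section Sample

variable {ι E : Type*} [Fintype ι] [MeasurableSpace E] (P : Measure E) [IsProbabilityMeasure P]

lemma iIndepFun_eval : iIndepFun (fun (i : ι) (x : ι → E) => x i) (Measure.pi fun _ : ι => P) :=
  iIndepFun_pi (X := fun (_ : ι) (a : E) => a) fun _ => aemeasurable_id

lemma measurePreserving_pair {m l : ι} (h : m ≠ l) :
    MeasurePreserving (fun x : ι → E => (x m, x l)) (Measure.pi fun _ : ι => P) (P.prod P) := by
  refine ⟨by fun_prop, ?_⟩
  rw [(indepFun_iff_map_prod_eq_prod_map_map (measurable_pi_apply m).aemeasurable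
    (measurable_pi_apply l).aemeasurable).1 ((iIndepFun_eval P).indepFun h), (measurePreserving_eval (fun _ : ι => P) m).map_eq,
    (measurePreserving_eval (fun _ : ι => P) l).map_eq]

lemma measurePreserving_triple {m l i : ι} (hml : m ≠ l) (hmi : m ≠ i) (hli : l ≠ i) :
    MeasurePreserving (fun x : ι → E => ((x m, x l), x i)) (Measure.pi fun _ : ι => P)
      ((P.prod P).prod P) := by
  refine ⟨by fun_prop, ?_⟩
  rw [(indepFun_iff_map_prod_eq_prod_map_map (f := fun x : ι → E => (x m, x l)) (by fun_prop)
    (measurable_pi_apply i).aemeasurable).1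
    ((iIndepFun_eval P).indepFun_prodMk (fun i => by fun_prop) m l i hmi hli),
    (measurePreserving_pair P hml).map_eq, (measurePreserving_eval (fun _ : ι => P) i).map_eq]

end Sample

/-! ### Almost sure genericity of the sample and second moments of the logarithms. -/

section Moments

open Set

variable {d N : ℕ} {p : (Fin d → ℝ) → ℝ}

/-- The law of an i.i.d. sample with density `p`. -/
abbrev sampleMeasure (N : ℕ) (p : (Fin d → ℝ) → ℝ) : Measure (Fin N → Fin d → ℝ) :=
  Measure.pi fun _ : Fin N => densityMeasure p

/-- The integral of `|s|^(-1/2)` over `[-1,1]`. -/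
def invSqrtMass : ℝ :=
  (∫⁻ s in Icc (-1 : ℝ) 1, ENNReal.ofReal (|s| ^ (-(1 / 2) : ℝ))).toReal

/-- The constant in the second moment bound for the logarithmic side lengths. -/
def momentConst (M : ℝ) : ℝ := 8 + 16 * ((1 + M) * invSqrtMass) / Real.log 2 ^ 2

namespace IsAdmissibleDensity

lemma ae_sample_mem (hp : IsAdmissibleDensity p) :
    ∀ᵐ x ∂sampleMeasure N p, ∀ m, x m ∈ unitCube d := by
  have := hp.isProbabilityMeasure
  rw [ae_all_iff]
  intro m
  exact Measure.tendsto_eval_ae_ae.eventually hp.ae_mem_unitCube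

lemma ae_sample_coord_ne (hp : IsAdmissibleDensity p) :
    ∀ᵐ x ∂sampleMeasure N p, ∀ m m', m ≠ m' → ∀ j, x m j ≠ x m' j := by
  have := hp.isProbabilityMeasure
  rw [ae_all_iff]
  intro m
  rw [ae_all_iff]
  intro m'
  by_cases h : m = m'
  · simp [h]
  rw [Filter.eventually_imp_distrib_left]
  intro _
  rw [ae_all_iff]
  intro j
  have hms : MeasurableSet {z : (Fin d → ℝ) × (Fin d → ℝ) | z.1 j ≠ z.2 j} :=
    (measurableSet_eq_fun (by fun_prop) (by fun_prop)).compl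
  refine (measurePreserving_pair (densityMeasure p) h).quasiMeasurePreserving.ae
    (p := fun z => z.1 j ≠ z.2 j) ?_
  rw [Measure.ae_prod_iff_ae_ae hms]
  refine Filter.Eventually.of_forall fun a => ?_
  rw [ae_iff]
  simpa [eq_comm] using densityMeasure_hyperplane (p := p) j (a j)

lemma ae_sample_dist_ne (hp : IsAdmissibleDensity p) (hd : 1 ≤ d) :
    ∀ᵐ x ∂sampleMeasure N p, ∀ i m m', m ≠ i → m' ≠ i → m ≠ m' →
      dist (x m) (x i) ≠ dist (x m') (x i) := by
  have := hp.isProbabilityMeasure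
  rw [ae_all_iff]
  intro i
  rw [ae_all_iff]
  intro m
  rw [ae_all_iff]
  intro m'
  by_cases h1 : m = i
  · simp [h1]
  by_cases h2 : m' = i
  · simp [h2]
  by_cases h3 : m = m'
  · simp [h3]
  have hms : MeasurableSet {z : ((Fin d → ℝ) × (Fin d → ℝ)) × (Fin d → ℝ) |
      dist z.2 z.1.1 ≠ dist z.1.2 z.1.1} :=
    (measurableSet_eq_fun (by fun_prop) (by fun_prop)).compl
  have h4 : ∀ᵐ x ∂sampleMeasure N p, dist (x m) (x i) ≠ dist (x m') (x i) := by
    -- Given `x i` and `x m'`, a tie would put `x m` on a sphere, which is null.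
    refine (measurePreserving_triple (densityMeasure p) (m := i) (l := m') (i := m)
      (Ne.symm h2) (Ne.symm h1) (Ne.symm h3)).quasiMeasurePreserving.ae
      (p := fun z => dist z.2 z.1.1 ≠ dist z.1.2 z.1.1) ?_
    rw [Measure.ae_prod_iff_ae_ae hms]
    refine Filter.Eventually.of_forall fun a => ?_
    rw [ae_iff]
    simpa using densityMeasure_sphere (p := p) hd a.1 (dist a.2 a.1)
  filter_upwards [h4] with x hx _ _ _ using hx

/-- The density is at most 1 + C₂ on the cube, whose j-th marginal is uniform on [0,1]; translating
by `a j` stays inside [-1,1]. -/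
lemma lintegral_rpow_coord_le (hp : IsAdmissibleDensity p) {a : Fin d → ℝ}
    (ha : a ∈ unitCube d) (j : Fin d) :
    ∫⁻ b, ENNReal.ofReal (|b j - a j| ^ (-(1 / 2) : ℝ)) ∂densityMeasure p
      ≤ ENNReal.ofReal ((1 + gradConst p) * invSqrtMass) := by
  have hA : 0 ≤ 1 + gradConst p := by linarith [hp.gradConst_nonneg]
  have hm : Measurable fun s : ℝ => ENNReal.ofReal (|s| ^ (-(1 / 2) : ℝ)) := by fun_prop
  have hprob : IsProbabilityMeasure ((volume : Measure ℝ).restrict (Icc 0 1)) := ⟨by simp⟩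
  refine (lintegral_mono' hp.densityMeasure_le le_rfl).trans ?_
  rw [lintegral_smul_measure, ENNReal.ofReal_mul hA, invSqrtMass,
    ENNReal.ofReal_toReal lintegral_rpow_abs_ne_top, smul_eq_mul]
  gcongr
  have hcube : (volume : Measure (Fin d → ℝ)).restrict (unitCube d)
      = Measure.pi fun _ : Fin d => (volume : Measure ℝ).restrict (Icc 0 1) := by
    rw [unitCube, ← pi_univ_Icc, volume_pi, Measure.restrict_pi_pi]
    rfl
  rw [hcube]
  have h1 := (measurePreserving_eval
    (fun _ : Fin d => (volume : Measure ℝ).restrict (Icc 0 1)) j).lintegral_comp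
    (f := fun s : ℝ => ENNReal.ofReal (|s - a j| ^ (-(1 / 2) : ℝ))) (by fun_prop)
  refine h1.le.trans ?_
  have haj := mem_unitCube.1 ha j
  rw [← lintegral_indicator measurableSet_Icc, ← lintegral_indicator measurableSet_Icc,
    ← lintegral_sub_right_eq_self ((Icc (-1 : ℝ) 1).indicator
      fun s => ENNReal.ofReal (|s| ^ (-(1 / 2) : ℝ))) (a j)]
  refine lintegral_mono fun s => ?_
  by_cases hs : s ∈ Icc (0 : ℝ) 1
  · have hs' : s - a j ∈ Icc (-1 : ℝ) 1 := ⟨by linarith [hs.1], by linarith [hs.2]⟩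
    rw [indicator_of_mem hs, indicator_of_mem hs']
  · rw [indicator_of_notMem hs]
    exact zero_le

lemma integrable_rpow_coord (hp : IsAdmissibleDensity p) {m i : Fin N} (hmi : m ≠ i)
    (j : Fin d) :
    Integrable (fun x => |x m j - x i j| ^ (-(1 / 2) : ℝ)) (sampleMeasure N p) ∧
      ∫ x, |x m j - x i j| ^ (-(1 / 2) : ℝ) ∂sampleMeasure N p
        ≤ (1 + gradConst p) * invSqrtMass := by
  have := hp.isProbabilityMeasure
  have hA : 0 ≤ (1 + gradConst p) * invSqrtMass :=
    mul_nonneg (by linarith [hp.gradConst_nonneg]) ENNReal.toReal_nonneg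
  have hm : Measurable fun x : Fin N → Fin d → ℝ => |x m j - x i j| ^ (-(1 / 2) : ℝ) := by
    fun_prop
  have h0 : ∀ x : Fin N → Fin d → ℝ, 0 ≤ |x m j - x i j| ^ (-(1 / 2) : ℝ) := fun x => by
    positivity
  have hle : ∫⁻ x, ENNReal.ofReal (|x m j - x i j| ^ (-(1 / 2) : ℝ)) ∂sampleMeasure N p
      ≤ ENNReal.ofReal ((1 + gradConst p) * invSqrtMass) := by
    have h1 := (measurePreserving_pair (densityMeasure p) (Ne.symm hmi)).lintegral_comp
      (f := fun z : (Fin d → ℝ) × (Fin d → ℝ) =>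
        ENNReal.ofReal (|z.2 j - z.1 j| ^ (-(1 / 2) : ℝ))) (by fun_prop)
    rw [h1, lintegral_prod _ (by fun_prop)]
    calc _ ≤ ∫⁻ _, ENNReal.ofReal ((1 + gradConst p) * invSqrtMass) ∂densityMeasure p := by
          refine lintegral_mono_ae ?_
          filter_upwards [hp.ae_mem_unitCube] with a ha using hp.lintegral_rpow_coord_le ha j
      _ = _ := by simp
  constructor
  · refine ⟨hm.aestronglyMeasurable, ?_⟩
    rw [hasFiniteIntegral_iff_ofReal (Filter.Eventually.of_forall h0)]
    exact hle.trans_lt ENNReal.ofReal_lt_top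
  · rw [integral_eq_lintegral_of_nonneg_ae (Filter.Eventually.of_forall h0)
      hm.aestronglyMeasurable]
    exact ENNReal.toReal_le_of_le_ofReal hA hle

lemma integrable_logLenBound (hp : IsAdmissibleDensity p) (i : Fin N) (j : Fin d) :
    Integrable (fun x => logLenBound x i j) (sampleMeasure N p) := by
  have := hp.isProbabilityMeasure
  unfold logLenBound
  refine (integrable_const _).add (Integrable.const_mul ?_ _)
  exact integrable_finsetSum _ fun m hm =>
    (hp.integrable_rpow_coord (Finset.ne_of_mem_erase hm) j).1

/-- The prefactor 16/N balances the at most N terms of bounded mean, and the resulting constant is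
absorbed into (log N)² by N ≥ 2. -/
lemma integral_logLenBound_le (hp : IsAdmissibleDensity p) {M : ℝ} (hM : gradConst p ≤ M)
    (hN : 2 ≤ N) (i : Fin N) (j : Fin d) :
    ∫ x, logLenBound x i j ∂sampleMeasure N p ≤ momentConst M * Real.log N ^ 2 := by
  have := hp.isProbabilityMeasure
  have hN0 : (0 : ℝ) < N := by positivity
  have hκ : 0 ≤ invSqrtMass := ENNReal.toReal_nonneg
  have hM0 : 0 ≤ M := hp.gradConst_nonneg.trans hM
  have hint : ∀ m ∈ Finset.univ.erase i, Integrable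
      (fun x : Fin N → Fin d → ℝ => |x m j - x i j| ^ (-(1 / 2) : ℝ)) (sampleMeasure N p) :=
    fun m hm => (hp.integrable_rpow_coord (Finset.ne_of_mem_erase hm) j).1
  unfold logLenBound
  rw [integral_add (integrable_const _) ((integrable_finsetSum _ hint).const_mul _),
    integral_const_mul (16 / (N : ℝ)), integral_finsetSum _ hint, integral_const, probReal_univ, one_smul]
  have h1 : ∑ m ∈ Finset.univ.erase i,
      ∫ x, |x m j - x i j| ^ (-(1 / 2) : ℝ) ∂sampleMeasure N p
      ≤ N * ((1 + M) * invSqrtMass) := by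
    refine (Finset.sum_le_card_nsmul _ _ ((1 + M) * invSqrtMass) fun m hm => ?_).trans ?_
    · refine (hp.integrable_rpow_coord (Finset.ne_of_mem_erase hm) j).2.trans ?_
      gcongr
    · rw [nsmul_eq_mul]
      have h2 : ((Finset.univ.erase i).card : ℝ) ≤ N := by
        have := Finset.card_le_univ (Finset.univ.erase i)
        rw [Fintype.card_fin] at this
        exact_mod_cast this
      gcongr
  have hlog2 : 0 < Real.log 2 := Real.log_pos one_lt_two
  have hlog : Real.log 2 ≤ Real.log N := Real.log_le_log two_pos (by exact_mod_cast hN)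
  have h3 : 1 ≤ Real.log N ^ 2 / Real.log 2 ^ 2 := by
    rw [one_le_div (by positivity)]
    gcongr
  have h4 : 16 * ((1 + M) * invSqrtMass)
      ≤ 16 * ((1 + M) * invSqrtMass) * (Real.log N ^ 2 / Real.log 2 ^ 2) :=
    le_mul_of_one_le_right (by positivity) h3
  calc 8 * Real.log N ^ 2 + 16 / N * ∑ m ∈ Finset.univ.erase i,
        ∫ x, |x m j - x i j| ^ (-(1 / 2) : ℝ) ∂sampleMeasure N p
      ≤ 8 * Real.log N ^ 2 + 16 / N * (N * ((1 + M) * invSqrtMass)) := by gcongr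
    _ = 8 * Real.log N ^ 2 + 16 * ((1 + M) * invSqrtMass) := by field_simp
    _ ≤ 8 * Real.log N ^ 2
        + 16 * ((1 + M) * invSqrtMass) * (Real.log N ^ 2 / Real.log 2 ^ 2) := by linarith
    _ = _ := by unfold momentConst; ring

lemma memLp_logLen (hp : IsAdmissibleDensity p) (U : Finset (Fin N)) (k : ℕ) (i : Fin N)
    (j : Fin d) : MemLp (fun x => logLen U k x i j) 2 (sampleMeasure N p) := by
  have := hp.isProbabilityMeasure
  rw [memLp_two_iff_integrable_sq (measurable_logLen U k i j).aestronglyMeasurable]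
  refine (hp.integrable_logLenBound i j).mono'
    ((measurable_logLen U k i j).pow_const 2).aestronglyMeasurable ?_
  filter_upwards [hp.ae_sample_mem, hp.ae_sample_coord_ne] with x hx hx'
  rw [Real.norm_of_nonneg (sq_nonneg _)]
  exact sq_logLen_le hx hx'

end IsAdmissibleDensity

end Moments

/-! ### Stability under leaving out a point, and the variance bound. -/

section Variance

variable {d N : ℕ} {p : (Fin d → ℝ) → ℝ}

lemma logLen_congr {U : Finset (Fin N)} {k : ℕ} {x y : Fin N → Fin d → ℝ} {l : Fin N}
    (hU : ∀ m ∈ U, x m = y m) (hl : x l = y l) (j : Fin d) :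
    logLen U k x l j = logLen U k y l j := by
  have h1 : neighborsIn U k x l = neighborsIn U k y l := by
    ext m
    rw [mem_neighborsIn, mem_neighborsIn]
    refine and_congr_right fun hm => and_congr_right fun _ => ?_
    rw [Finset.filter_congr fun m' hm' => by rw [hU m' hm', hU m hm, hl]]
  unfold logLen
  rw [h1, hl, Finset.sup_congr rfl fun m hm => by rw [hU m (mem_neighborsIn.1 hm).1]]

/-- The contribution of the point `x l` to the estimator that uses the points of index in `U`. -/
def logVol (U : Finset (Fin N)) (k : ℕ) (x : Fin N → Fin d → ℝ) (l : Fin N) : ℝ :=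
  ∑ j, logLen U k x l j

lemma estimator_eq (k : ℕ) (x : Fin N → Fin d → ℝ) :
    estimator k x = -digamma k + digamma N + ((d : ℝ) - 1) / k
      + (1 / (N : ℝ)) * ∑ i, logVol Finset.univ k x i := by
  simp only [estimator, log_clippedSideLength, logVol]

/-- The estimator with the `i`-th sample point left out. -/
def leaveOneOut (k : ℕ) (i : Fin N) (x : Fin N → Fin d → ℝ) : ℝ :=
  -digamma k + digamma N + ((d : ℝ) - 1) / k
    + (1 / (N : ℝ)) * ∑ l ∈ Finset.univ.erase i, logVol (Finset.univ.erase i) k x l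

lemma measurable_logVol (U : Finset (Fin N)) (k : ℕ) (l : Fin N) :
    Measurable fun x : Fin N → Fin d → ℝ => logVol U k x l :=
  Finset.measurable_fun_sum _ fun j _ => measurable_logLen U k l j

lemma measurable_estimator (k : ℕ) :
    Measurable fun x : Fin N → Fin d → ℝ => estimator k x := by
  simp_rw [estimator_eq]
  exact measurable_const.add ((Finset.measurable_fun_sum _ fun i _ =>
    measurable_logVol _ k i).const_mul _)

lemma measurable_leaveOneOut (k : ℕ) (i : Fin N) :
    Measurable fun x : Fin N → Fin d → ℝ => leaveOneOut k i x :=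
  measurable_const.add ((Finset.measurable_fun_sum _ fun l _ =>
    measurable_logVol _ k l).const_mul _)

lemma leaveOneOut_update (k : ℕ) (i : Fin N) (x : Fin N → Fin d → ℝ) (a : Fin d → ℝ) :
    leaveOneOut k i (Function.update x i a) = leaveOneOut k i x := by
  unfold leaveOneOut logVol
  congr 2
  refine Finset.sum_congr rfl fun l hl => Finset.sum_congr rfl fun j _ => ?_
  exact logLen_congr (fun m hm => Function.update_of_ne (Finset.ne_of_mem_erase hm) _ _)
    (Function.update_of_ne (Finset.ne_of_mem_erase hl) _ _) j

/-- By `neighborsIn_erase` only the points having `i` as a neighbour change. The leave-one-out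
version keeps the constants and the factor 1/N of sample size N, so these cancel. -/
lemma estimator_sub_leaveOneOut (k : ℕ) (i : Fin N) (x : Fin N → Fin d → ℝ) :
    estimator k x - leaveOneOut k i x = (1 / (N : ℝ)) * (logVol Finset.univ k x i
      + ∑ l ∈ Finset.univ.filter fun l => i ∈ neighborsIn Finset.univ k x l,
        (logVol Finset.univ k x l - logVol (Finset.univ.erase i) k x l)) := by
  have h1 : ∑ l ∈ Finset.univ.filter fun l => i ∈ neighborsIn Finset.univ k x l,
        (logVol Finset.univ k x l - logVol (Finset.univ.erase i) k x l)
      = ∑ l ∈ Finset.univ.erase i,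
        (logVol Finset.univ k x l - logVol (Finset.univ.erase i) k x l) := by
    refine Finset.sum_subset (fun l hl => ?_) fun l _ hl => ?_
    · refine Finset.mem_erase.2 ⟨?_, Finset.mem_univ _⟩
      exact (mem_neighborsIn.1 (Finset.mem_filter.1 hl).2).2.1.symm
    · have h2 : i ∉ neighborsIn Finset.univ k x l := fun h =>
        hl (Finset.mem_filter.2 ⟨Finset.mem_univ _, h⟩)
      rw [sub_eq_zero, logVol, logVol]
      refine Finset.sum_congr rfl fun j _ => ?_
      rw [logLen, logLen, neighborsIn_erase h2]
  rw [h1, estimator_eq, leaveOneOut, Finset.sum_sub_distrib,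
    ← Finset.add_sum_erase _ _ (Finset.mem_univ i)]
  ring

lemma sq_logVol_le {U : Finset (Fin N)} {k : ℕ} {x : Fin N → Fin d → ℝ} {l : Fin N}
    (hx : ∀ m, x m ∈ unitCube d) (hcoord : ∀ m m', m ≠ m' → ∀ j, x m j ≠ x m' j) :
    logVol U k x l ^ 2 ≤ d * ∑ j, logLenBound x l j := by
  have h1 := sq_sum_le_card_mul_sum_sq (s := (Finset.univ : Finset (Fin d)))
    (f := fun j => logLen U k x l j)
  rw [Finset.card_univ, Fintype.card_fin] at h1
  refine h1.trans ?_
  gcongr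
  exact sq_logLen_le hx hcoord

/-- The constant in the Efron–Stein bound for the estimator. -/
def stabilityConst (d k : ℕ) : ℝ := 2 * d + 8 * d * (k * 2 ^ d) * k

lemma sum_sq_estimator_sub_le {k : ℕ} {x : Fin N → Fin d → ℝ} (hd : 1 ≤ d)
    (hx : ∀ m, x m ∈ unitCube d) (hcoord : ∀ m m', m ≠ m' → ∀ j, x m j ≠ x m' j)
    (hdist : ∀ i m m', m ≠ i → m' ≠ i → m ≠ m' → dist (x m) (x i) ≠ dist (x m') (x i)) :
    ∑ i, (estimator k x - leaveOneOut k i x) ^ 2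
      ≤ stabilityConst d k / N ^ 2 * ∑ l, ∑ j, logLenBound x l j := by
  classical
  set W : Fin N → ℝ := fun l => ∑ j, logLenBound x l j with hW
  have hW0 : ∀ l, 0 ≤ W l := fun l => Finset.sum_nonneg fun j _ => logLenBound_nonneg x l j
  set A : Fin N → Finset (Fin N) :=
    fun i => Finset.univ.filter fun l => i ∈ neighborsIn Finset.univ k x l with hA
  set K : ℝ := k * 2 ^ d with hK
  have hK0 : 0 ≤ K := by positivity
  have hpt : ∀ i, (estimator k x - leaveOneOut k i x) ^ 2
      ≤ (1 / N ^ 2) * (2 * d * W i + 8 * d * K * ∑ l ∈ A i, W l) := by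
    intro i
    rw [estimator_sub_leaveOneOut, mul_pow, div_pow, one_pow]
    gcongr
    refine (add_sq_le).trans ?_
    have h1 : logVol Finset.univ k x i ^ 2 ≤ d * W i := sq_logVol_le hx hcoord
    have h2 : (∑ l ∈ A i, (logVol Finset.univ k x l - logVol (Finset.univ.erase i) k x l)) ^ 2
        ≤ K * ∑ l ∈ A i, 4 * d * W l := by
      refine sq_sum_le_card_mul_sum_sq.trans ?_
      have hcard : ((A i).card : ℝ) ≤ K := by
        have := card_indegree_le (k := k) (i := i) hd hcoord
        rw [hK]
        exact_mod_cast this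
      refine mul_le_mul hcard (Finset.sum_le_sum fun l _ => ?_)
        (Finset.sum_nonneg fun l _ => sq_nonneg _) hK0
      have h3 : logVol Finset.univ k x l ^ 2 ≤ d * W l := sq_logVol_le hx hcoord
      have h4 : logVol (Finset.univ.erase i) k x l ^ 2 ≤ d * W l := sq_logVol_le hx hcoord
      nlinarith [sq_nonneg (logVol Finset.univ k x l + logVol (Finset.univ.erase i) k x l)]
    rw [← Finset.mul_sum] at h2
    linarith
  -- Double counting: each `l` has at most `k` neighbours, hence lies in at most `k` of the sets `A
  -- i`.
  have hswap : ∑ i, ∑ l ∈ A i, W l ≤ k * ∑ l, W l := by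
    have h1 : ∑ i, ∑ l ∈ A i, W l = ∑ l, ∑ i ∈ neighborsIn Finset.univ k x l, W l :=
      Finset.sum_comm' fun i l => by simp [hA]
    rw [h1, Finset.mul_sum]
    refine Finset.sum_le_sum fun l _ => ?_
    rw [Finset.sum_const, nsmul_eq_mul]
    have h2 : ((neighborsIn Finset.univ k x l).card : ℝ) ≤ k := by
      exact_mod_cast card_neighborsIn_le (hdist l)
    exact mul_le_mul_of_nonneg_right h2 (hW0 l)
  calc ∑ i, (estimator k x - leaveOneOut k i x) ^ 2
      ≤ ∑ i, (1 / N ^ 2) * (2 * d * W i + 8 * d * K * ∑ l ∈ A i, W l) :=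
        Finset.sum_le_sum fun i _ => hpt i
    _ = (1 / N ^ 2) * (2 * d * ∑ i, W i + 8 * d * K * ∑ i, ∑ l ∈ A i, W l) := by
        rw [← Finset.mul_sum, Finset.sum_add_distrib, ← Finset.mul_sum, ← Finset.mul_sum]
    _ ≤ (1 / N ^ 2) * (2 * d * ∑ i, W i + 8 * d * K * (k * ∑ l, W l)) := by gcongr
    _ = _ := by unfold stabilityConst; ring

namespace IsAdmissibleDensity

lemma memLp_logVol (hp : IsAdmissibleDensity p) (U : Finset (Fin N)) (k : ℕ) (l : Fin N) :
    MemLp (fun x => logVol U k x l) 2 (sampleMeasure N p) :=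
  memLp_finsetSum _ fun j _ => hp.memLp_logLen U k l j

lemma memLp_estimator (hp : IsAdmissibleDensity p) (k : ℕ) :
    MemLp (fun x => estimator k x) 2 (sampleMeasure N p) := by
  have := hp.isProbabilityMeasure
  simp_rw [estimator_eq]
  have h : MemLp (fun x => (1 / (N : ℝ)) * ∑ i, logVol Finset.univ k x i) 2 (sampleMeasure N p) :=
    (memLp_finsetSum _ fun i _ => hp.memLp_logVol Finset.univ k i).const_mul _
  exact MemLp.add (f := fun _ => -digamma k + digamma N + ((d : ℝ) - 1) / k) (memLp_const _) h

lemma memLp_leaveOneOut (hp : IsAdmissibleDensity p) (k : ℕ) (i : Fin N) :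
    MemLp (fun x => leaveOneOut k i x) 2 (sampleMeasure N p) := by
  have := hp.isProbabilityMeasure
  have h : MemLp (fun x => (1 / (N : ℝ)) * ∑ l ∈ Finset.univ.erase i,
      logVol (Finset.univ.erase i) k x l) 2 (sampleMeasure N p) :=
    (memLp_finsetSum _ fun l _ => hp.memLp_logVol (Finset.univ.erase i) k l).const_mul _
  exact MemLp.add (f := fun _ => -digamma k + digamma N + ((d : ℝ) - 1) / k) (memLp_const _) h

theorem variance_estimator_le (hp : IsAdmissibleDensity p) {M : ℝ} (hM : gradConst p ≤ M)
    (hd : 1 ≤ d) (hN : 2 ≤ N) (k : ℕ) :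
    variance (fun x => estimator k x) (sampleMeasure N p)
      ≤ stabilityConst d k * d * momentConst M * (Real.log N ^ 2 / N) := by
  have := hp.isProbabilityMeasure
  have hN0 : (0 : ℝ) < N := by positivity
  have hS : 0 ≤ stabilityConst d k := by unfold stabilityConst; positivity
  have hint : ∀ i, Integrable (fun x => (estimator k x - leaveOneOut k i x) ^ 2)
      (sampleMeasure N p) := fun i =>
    ((hp.memLp_estimator k).sub (hp.memLp_leaveOneOut k i)).integrable_sq
  have hWint : ∀ l : Fin N, Integrable (fun x => ∑ j, logLenBound x l j) (sampleMeasure N p) :=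
    fun l => integrable_finsetSum _ fun j _ => hp.integrable_logLenBound l j
  refine (variance_pi_le_sum (densityMeasure p) N (measurable_estimator k)
    (hp.memLp_estimator k) (measurable_leaveOneOut k) (hp.memLp_leaveOneOut k)
    (leaveOneOut_update k)).trans ?_
  rw [← integral_finsetSum _ fun i _ => hint i]
  calc ∫ x, ∑ i, (estimator k x - leaveOneOut k i x) ^ 2 ∂sampleMeasure N p
      ≤ ∫ x, stabilityConst d k / N ^ 2 * ∑ l, ∑ j, logLenBound x l j ∂sampleMeasure N p := by
        refine integral_mono_ae (integrable_finsetSum _ fun i _ => hint i)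
          ((integrable_finsetSum _ fun l _ => hWint l).const_mul _) ?_
        filter_upwards [hp.ae_sample_mem, hp.ae_sample_coord_ne, hp.ae_sample_dist_ne hd]
          with x h1 h2 h3 using sum_sq_estimator_sub_le hd h1 h2 h3
    _ = stabilityConst d k / N ^ 2
          * ∑ l : Fin N, ∑ j, ∫ x, logLenBound x l j ∂sampleMeasure N p := by
        rw [integral_const_mul, integral_finsetSum _ fun l _ => hWint l]
        congr 1
        exact Finset.sum_congr rfl fun l _ =>
          integral_finsetSum _ fun j _ => hp.integrable_logLenBound l j
    _ ≤ stabilityConst d k / N ^ 2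
          * ∑ _l : Fin N, ∑ _j : Fin d, momentConst M * Real.log N ^ 2 := by
        gcongr with l _ j _
        exact hp.integral_logLenBound_le hM hN l j
    _ = _ := by
        simp only [Finset.sum_const, Finset.card_univ, Fintype.card_fin, nsmul_eq_mul]
        field_simp

end IsAdmissibleDensity

end Variance

/-! ### Partition of the sample space by neighbour configuration. -/

section Decomposition

variable {d N : ℕ}

/-- The pairs of a `(k+1)`-st nearest neighbour and a set of `k` nearest neighbours of the
point with index `i` that are possible. -/
def neighborConfigs (N k : ℕ) (i : Fin N) : Finset (Fin N × Finset (Fin N)) :=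
  Finset.univ.filter fun q => q.1 ≠ i ∧ i ∉ q.2 ∧ q.1 ∉ q.2 ∧ q.2.card = k

lemma mem_neighborConfigs {k : ℕ} {i : Fin N} {q : Fin N × Finset (Fin N)} :
    q ∈ neighborConfigs N k i ↔ q.1 ≠ i ∧ i ∉ q.2 ∧ q.1 ∉ q.2 ∧ q.2.card = k := by
  simp [neighborConfigs]

/-- The (k+1)-st neighbour determines the set of nearer points. Hence the events `IsInner` over all
configurations partition the sample space up to ties. -/
lemma existsUnique_config {k : ℕ} {x : Fin N → Fin d → ℝ} {i : Fin N}
    (hdist : ∀ m m', m ≠ i → m' ≠ i → m ≠ m' → dist (x m) (x i) ≠ dist (x m') (x i))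
    (hN : k + 2 ≤ N) : ∃! q, q ∈ neighborConfigs N k i ∧ IsInner i q.1 q.2 x := by
  obtain ⟨l, ⟨hli, hlk⟩, huniq⟩ := existsUnique_card_filter hdist hN
  refine ⟨(l, Finset.univ.filter fun m => m ≠ i ∧ dist (x m) (x i) < dist (x l) (x i)), ⟨?_, ?_⟩, ?_⟩
  · rw [mem_neighborConfigs]
    exact ⟨hli, by simp, by simp, hlk⟩
  · intro m hmi _
    simp [hmi]
  · rintro ⟨l', S⟩ ⟨hq, hS⟩
    obtain ⟨h1, h2, h3, h4⟩ := mem_neighborConfigs.1 hq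
    have h5 := hS.filter_eq h2 h3
    have h6 : l' = l := huniq l' ⟨h1, by rw [h5]; exact h4⟩
    subst h6
    exact Prod.ext rfl h5.symm

lemma measurableSet_isInner (i l : Fin N) (S : Finset (Fin N)) :
    MeasurableSet {x : Fin N → Fin d → ℝ | IsInner i l S x} := by
  unfold IsInner
  have h1 : ∀ m, MeasurableSet {x : Fin N → Fin d → ℝ | dist (x m) (x i) < dist (x l) (x i)} :=
    fun m => measurableSet_lt (by fun_prop) (by fun_prop)
  have h2 : ∀ m, MeasurableSet {x : Fin N → Fin d → ℝ | dist (x l) (x i) ≤ dist (x m) (x i)} :=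
    fun m => measurableSet_le (by fun_prop) (by fun_prop)
  refine MeasurableSet.congr (s := ⋂ m, {x : Fin N → Fin d → ℝ |
    m ≠ i → m ≠ l → (m ∈ S ↔ dist (x m) (x i) < dist (x l) (x i))}) ?_ ?_
  · refine MeasurableSet.iInter fun m => ?_
    by_cases hmi : m = i
    · simp [hmi]
    by_cases hml : m = l
    · simp [hml]
    by_cases hmS : m ∈ S
    · simpa [hmi, hml, hmS] using h1 m
    · simpa [hmi, hml, hmS] using h2 m
  · ext x
    simp

end Decomposition

/-! ### The Beta law of the mass of the ball on a configuration event. -/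

section ConfigLaw

open Set

variable {d N : ℕ} {p : (Fin d → ℝ) → ℝ}

namespace IsAdmissibleDensity

lemma measurable_ballMass (hp : IsAdmissibleDensity p) :
    Measurable fun z : (Fin d → ℝ) × (Fin d → ℝ) => ballMass p z.1 (dist z.2 z.1) := by
  have := hp.isProbabilityMeasure
  have hs : MeasurableSet {w : ((Fin d → ℝ) × (Fin d → ℝ)) × (Fin d → ℝ) |
      dist w.2 w.1.1 < dist w.1.2 w.1.1} := measurableSet_lt (by fun_prop) (by fun_prop)
  exact (measurable_measure_prodMk_left (ν := densityMeasure p) hs).ennreal_toReal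

lemma map_ballMass (hp : IsAdmissibleDensity p) (hd : 1 ≤ d) (x : Fin d → ℝ) :
    (densityMeasure p).map (fun y => ballMass p x (dist y x)) = volume.restrict (Icc 0 1) := by
  have := hp.isProbabilityMeasure
  exact map_measureReal_lt_eq_uniform (densityMeasure p) (D := fun y => dist y x) (by fun_prop)
    (fun _ => dist_nonneg) fun r => densityMeasure_sphere hd x r

/-- The law of the mass is uniform for every centre by `map_ballMass`, so averaging over the centre
changes nothing. -/
lemma lintegral_prod_ballMass (hp : IsAdmissibleDensity p) (hd : 1 ≤ d) {Ψ : ℝ → ENNReal}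
    (hΨ : Measurable Ψ) :
    ∫⁻ z, Ψ (ballMass p z.1 (dist z.2 z.1)) ∂(densityMeasure p).prod (densityMeasure p)
      = ∫⁻ u in Icc (0 : ℝ) 1, Ψ u := by
  have := hp.isProbabilityMeasure
  have hae : AEMeasurable (fun z : (Fin d → ℝ) × (Fin d → ℝ) =>
      Ψ (ballMass p z.1 (dist z.2 z.1))) ((densityMeasure p).prod (densityMeasure p)) :=
    (hΨ.comp hp.measurable_ballMass).aemeasurable
  have h : ∀ x : Fin d → ℝ, ∫⁻ y, Ψ (ballMass p x (dist y x)) ∂densityMeasure p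
      = ∫⁻ u in Icc (0 : ℝ) 1, Ψ u := by
    intro x
    have hmx : Measurable fun y => ballMass p x (dist y x) :=
      hp.measurable_ballMass.comp (f := fun y => (x, y)) (by fun_prop)
    rw [← hp.map_ballMass hd x, lintegral_map hΨ hmx]
  rw [lintegral_prod _ hae]
  simp_rw [h]
  simp

/-- On the event that `x l` is the `(k+1)`-st nearest neighbour of `x i`, and that `S` contains the
nearer ones, the mass of the ball reaching to `x l` follows a Beta law. -/
lemma lintegral_config (hp : IsAdmissibleDensity p) (hd : 1 ≤ d) {k n : ℕ} {i : Fin N}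
    (hN : N = k + n + 2) {q : Fin N × Finset (Fin N)} (hq : q ∈ neighborConfigs N k i)
    {Φ : ℝ → ENNReal} (hΦ : Measurable Φ) :
    ∫⁻ x in {x | IsInner i q.1 q.2 x}, Φ (ballMass p (x i) (dist (x q.1) (x i)))
        ∂sampleMeasure N p
      = ∫⁻ u in Icc (0 : ℝ) 1, ENNReal.ofReal (u ^ k * (1 - u) ^ n) * Φ u := by
  classical
  have := hp.isProbabilityMeasure
  obtain ⟨l, S⟩ := q
  obtain ⟨hli, hiS, hlS, hcard⟩ := mem_neighborConfigs.1 hq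
  simp only at hli hiS hlS hcard ⊢
  set P := densityMeasure p with hP
  let pr : Fin N → Prop := fun m => m = i ∨ m = l
  have hpi : pr i := Or.inl rfl
  have hpl : pr l := Or.inr rfl
  let T : Set (({m // pr m} → Fin d → ℝ) × ({m // ¬pr m} → Fin d → ℝ)) :=
    {w | ∀ m : {m // ¬pr m}, (m.1 ∈ S ↔ dist (w.2 m) (w.1 ⟨i, hpi⟩)
      < dist (w.1 ⟨l, hpl⟩) (w.1 ⟨i, hpi⟩))}
  have hTm : MeasurableSet T := by
    have h1 : ∀ m : {m // ¬pr m}, MeasurableSet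
        {w : ({m // pr m} → Fin d → ℝ) × ({m // ¬pr m} → Fin d → ℝ) |
          dist (w.2 m) (w.1 ⟨i, hpi⟩) < dist (w.1 ⟨l, hpl⟩) (w.1 ⟨i, hpi⟩)} :=
      fun m => measurableSet_lt (by fun_prop) (by fun_prop)
    have h2 : ∀ m : {m // ¬pr m}, MeasurableSet
        {w : ({m // pr m} → Fin d → ℝ) × ({m // ¬pr m} → Fin d → ℝ) |
          dist (w.1 ⟨l, hpl⟩) (w.1 ⟨i, hpi⟩) ≤ dist (w.2 m) (w.1 ⟨i, hpi⟩)} :=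
      fun m => measurableSet_le (by fun_prop) (by fun_prop)
    refine MeasurableSet.congr (s := ⋂ m : {m // ¬pr m},
      {w : ({m // pr m} → Fin d → ℝ) × ({m // ¬pr m} → Fin d → ℝ) | (m.1 ∈ S ↔
        dist (w.2 m) (w.1 ⟨i, hpi⟩) < dist (w.1 ⟨l, hpl⟩) (w.1 ⟨i, hpi⟩))}) ?_ ?_
    · refine MeasurableSet.iInter fun m => ?_
      by_cases hmS : m.1 ∈ S
      · simpa [hmS] using h1 m
      · simpa [hmS] using h2 m
    · ext w
      simp [T]
  have hmass : Measurable fun z : {m // pr m} → Fin d → ℝ =>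
      ballMass p (z ⟨i, hpi⟩) (dist (z ⟨l, hpl⟩) (z ⟨i, hpi⟩)) :=
    hp.measurable_ballMass.comp (g := fun z : (Fin d → ℝ) × (Fin d → ℝ) =>
      ballMass p z.1 (dist z.2 z.1)) (f := fun z : {m // pr m} → Fin d → ℝ =>
        (z ⟨i, hpi⟩, z ⟨l, hpl⟩)) (by fun_prop)
  let F : (({m // pr m} → Fin d → ℝ) × ({m // ¬pr m} → Fin d → ℝ)) → ENNReal :=
    T.indicator fun w => Φ (ballMass p (w.1 ⟨i, hpi⟩) (dist (w.1 ⟨l, hpl⟩) (w.1 ⟨i, hpi⟩)))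
  have hF : Measurable F := (hΦ.comp (hmass.comp measurable_fst)).indicator hTm
  have hmp := measurePreserving_piEquivPiSubtypeProd (fun _ : Fin N => P) pr
  have h1 : ∫⁻ x in {x | IsInner i l S x}, Φ (ballMass p (x i) (dist (x l) (x i)))
        ∂sampleMeasure N p
      = ∫⁻ x, F (MeasurableEquiv.piEquivPiSubtypeProd (fun _ : Fin N => Fin d → ℝ) pr x)
        ∂sampleMeasure N p := by
    rw [← lintegral_indicator (measurableSet_isInner i l S)]
    refine lintegral_congr fun x => ?_
    have hiff : MeasurableEquiv.piEquivPiSubtypeProd (fun _ : Fin N => Fin d → ℝ) pr x ∈ T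
        ↔ IsInner i l S x := by
      constructor
      · intro h m hmi hml
        exact h ⟨m, fun h' => h'.elim hmi hml⟩
      · intro h m
        exact h m.1 (fun h' => m.2 (Or.inl h')) fun h' => m.2 (Or.inr h')
    by_cases hx : IsInner i l S x
    · rw [indicator_of_mem (show x ∈ {x | IsInner i l S x} from hx)]
      simp only [F]
      rw [indicator_of_mem (hiff.2 hx)]
      rfl
    · rw [indicator_of_notMem (show x ∉ {x | IsInner i l S x} from hx)]
      simp only [F]
      rw [indicator_of_notMem fun h => hx (hiff.1 h)]
  rw [h1, hmp.lintegral_comp hF, lintegral_prod _ hF.aemeasurable]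
  have hcardS : (Finset.univ.filter fun m : {m // ¬pr m} => m.1 ∈ S).card = k := by
    rw [← hcard]
    refine Finset.card_bij (fun m _ => m.1) (fun m hm => (Finset.mem_filter.1 hm).2)
      (fun m _ m' _ h => Subtype.ext h) fun m hm => ?_
    refine ⟨⟨m, ?_⟩, Finset.mem_filter.2 ⟨Finset.mem_univ _, hm⟩, rfl⟩
    rintro (rfl | rfl)
    · exact hiS hm
    · exact hlS hm
  have hcardrest : Fintype.card {m // ¬pr m} = k + n := by
    have h2 : Fintype.card {m // ¬pr m} = (Finset.univ \ {i, l} : Finset (Fin N)).card := by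
      rw [Fintype.card_subtype]
      congr 1
      ext m
      simp [pr]
    rw [h2, Finset.card_sdiff_of_subset (Finset.subset_univ _), Finset.card_univ,
      Fintype.card_fin, Finset.card_pair hli.symm, hN]
    rfl
  have hcardSc : (Finset.univ.filter fun m : {m // ¬pr m} => ¬ m.1 ∈ S).card = n := by
    have h3 := Finset.card_filter_add_card_filter_not (s := Finset.univ)
      (fun m : {m // ¬pr m} => m.1 ∈ S)
    rw [hcardS, Finset.card_univ, hcardrest] at h3
    omega
  -- With the points i and l fixed, each of the `k` points in `S` lies in the ball with probability
  -- u and each of the `n` others outside it with probability 1 - u.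
  have hinner : ∀ z : {m // pr m} → Fin d → ℝ,
      ∫⁻ r, F (z, r) ∂Measure.pi (fun _ : {m // ¬pr m} => P)
        = (fun u : ℝ => ENNReal.ofReal (u ^ k * (1 - u) ^ n) * Φ u)
          (ballMass p (z ⟨i, hpi⟩) (dist (z ⟨l, hpl⟩) (z ⟨i, hpi⟩))) := by
    intro z
    set R := dist (z ⟨l, hpl⟩) (z ⟨i, hpi⟩) with hR
    set B := Metric.ball (z ⟨i, hpi⟩) R with hB
    set u := ballMass p (z ⟨i, hpi⟩) R with hu
    have hu0 : 0 ≤ u := measureReal_nonneg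
    have hu1 : 0 ≤ 1 - u := sub_nonneg.2 measureReal_le_one
    have h4 : ∀ r, F (z, r) = (univ.pi fun m : {m // ¬pr m} => if m.1 ∈ S then B else Bᶜ).indicator
        (fun _ => Φ u) r := by
      intro r
      have hiff : (z, r) ∈ T ↔ r ∈ univ.pi fun m : {m // ¬pr m} => if m.1 ∈ S then B else Bᶜ := by
        simp only [T, mem_ofPred_eq, mem_pi, mem_univ, forall_const]
        refine forall_congr' fun m => ?_
        by_cases hm : m.1 ∈ S
        · simp [hm, hB, hR]
        · simp [hm, hB, hR]
      by_cases hr : (z, r) ∈ T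
      · simp only [F]
        rw [indicator_of_mem hr, indicator_of_mem (hiff.1 hr)]
      · simp only [F]
        rw [indicator_of_notMem hr, indicator_of_notMem fun h => hr (hiff.2 h)]
    have hBm : MeasurableSet B := measurableSet_ball
    have hms : MeasurableSet (univ.pi fun m : {m // ¬pr m} => if m.1 ∈ S then B else Bᶜ) := by
      refine MeasurableSet.univ_pi fun m => ?_
      split_ifs
      · exact hBm
      · exact hBm.compl
    simp_rw [h4]
    rw [lintegral_indicator hms, setLIntegral_const, Measure.pi_pi, mul_comm]
    congr 1
    have h5 : ∀ m : {m // ¬pr m}, P (if m.1 ∈ S then B else Bᶜ)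
        = ENNReal.ofReal (if m.1 ∈ S then u else 1 - u) := by
      intro m
      split_ifs
      · rw [hu, ballMass, ofReal_measureReal]
      · rw [hu, ballMass, ← probReal_compl_eq_one_sub hBm, ofReal_measureReal]
    simp_rw [h5]
    rw [← ENNReal.ofReal_prod_of_nonneg fun m _ => by split_ifs <;> assumption,
      Finset.prod_ite, Finset.prod_const, Finset.prod_const, hcardS, hcardSc]
  simp_rw [hinner]
  have hne : (⟨i, hpi⟩ : {m // pr m}) ≠ ⟨l, hpl⟩ := fun h => hli (Subtype.ext_iff.1 h).symm
  have hΨ : Measurable fun u : ℝ => ENNReal.ofReal (u ^ k * (1 - u) ^ n) * Φ u := by fun_prop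
  have h6 := (measurePreserving_pair P hne).lintegral_comp (hΨ.comp hp.measurable_ballMass)
  exact h6.trans (hp.lintegral_prod_ballMass hd hΨ)

/-- The `max` changes nothing on [0,1]; it makes the density nonnegative everywhere, as
`integral_withDensity_ofReal` requires. -/
lemma map_config (hp : IsAdmissibleDensity p) (hd : 1 ≤ d) {k n : ℕ} {i : Fin N}
    (hN : N = k + n + 2) {q : Fin N × Finset (Fin N)} (hq : q ∈ neighborConfigs N k i) :
    ((sampleMeasure N p).restrict {x | IsInner i q.1 q.2 x}).map
        (fun x => ballMass p (x i) (dist (x q.1) (x i)))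
      = (volume.restrict (Icc (0 : ℝ) 1)).withDensity
        fun u => ENNReal.ofReal (max (u ^ k * (1 - u) ^ n) 0) := by
  have hm : Measurable fun x : Fin N → Fin d → ℝ => ballMass p (x i) (dist (x q.1) (x i)) :=
    hp.measurable_ballMass.comp (g := fun z : (Fin d → ℝ) × (Fin d → ℝ) =>
      ballMass p z.1 (dist z.2 z.1)) (f := fun x : Fin N → Fin d → ℝ => (x i, x q.1)) (by fun_prop)
  ext s hs
  rw [← lintegral_indicator_one hs, lintegral_map (measurable_one.indicator hs) hm,
    hp.lintegral_config hd hN hq (measurable_one.indicator hs), withDensity_apply _ hs,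
    ← lintegral_indicator hs]
  refine lintegral_congr fun u => ?_
  by_cases hu : u ∈ s
  · simp [hu]
  · simp [hu]

lemma integral_config (hp : IsAdmissibleDensity p) (hd : 1 ≤ d) {k n : ℕ} {i : Fin N}
    (hN : N = k + n + 2) {q : Fin N × Finset (Fin N)} (hq : q ∈ neighborConfigs N k i)
    {φ : ℝ → ℝ} (hφ : Measurable φ)
    (hint : IntervalIntegrable (fun u => u ^ k * (1 - u) ^ n * φ u) volume 0 1) :
    IntegrableOn (fun x => φ (ballMass p (x i) (dist (x q.1) (x i))))
        {x | IsInner i q.1 q.2 x} (sampleMeasure N p) ∧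
      ∫ x in {x | IsInner i q.1 q.2 x}, φ (ballMass p (x i) (dist (x q.1) (x i)))
        ∂sampleMeasure N p = ∫ u in (0 : ℝ)..1, u ^ k * (1 - u) ^ n * φ u := by
  have hm : Measurable fun x : Fin N → Fin d → ℝ => ballMass p (x i) (dist (x q.1) (x i)) :=
    hp.measurable_ballMass.comp (g := fun z : (Fin d → ℝ) × (Fin d → ℝ) =>
      ballMass p z.1 (dist z.2 z.1)) (f := fun x : Fin N → Fin d → ℝ => (x i, x q.1)) (by fun_prop)
  have hw : Measurable fun u : ℝ => max (u ^ k * (1 - u) ^ n) 0 := by fun_prop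
  have hmax : ∀ u ∈ Icc (0 : ℝ) 1,
      max (u ^ k * (1 - u) ^ n) 0 * φ u = u ^ k * (1 - u) ^ n * φ u := fun u hu => by
    rw [max_eq_left (mul_nonneg (pow_nonneg hu.1 _) (pow_nonneg (sub_nonneg.2 hu.2) _))]
  have hI : IntegrableOn (fun u => max (u ^ k * (1 - u) ^ n) 0 * φ u) (Icc (0 : ℝ) 1) := by
    rw [integrableOn_congr_fun hmax measurableSet_Icc,
      ← intervalIntegrable_iff_integrableOn_Icc_of_le zero_le_one]
    exact hint
  constructor
  · have h1 : Integrable φ (((sampleMeasure N p).restrict {x | IsInner i q.1 q.2 x}).map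
        (fun x => ballMass p (x i) (dist (x q.1) (x i)))) := by
      rw [hp.map_config hd hN hq,
        integrable_withDensity_ofReal_iff _ hw fun u => le_max_right _ _]
      exact hI
    exact (integrable_map_measure hφ.aestronglyMeasurable hm.aemeasurable).1 h1
  · rw [← integral_map (φ := fun x : Fin N → Fin d → ℝ => ballMass p (x i) (dist (x q.1) (x i)))
      hm.aemeasurable hφ.aestronglyMeasurable, hp.map_config hd hN hq,
      integral_withDensity_ofReal _ hw fun u => le_max_right _ _,
      setIntegral_congr_fun measurableSet_Icc hmax, integral_Icc_eq_integral_Ioc,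
      ← intervalIntegral.integral_of_le zero_le_one]

end IsAdmissibleDensity

end ConfigLaw

/-! ### The mean contribution of one sample point. -/

section Bias

open Set

variable {d N : ℕ} {p : (Fin d → ℝ) → ℝ}

lemma IsInner.logLen_eq {i l : Fin N} {S : Finset (Fin N)} {x : Fin N → Fin d → ℝ}
    (h : IsInner i l S x) (hiS : i ∉ S) (hlS : l ∉ S) (j : Fin d) :
    logLen Finset.univ S.card x i j
      = Real.log (boxLen (x i) (fun m : {m // m ∈ S} => x m) j) := by
  rw [logLen, h.neighborsIn_eq hiS hlS, boxLen]
  congr 3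
  rw [Finset.univ_eq_attach, Finset.sup_attach S fun l => nndist (x l j) (x i j)]

/-- The constant in the conditional bias estimate. -/
def biasConst (d k : ℕ) (D : ℝ) : ℝ := 4 * d * D * (1 + D) ^ (k - 1) + 2 * D

/-- For z = R c n^(1/d) one has z ≤ 1 + z^d, and z^d ≤ n m because c^d ≤ c. The bound is linear in
the mass, so only the mean of the Beta law is needed and no fractional moment. -/
lemma le_of_mul_pow_le {c R m n : ℝ} (hd : 1 ≤ d) (hc : 0 < c) (hc1 : c ≤ 1) (hR : 0 ≤ R)
    (hn : 0 < n) (h : c * R ^ d ≤ m) : R ≤ (c * n ^ (1 / (d : ℝ)))⁻¹ * (1 + n * m) := by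
  set t := n ^ (1 / (d : ℝ)) with ht
  have ht0 : 0 < t := Real.rpow_pos_of_pos hn _
  have htd : t ^ d = n := by
    rw [ht, one_div, Real.rpow_inv_natCast_pow hn.le (by omega)]
  have hm : 0 ≤ m := le_trans (by positivity) h
  rw [inv_mul_eq_div, le_div_iff₀ (by positivity)]
  rcases le_total (R * (c * t)) 1 with h1 | h1
  · nlinarith [mul_nonneg hn.le hm]
  · have h2 : R * (c * t) ≤ (R * (c * t)) ^ d := le_self_pow₀ h1 (by omega)
    have h3 : (R * (c * t)) ^ d = c ^ d * R ^ d * n := by rw [← htd]; ring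
    have h4 : c ^ d ≤ c := pow_le_of_le_one hc.le hc1 (by omega)
    have h5 : c ^ d * R ^ d * n ≤ m * n := by
      gcongr
      refine le_trans ?_ h
      gcongr
    linarith

lemma integral_add_const_sub {α : Type*} [MeasurableSpace α] {ν : Measure α} [IsFiniteMeasure ν]
    {f g : α → ℝ} {c : ℝ} (hf : Integrable f ν) (hg : Integrable g ν) :
    ∫ a, (f a + (c * 1 - g a)) ∂ν = ∫ a, f a ∂ν + (c * ∫ _, (1 : ℝ) ∂ν - ∫ a, g a ∂ν) := by
  rw [integral_add (g := fun a => c * 1 - g a) hf ((integrable_const _).sub hg), integral_sub (integrable_const _) hg,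
    integral_const_mul]

namespace IsAdmissibleDensity

lemma integrable_logVol (hp : IsAdmissibleDensity p) (U : Finset (Fin N)) (k : ℕ) (i : Fin N) :
    Integrable (fun x => logVol U k x i) (sampleMeasure N p) := by
  have := hp.isProbabilityMeasure
  exact (hp.memLp_logVol U k i).integrable one_le_two

lemma integrable_log_eval (hp : IsAdmissibleDensity p) (i : Fin N) :
    Integrable (fun x => Real.log (p (x i))) (sampleMeasure N p) := by
  have := hp.isProbabilityMeasure
  exact integrable_comp_eval (μ := fun _ : Fin N => densityMeasure p) (i := i) hp.integrable_log

lemma integral_log_eval (hp : IsAdmissibleDensity p) (i : Fin N) :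
    ∫ x, Real.log (p (x i)) ∂sampleMeasure N p = -entropy p := by
  have := hp.isProbabilityMeasure
  rw [← hp.integral_log_eq]
  exact integral_comp_eval (μ := fun _ : Fin N => densityMeasure p) (i := i)
    hp.integrable_log.aestronglyMeasurable

lemma integrable_dist (hp : IsAdmissibleDensity p) (l i : Fin N) :
    Integrable (fun x => dist (x l) (x i)) (sampleMeasure N p) := by
  have := hp.isProbabilityMeasure
  have hm : Measurable fun x : Fin N → Fin d → ℝ => dist (x l) (x i) := by fun_prop
  refine Integrable.of_bound (C := 1) hm.aestronglyMeasurable ?_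
  filter_upwards [hp.ae_sample_mem] with x hx
  rw [Real.norm_of_nonneg dist_nonneg]
  exact dist_le_one (hx l) (hx i)

/-- With all points outside `S` fixed, those of `S` range independently over the ball around `x i`
that reaches to the (k+1)-st neighbour, and `abs_setIntegral_log_boxLen_le` applies. Its factor m^k
is the probability that they all fall there, so the bound integrates back to the radius over the
event. -/
lemma abs_setIntegral_config_le (hp : IsAdmissibleDensity p) (hd : 1 ≤ d) {k n : ℕ} (hk : 1 ≤ k)
    {i : Fin N} (hN : N = k + n + 2) {q : Fin N × Finset (Fin N)}
    (hq : q ∈ neighborConfigs N k i) :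
    |∫ x in {x | IsInner i q.1 q.2 x}, (logVol Finset.univ k x i + d / k
        - Real.log (ballMass p (x i) (dist (x q.1) (x i))) + Real.log (p (x i)))
        ∂sampleMeasure N p|
      ≤ biasConst d k (gradConst p) / lowerConst p ^ k
        * ∫ x in {x | IsInner i q.1 q.2 x}, dist (x q.1) (x i) ∂sampleMeasure N p := by
  classical
  have := hp.isProbabilityMeasure
  have hintlog := (hp.integral_config hd hN hq Real.measurable_log
    (intervalIntegrable_pow_mul_log k n)).1
  obtain ⟨l, S⟩ := q
  obtain ⟨hli, hiS, hlS, hcard⟩ := mem_neighborConfigs.1 hq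
  simp only at hli hiS hlS hcard hintlog ⊢
  set P := densityMeasure p with hP
  set C := biasConst d k (gradConst p) / lowerConst p ^ k with hC
  let pr : Fin N → Prop := fun m => m ∈ S
  let e := MeasurableEquiv.piEquivPiSubtypeProd (fun _ : Fin N => Fin d → ℝ) pr
  have hmp : MeasurePreserving e (sampleMeasure N p)
    ((Measure.pi fun _ : {m // pr m} => P).prod (Measure.pi fun _ : {m // ¬pr m} => P)) := by
    convert! measurePreserving_piEquivPiSubtypeProd (fun _ : Fin N => P) pr
  let A : Set (Fin N → Fin d → ℝ) := {x | IsInner i l S x}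
  have hAm : MeasurableSet A := measurableSet_isInner i l S
  -- The event factors: `B` constrains only the points outside `S`, and given these, `D b` is a
  -- product of balls for the points of `S`.
  let B : Set ({m // ¬pr m} → Fin d → ℝ) := {b | ∀ m : {m // ¬pr m}, m.1 ≠ i → m.1 ≠ l →
    dist (b ⟨l, hlS⟩) (b ⟨i, hiS⟩) ≤ dist (b m) (b ⟨i, hiS⟩)}
  let D : ({m // ¬pr m} → Fin d → ℝ) → Set ({m // pr m} → Fin d → ℝ) := fun b =>
    univ.pi fun _ => Metric.ball (b ⟨i, hiS⟩) (dist (b ⟨l, hlS⟩) (b ⟨i, hiS⟩))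
  have hmem : ∀ x, x ∈ A ↔ (e x).2 ∈ B ∧ (e x).1 ∈ D (e x).2 := by
    intro x
    constructor
    · intro h
      refine ⟨fun m hmi hml => not_lt.1 fun hlt => m.2 ((h m.1 hmi hml).2 hlt), fun m _ => ?_⟩
      refine (h m.1 ?_ ?_).1 m.2
      · intro h'; exact hiS (h' ▸ m.2)
      · intro h'; exact hlS (h' ▸ m.2)
    · rintro ⟨h1, h2⟩ m hmi hml
      constructor
      · intro hmS
        exact h2 ⟨m, hmS⟩ (mem_univ _)
      · intro hlt
        by_contra hmS
        exact absurd (h1 ⟨m, hmS⟩ hmi hml) (not_le.2 hlt)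
  let H : (Fin N → Fin d → ℝ) → ℝ := fun x => logVol Finset.univ k x i + d / k
        - Real.log (ballMass p (x i) (dist (x l) (x i))) + Real.log (p (x i))
  have hHint : Integrable (A.indicator H) (sampleMeasure N p) := by
    rw [integrable_indicator_iff hAm]
    exact (((hp.integrable_logVol _ k i).integrableOn.add (integrable_const _)).sub hintlog).add
      (hp.integrable_log_eval i).integrableOn
  have hRint : Integrable (A.indicator fun x => dist (x l) (x i)) (sampleMeasure N p) := by
    rw [integrable_indicator_iff hAm]
    exact (hp.integrable_dist l i).integrableOn
  have hswap : ∀ G : (Fin N → Fin d → ℝ) → ℝ, Integrable (A.indicator G) (sampleMeasure N p) →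
      Integrable (fun w => A.indicator G (e.symm w)) ((Measure.pi fun _ : {m // pr m} => P).prod
        (Measure.pi fun _ : {m // ¬pr m} => P)) ∧
      ∫ x in A, G x ∂sampleMeasure N p = ∫ b, ∫ a, A.indicator G (e.symm (a, b))
        ∂(Measure.pi fun _ : {m // pr m} => P) ∂(Measure.pi fun _ : {m // ¬pr m} => P) := by
    intro G hG
    have h1 : Integrable (fun w => A.indicator G (e.symm w))
        ((Measure.pi fun _ : {m // pr m} => P).prod (Measure.pi fun _ : {m // ¬pr m} => P)) :=
      (hmp.symm e).integrable_comp_of_integrable hG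
    refine ⟨h1, ?_⟩
    rw [← integral_indicator hAm, ← (hmp.symm e).integral_comp', integral_prod_symm _ h1]
  obtain ⟨hH1, hH2⟩ := hswap H hHint
  obtain ⟨hR1, hR2⟩ := hswap _ hRint
  change |∫ x in A, H x ∂sampleMeasure N p| ≤ C * ∫ x in A, dist (x l) (x i) ∂sampleMeasure N p
  rw [hH2, hR2, ← integral_const_mul, ← Real.norm_eq_abs]
  have hne : (⟨i, hiS⟩ : {m // ¬pr m}) ≠ ⟨l, hlS⟩ := fun h => hli (Subtype.ext_iff.1 h).symm
  have haepos : ∀ᵐ b ∂(Measure.pi fun _ : {m // ¬pr m} => P),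
      dist (b ⟨l, hlS⟩) (b ⟨i, hiS⟩) ≠ 0 := by
    have hms : MeasurableSet {z : (Fin d → ℝ) × (Fin d → ℝ) | dist z.2 z.1 ≠ 0} :=
      (measurableSet_eq_fun (by fun_prop) (by fun_prop)).compl
    refine (measurePreserving_pair P hne).quasiMeasurePreserving.ae
      (p := fun z => dist z.2 z.1 ≠ 0) ?_
    rw [Measure.ae_prod_iff_ae_ae hms]
    refine Filter.Eventually.of_forall fun a => ?_
    rw [ae_iff]
    have := densityMeasure_sphere (p := p) hd a 0
    simpa only [ne_eq, not_not] using this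
  have haecube : ∀ᵐ b ∂(Measure.pi fun _ : {m // ¬pr m} => P), ∀ m, b m ∈ unitCube d := by
    rw [ae_all_iff]
    intro m
    exact Measure.tendsto_eval_ae_ae.eventually hp.ae_mem_unitCube
  refine norm_integral_le_of_norm_le (hR1.integral_prod_right.const_mul C) ?_
  filter_upwards [haepos, haecube] with b hb hbc
  set R := dist (b ⟨l, hlS⟩) (b ⟨i, hiS⟩) with hR
  have hRpos : 0 < R := lt_of_le_of_ne dist_nonneg (Ne.symm hb)
  by_cases hbB : b ∈ B
  swap
  · have h0 : ∀ (G : (Fin N → Fin d → ℝ) → ℝ) a, A.indicator G (e.symm (a, b)) = 0 := by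
      intro G a
      refine indicator_of_notMem (fun h => hbB ?_) _
      have := ((hmem _).1 h).1
      rwa [e.apply_symm_apply] at this
    simp [h0]
  have hDm : MeasurableSet (D b) := MeasurableSet.univ_pi fun _ => measurableSet_ball
  have hAD : ∀ a, e.symm (a, b) ∈ A ↔ a ∈ D b := by
    intro a
    rw [hmem, e.apply_symm_apply]
    exact and_iff_right hbB
  have hes : ∀ (a : {m // pr m} → Fin d → ℝ) (m : Fin N) (hm : m ∉ S),
      e.symm (a, b) m = b ⟨m, hm⟩ := by
    intro a m hm
    have h1 : (e (e.symm (a, b))).2 ⟨m, hm⟩ = b ⟨m, hm⟩ := by rw [e.apply_symm_apply]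
    exact h1
  have hes' : ∀ (a : {m // pr m} → Fin d → ℝ), (fun m : {m // m ∈ S} => e.symm (a, b) m) = a := by
    intro a
    have h1 : (e (e.symm (a, b))).1 = a := by rw [e.apply_symm_apply]
    exact h1
  have hcardpr : Fintype.card {m // pr m} = k := by
    rw [← hcard]
    exact Fintype.card_coe S
  have hIH : ∫ a, A.indicator H (e.symm (a, b)) ∂(Measure.pi fun _ : {m // pr m} => P)
      = ∫ a in D b, (∑ j, Real.log (boxLen (b ⟨i, hiS⟩) a j) + d / Fintype.card {m // pr m}
        - Real.log (ballMass p (b ⟨i, hiS⟩) R) + Real.log (p (b ⟨i, hiS⟩)))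
        ∂(Measure.pi fun _ : {m // pr m} => P) := by
    rw [← integral_indicator hDm]
    refine integral_congr_ae (Filter.Eventually.of_forall fun a => ?_)
    simp only
    by_cases ha : a ∈ D b
    · rw [indicator_of_mem ha, indicator_of_mem ((hAD a).2 ha)]
      have hin : IsInner i l S (e.symm (a, b)) := (hAD a).2 ha
      simp only [H, logVol]
      rw [hes a i hiS, hes a l hlS, hcardpr]
      congr 3
      refine Finset.sum_congr rfl fun j _ => ?_
      rw [← hcard, hin.logLen_eq hiS hlS, hes' a, hes a i hiS]
    · rw [indicator_of_notMem ha, indicator_of_notMem fun h => ha ((hAD a).1 h)]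
  have hIR : ∫ a, A.indicator (fun x => dist (x l) (x i)) (e.symm (a, b))
        ∂(Measure.pi fun _ : {m // pr m} => P)
      = R * ballMass p (b ⟨i, hiS⟩) R ^ k := by
    have h1 : ∀ a, A.indicator (fun x => dist (x l) (x i)) (e.symm (a, b))
        = (D b).indicator (fun _ => R) a := by
      intro a
      by_cases ha : a ∈ D b
      · rw [indicator_of_mem ha, indicator_of_mem ((hAD a).2 ha), hes a i hiS, hes a l hlS]
      · rw [indicator_of_notMem ha, indicator_of_notMem fun h => ha ((hAD a).1 h)]
    simp_rw [h1]
    rw [integral_indicator hDm, setIntegral_const, measureReal_def, Measure.pi_pi,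
      ENNReal.toReal_prod, smul_eq_mul, mul_comm]
    simp only [← measureReal_def]
    rw [Finset.prod_const, Finset.card_univ, hcardpr]
  rw [hIH, hIR, Real.norm_eq_abs]
  have key := hp.abs_setIntegral_log_boxLen_le (ι := {m // pr m}) (by rw [hcardpr]; exact hk)
    (hbc ⟨i, hiS⟩) hRpos (dist_le_one (hbc _) (hbc _))
  refine key.trans (le_of_eq ?_)
  rw [hcardpr, hC, biasConst]
  ring

/-- By `le_of_mul_pow_le` it suffices to average 1 + N u over the Beta law, whose mean is (k+1)/N;
this gives k + 2. -/
lemma setIntegral_dist_le (hp : IsAdmissibleDensity p) (hd : 1 ≤ d) {k n : ℕ}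
    {i : Fin N} (hN : N = k + n + 2) {q : Fin N × Finset (Fin N)}
    (hq : q ∈ neighborConfigs N k i) :
    ∫ x in {x | IsInner i q.1 q.2 x}, dist (x q.1) (x i) ∂sampleMeasure N p
      ≤ (lowerConst p * (N : ℝ) ^ (1 / (d : ℝ)))⁻¹ * ((k + 2) * natBeta k n) := by
  have := hp.isProbabilityMeasure
  have hNpos : (0 : ℝ) < N := by
    have : 0 < N := i.pos
    exact_mod_cast this
  set c := (lowerConst p * (N : ℝ) ^ (1 / (d : ℝ)))⁻¹ with hc
  have h1 := hp.integral_config hd hN hq (φ := fun u => c * (1 + N * u)) (by fun_prop)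
    (Continuous.intervalIntegrable (by fun_prop) _ _)
  have h2 : ∫ u in (0 : ℝ)..1, u ^ k * (1 - u) ^ n * (c * (1 + N * u))
      = c * ((k + 2) * natBeta k n) := by
    have h3 : ∀ u : ℝ, u ^ k * (1 - u) ^ n * (c * (1 + N * u))
        = c * (u ^ k * (1 - u) ^ n) + c * N * (u ^ (k + 1) * (1 - u) ^ n) := fun u => by ring
    simp_rw [h3]
    rw [intervalIntegral.integral_add (Continuous.intervalIntegrable (by fun_prop) _ _)
      (Continuous.intervalIntegrable (by fun_prop) _ _), intervalIntegral.integral_const_mul,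
      intervalIntegral.integral_const_mul]
    change c * natBeta k n + c * N * natBeta (k + 1) n = _
    have h4 : (N : ℝ) = k + n + 2 := by rw [hN]; push_cast; ring
    rw [natBeta_succ_left, h4]
    field_simp
    ring
  rw [← h2, ← h1.2]
  refine setIntegral_mono_on_ae (hp.integrable_dist q.1 i).integrableOn h1.1
    (measurableSet_isInner i q.1 q.2) ?_
  have hqi := (mem_neighborConfigs.1 hq).1
  filter_upwards [hp.ae_sample_mem, hp.ae_sample_dist_ne hd, hp.ae_sample_coord_ne]
    with x hx _ hx' _
  have hpos : 0 < dist (x q.1) (x i) := by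
    rw [dist_pos]
    intro h0
    exact hx' q.1 i hqi ⟨0, hd⟩ (by rw [h0])
  exact le_of_mul_pow_le hd hp.lowerConst_pos hp.lowerConst_le_one dist_nonneg hNpos
    (hp.pow_le_ballMass (hx i) hpos (dist_le_one (hx _) (hx _)))

/-- The mean contribution of a single sample point to the estimator. -/
lemma abs_integral_logVol_le (hp : IsAdmissibleDensity p) (hd : 1 ≤ d) {k n : ℕ} (hk : 1 ≤ k)
    (i : Fin N) (hN : N = k + n + 2) :
    |∫ x, logVol Finset.univ k x i ∂sampleMeasure N p - entropy p + d / k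
        - ((harmonic k : ℝ) - harmonic (k + n + 1))|
      ≤ biasConst d k (gradConst p) * (k + 2)
        * (1 / (lowerConst p ^ (k + 1) * (N : ℝ) ^ (1 / (d : ℝ)))) := by
  have := hp.isProbabilityMeasure
  set J := neighborConfigs N k i with hJ
  set c := lowerConst p with hc
  have hc0 : 0 < c := hp.lowerConst_pos
  have hNpos : (0 : ℝ) < N := by
    have : 0 < N := i.pos
    exact_mod_cast this
  have hB0 : 0 ≤ biasConst d k (gradConst p) := by
    have := hp.gradConst_nonneg
    unfold biasConst
    positivity
  set A : Fin N × Finset (Fin N) → Set (Fin N → Fin d → ℝ) :=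
    fun q => {x | IsInner i q.1 q.2 x} with hA
  have hAm : ∀ q, MeasurableSet (A q) := fun q => measurableSet_isInner i q.1 q.2
  have hsplit : ∀ G : (Fin N → Fin d → ℝ) → ℝ, Integrable G (sampleMeasure N p) →
      ∫ x, G x ∂sampleMeasure N p = ∑ q ∈ J, ∫ x in A q, G x ∂sampleMeasure N p := by
    intro G hG
    have h1 : ∀ q, ∫ x in A q, G x ∂sampleMeasure N p
        = ∫ x, (A q).indicator G x ∂sampleMeasure N p := fun q =>
      (integral_indicator (hAm q)).symm
    simp_rw [h1]
    rw [← integral_finsetSum _ fun q _ => hG.indicator (hAm q)]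
    refine integral_congr_ae ?_
    filter_upwards [hp.ae_sample_dist_ne hd] with x hx
    obtain ⟨q, ⟨hqJ, hqx⟩, huniq⟩ := existsUnique_config (k := k) (hx i) (by omega)
    rw [Finset.sum_eq_single_of_mem q hqJ]
    · rw [indicator_of_mem (show x ∈ A q from hqx)]
    · intro q' hq' hne
      exact indicator_of_notMem (fun h => hne (huniq q' ⟨hq', h⟩)) _
  have hmass : ∀ q ∈ J, ∫ _ in A q, (1 : ℝ) ∂sampleMeasure N p = natBeta k n := by
    intro q hq
    have h1 := (hp.integral_config hd hN hq (φ := fun _ => 1) measurable_const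
      (Continuous.intervalIntegrable (by fun_prop) _ _)).2
    simpa [natBeta] using h1
  -- All configurations are equally likely, so total mass one fixes this product without counting
  -- them.
  have hcount : (J.card : ℝ) * natBeta k n = 1 := by
    have h1 := hsplit (fun _ => 1) (integrable_const _)
    rw [Finset.sum_congr rfl hmass] at h1
    simpa using h1.symm
  have hlog : ∀ q ∈ J, IntegrableOn (fun x => Real.log (ballMass p (x i) (dist (x q.1) (x i))))
        (A q) (sampleMeasure N p) ∧
      ∫ x in A q, Real.log (ballMass p (x i) (dist (x q.1) (x i))) ∂sampleMeasure N p
        = natBeta k n * ((harmonic k : ℝ) - harmonic (k + n + 1)) := by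
    intro q hq
    rw [← natBetaLog_eq]
    exact hp.integral_config hd hN hq Real.measurable_log (intervalIntegrable_pow_mul_log k n)
  have hY : Integrable (fun x => logVol Finset.univ k x i + Real.log (p (x i)))
      (sampleMeasure N p) := (hp.integrable_logVol _ k i).add (hp.integrable_log_eval i)
  have hterm : ∀ q ∈ J, ∫ x in A q, (logVol Finset.univ k x i + d / k
        - Real.log (ballMass p (x i) (dist (x q.1) (x i))) + Real.log (p (x i)))
        ∂sampleMeasure N p
      = ∫ x in A q, (logVol Finset.univ k x i + Real.log (p (x i))) ∂sampleMeasure N p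
        + natBeta k n * (d / k - ((harmonic k : ℝ) - harmonic (k + n + 1))) := by
    intro q hq
    have h1 : ∀ x, logVol Finset.univ k x i + d / k
        - Real.log (ballMass p (x i) (dist (x q.1) (x i))) + Real.log (p (x i))
        = (logVol Finset.univ k x i + Real.log (p (x i))) + ((d / k : ℝ) * 1
        - Real.log (ballMass p (x i) (dist (x q.1) (x i)))) := fun x => by ring
    simp_rw [h1]
    have h2 := integral_add_const_sub (c := (d / k : ℝ)) hY.integrableOn (hlog q hq).1
    rw [h2, hmass q hq, (hlog q hq).2]
    ring
  have hEY : ∫ x, logVol Finset.univ k x i ∂sampleMeasure N p - entropy p + d / k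
        - ((harmonic k : ℝ) - harmonic (k + n + 1))
      = ∑ q ∈ J, ∫ x in A q, (logVol Finset.univ k x i + d / k
        - Real.log (ballMass p (x i) (dist (x q.1) (x i))) + Real.log (p (x i)))
        ∂sampleMeasure N p := by
    rw [Finset.sum_congr rfl hterm, Finset.sum_add_distrib, ← hsplit _ hY, Finset.sum_const,
      nsmul_eq_mul, ← mul_assoc, hcount, integral_add (hp.integrable_logVol _ k i)
      (hp.integrable_log_eval i), hp.integral_log_eval]
    ring
  rw [hEY]
  calc |∑ q ∈ J, ∫ x in A q, (logVol Finset.univ k x i + d / k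
        - Real.log (ballMass p (x i) (dist (x q.1) (x i))) + Real.log (p (x i)))
        ∂sampleMeasure N p|
      ≤ ∑ q ∈ J, biasConst d k (gradConst p) / c ^ k
          * ((c * (N : ℝ) ^ (1 / (d : ℝ)))⁻¹ * ((k + 2) * natBeta k n)) := by
        refine (Finset.abs_sum_le_sum_abs _ _).trans (Finset.sum_le_sum fun q hq => ?_)
        refine (hp.abs_setIntegral_config_le hd hk hN hq).trans ?_
        exact mul_le_mul_of_nonneg_left (hp.setIntegral_dist_le hd hN hq) (by positivity)
    _ = biasConst d k (gradConst p) / c ^ k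
          * ((c * (N : ℝ) ^ (1 / (d : ℝ)))⁻¹ * ((k + 2) * (J.card * natBeta k n))) := by
        rw [Finset.sum_const, nsmul_eq_mul]
        ring
    _ = _ := by
        rw [hcount, pow_succ]
        field_simp

end IsAdmissibleDensity

end Bias

/-! ### Bias bounds for the estimator. -/

section Main

variable {d N : ℕ} {p : (Fin d → ℝ) → ℝ}

lemma digamma_natCast {k : ℕ} (hk : 1 ≤ k) :
    digamma k = -Real.eulerMascheroniConstant + harmonic k - 1 / k := by
  obtain ⟨n, rfl⟩ : ∃ n, k = n + 1 := ⟨k - 1, by omega⟩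
  rw [Nat.cast_succ, digamma_succ, harmonic_succ]
  push_cast
  ring

lemma abs_mean_le {a : Fin N → ℝ} {b B : ℝ} (hN : 0 < N) (h : ∀ i, |a i - b| ≤ B) :
    |(1 / (N : ℝ)) * ∑ i, a i - b| ≤ B := by
  have hN0 : (0 : ℝ) < N := by exact_mod_cast hN
  have h1 : (1 / (N : ℝ)) * ∑ i, a i - b = (1 / (N : ℝ)) * ∑ i, (a i - b) := by
    rw [Finset.sum_sub_distrib]
    simp
    field_simp
  rw [h1, abs_mul, abs_of_pos (by positivity : (0 : ℝ) < 1 / N), one_div, inv_mul_le_iff₀ hN0]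
  refine (Finset.abs_sum_le_sum_abs _ _).trans ((Finset.sum_le_sum fun i _ => h i).trans ?_)
  simp

lemma biasConst_mono {k : ℕ} {D M : ℝ} (hD : 0 ≤ D) (hDM : D ≤ M) :
    biasConst d k D ≤ biasConst d k M := by
  unfold biasConst
  have : 0 ≤ M := hD.trans hDM
  gcongr

namespace IsAdmissibleDensity

lemma integral_estimator (hp : IsAdmissibleDensity p) (k : ℕ) :
    ∫ x, estimator k x ∂sampleMeasure N p = -digamma k + digamma N + ((d : ℝ) - 1) / k
      + (1 / (N : ℝ)) * ∑ i, ∫ x, logVol Finset.univ k x i ∂sampleMeasure N p := by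
  have := hp.isProbabilityMeasure
  simp_rw [estimator_eq]
  rw [integral_add (integrable_const _) ((integrable_finsetSum _ fun i _ =>
    hp.integrable_logVol Finset.univ k i).const_mul _), integral_const_mul,
    integral_finsetSum _ fun i _ => hp.integrable_logVol Finset.univ k i]
  simp

/-- The bias bound when there are at least two more points than neighbours. -/
lemma abs_bias_le (hp : IsAdmissibleDensity p) {M : ℝ} (hM : gradConst p ≤ M) (hd : 1 ≤ d)
    {k : ℕ} (hk : 1 ≤ k) (hN : k + 2 ≤ N) :
    |∫ x, estimator k x ∂sampleMeasure N p - entropy p|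
      ≤ biasConst d k M * (k + 2)
        * (1 / (lowerConst p ^ (k + 1) * (N : ℝ) ^ (1 / (d : ℝ)))) := by
  obtain ⟨n, rfl⟩ : ∃ n, N = k + n + 2 := ⟨N - k - 2, by omega⟩
  have hc0 := hp.lowerConst_pos
  set B := biasConst d k (gradConst p) * (k + 2)
    * (1 / (lowerConst p ^ (k + 1) * ((k + n + 2 : ℕ) : ℝ) ^ (1 / (d : ℝ)))) with hB
  have h1 : |(1 / ((k + n + 2 : ℕ) : ℝ)) * ∑ i : Fin (k + n + 2),
      ∫ x, logVol Finset.univ k x i ∂sampleMeasure (k + n + 2) p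
      - (entropy p - d / k + ((harmonic k : ℝ) - harmonic (k + n + 1)))| ≤ B := by
    refine abs_mean_le (by omega) fun i => ?_
    have h2 := hp.abs_integral_logVol_le hd hk i rfl
    refine le_trans (le_of_eq ?_) h2
    congr 1
    ring
  have hdig : digamma ((k + n + 2 : ℕ) : ℝ)
      = -Real.eulerMascheroniConstant + harmonic (k + n + 1) := by
    rw [← digamma_succ]
    congr 1
    push_cast
    ring
  have hk0 : (k : ℝ) ≠ 0 := by positivity
  rw [hp.integral_estimator, digamma_natCast hk, hdig]
  refine le_trans (le_of_eq ?_) (h1.trans ?_)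
  · congr 1
    field_simp
    ring
  · rw [hB]
    gcongr
    exact biasConst_mono hp.gradConst_nonneg hM

/-- A crude bound from |a| ≤ 1 + a² and the second moment, for the case N = k + 1. -/
lemma abs_integral_logVol_le_moment (hp : IsAdmissibleDensity p) {M : ℝ} (hM : gradConst p ≤ M)
    (hN : 2 ≤ N) (U : Finset (Fin N)) (k : ℕ) (i : Fin N) :
    |∫ x, logVol U k x i ∂sampleMeasure N p| ≤ d * (1 + momentConst M * Real.log N ^ 2) := by
  have := hp.isProbabilityMeasure
  have hint : ∀ j : Fin d, Integrable (fun x => logLen U k x i j) (sampleMeasure N p) :=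
    fun j => (hp.memLp_logLen U k i j).integrable one_le_two
  unfold logVol
  rw [integral_finsetSum _ fun j _ => hint j]
  refine (Finset.abs_sum_le_sum_abs _ _).trans ?_
  have h1 : ∀ j : Fin d, |∫ x, logLen U k x i j ∂sampleMeasure N p|
      ≤ 1 + momentConst M * Real.log N ^ 2 := by
    intro j
    have hWint := hp.integrable_logLenBound i j
    have h2 : ‖∫ x, logLen U k x i j ∂sampleMeasure N p‖
        ≤ ∫ x, (1 + logLenBound x i j) ∂sampleMeasure N p := by
      refine norm_integral_le_of_norm_le ((integrable_const 1).add hWint) ?_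
      filter_upwards [hp.ae_sample_mem, hp.ae_sample_coord_ne] with x hx hx'
      have h3 := sq_logLen_le (U := U) (k := k) (i := i) (j := j) hx hx'
      rw [Real.norm_eq_abs]
      have h4 := sq_abs (logLen U k x i j)
      nlinarith [sq_nonneg (|logLen U k x i j| - 1)]
    rw [integral_add (integrable_const _) hWint] at h2
    have h5 := hp.integral_logLenBound_le hM hN i j
    simp only [integral_const, probReal_univ, smul_eq_mul, one_mul] at h2
    rw [← Real.norm_eq_abs]
    linarith
  refine (Finset.sum_le_sum fun j _ => h1 j).trans ?_
  simp [mul_add]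

/-- The bias bound when all other points are neighbours. -/
lemma abs_bias_le_of_eq (hp : IsAdmissibleDensity p) {M : ℝ} (hM : gradConst p ≤ M)
    {k : ℕ} (hk : 1 ≤ k) (hN : N = k + 1) :
    |∫ x, estimator k x ∂sampleMeasure N p - entropy p|
      ≤ d / k + d * (1 + momentConst M * Real.log N ^ 2) + (1 + (1 + M) ^ 2) := by
  have hNpos : 0 < N := by omega
  have hk0 : (k : ℝ) ≠ 0 := by positivity
  have h1 := abs_mean_le (b := 0)
    (a := fun i => ∫ x, logVol Finset.univ k x i ∂sampleMeasure N p)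
    (B := d * (1 + momentConst M * Real.log N ^ 2)) hNpos fun i => by
      rw [sub_zero]
      exact hp.abs_integral_logVol_le_moment hM (by omega) Finset.univ k i
  rw [sub_zero] at h1
  have h2 := hp.abs_entropy_le
  have h3 : (1 + gradConst p) ^ 2 ≤ (1 + M) ^ 2 := by
    have := hp.gradConst_nonneg
    gcongr
  have h4 : -digamma k + digamma N + ((d : ℝ) - 1) / k = d / k := by
    have h5 : digamma (N : ℝ) = -Real.eulerMascheroniConstant + harmonic k := by
      rw [hN, Nat.cast_succ, digamma_succ]
    rw [h5, digamma_natCast hk]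
    field_simp
    ring
  rw [hp.integral_estimator, h4]
  have h6 : |(d / k : ℝ)| = d / k := abs_of_nonneg (by positivity)
  refine (abs_sub _ _).trans ?_
  refine (add_le_add (abs_add_le _ _) le_rfl).trans ?_
  linarith

end IsAdmissibleDensity

end Main

end TKSG

end

/-! ### Choice of constants and transfer to random variables. -/

theorem theorem2 (d k : ℕ) (hd : 1 ≤ d) (hk : 1 ≤ k) (M : ℝ) :
    ∃ C C' : ℝ, 0 < C ∧ 0 < C' ∧
      ∀ p : (Fin d → ℝ) → ℝ, TKSG.IsAdmissibleDensity p → TKSG.gradConst p ≤ M →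
      ∀ N : ℕ, k < N →
      ∀ (Ω : Type*) [MeasurableSpace Ω] (μ : Measure Ω) [IsProbabilityMeasure μ]
        (X : Fin N → Ω → (Fin d → ℝ)),
        iIndepFun X μ → (∀ i, HasLaw (X i) (TKSG.densityMeasure p) μ) →
        MemLp (fun ω => TKSG.estimator k fun i => X i ω) 2 μ ∧
        |(∫ ω, TKSG.estimator k (fun i => X i ω) ∂μ) - TKSG.entropy p|
          ≤ C * (Real.log N ^ (k + 2)
              / (TKSG.lowerConst p ^ (k + 1) * (N : ℝ) ^ (1 / (d : ℝ)))) ∧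
        variance (fun ω => TKSG.estimator k fun i => X i ω) μ
          ≤ C' * (Real.log N ^ (k + 2) / N) := by
  -- `M` may be negative, while the constants must be positive in any case.
  set M' := max M 0 with hM'
  have hM'0 : 0 ≤ M' := le_max_right _ _
  have hlog2 : 0 < Real.log 2 := Real.log_pos one_lt_two
  have hmom : 0 < TKSG.momentConst M' := by
    have : 0 ≤ TKSG.invSqrtMass := ENNReal.toReal_nonneg
    unfold TKSG.momentConst
    positivity
  have hd0 : (0 : ℝ) < d := by exact_mod_cast hd
  have hk0 : (0 : ℝ) < k := by exact_mod_cast hk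
  -- `C₁` serves N ≥ k + 2 and `C₂` serves N = k + 1. The powers of log 2 in the final constants
  -- supply the logarithmic factors that the sharper bounds do not have.
  set C₁ := TKSG.biasConst d k M' * (k + 2) with hC₁
  set C₂ := d / k + d * (1 + TKSG.momentConst M' * Real.log (k + 1 : ℕ) ^ 2)
    + (1 + (1 + M') ^ 2) with hC₂
  have hC₁0 : 0 ≤ C₁ := by
    have : 0 ≤ TKSG.biasConst d k M' := by unfold TKSG.biasConst; positivity
    positivity
  have hC₂0 : 0 < C₂ := by positivity
  refine ⟨(C₁ + C₂ * (k + 1)) / Real.log 2 ^ (k + 2),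
    TKSG.stabilityConst d k * d * TKSG.momentConst M' / Real.log 2 ^ k, by positivity, ?_, ?_⟩
  · unfold TKSG.stabilityConst
    positivity
  intro p hp hM N hN Ω _ μ _ X hindep hlaw
  have hprob := hp.isProbabilityMeasure
  have hMp : TKSG.gradConst p ≤ M' := hM.trans (le_max_left _ _)
  have hN2 : 2 ≤ N := by omega
  have hNpos : (0 : ℝ) < N := by positivity
  have hlogN : Real.log 2 ≤ Real.log N := Real.log_le_log two_pos (by exact_mod_cast hN2)
  have hc0 := hp.lowerConst_pos
  have hc1 := hp.lowerConst_le_one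
  have hXm : ∀ i, AEMeasurable (X i) μ := fun i => (hlaw i).aemeasurable
  have hXm' : AEMeasurable (fun ω i => X i ω) μ := aemeasurable_pi_lambda _ hXm
  have hjoint : μ.map (fun ω i => X i ω) = TKSG.sampleMeasure N p := by
    rw [(iIndepFun_iff_map_fun_eq_pi_map hXm).1 hindep]
    simp_rw [(hlaw _).map_eq]
  have hest := TKSG.measurable_estimator (d := d) (N := N) k
  refine ⟨?_, ?_, ?_⟩
  · have h1 := hp.memLp_estimator (N := N) k
    rw [← hjoint] at h1
    exact (memLp_map_measure_iff hest.aestronglyMeasurable hXm').1 h1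
  · have h1 : ∫ ω, TKSG.estimator k (fun i => X i ω) ∂μ
        = ∫ x, TKSG.estimator k x ∂TKSG.sampleMeasure N p := by
      rw [← hjoint, integral_map hXm' hest.aestronglyMeasurable]
    rw [h1]
    have hpowlog : Real.log 2 ^ (k + 2) ≤ Real.log N ^ (k + 2) := by gcongr
    set Q := TKSG.lowerConst p ^ (k + 1) * (N : ℝ) ^ (1 / (d : ℝ)) with hQ
    have hQ0 : 0 < Q := by positivity
    have hscale : (C₁ + C₂ * (k + 1)) * (1 / Q)
        ≤ (C₁ + C₂ * (k + 1)) / Real.log 2 ^ (k + 2) * (Real.log N ^ (k + 2) / Q) := by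
      rw [div_mul_div_comm, mul_one_div, div_le_div_iff₀ hQ0 (by positivity)]
      have h2 : 0 ≤ (C₁ + C₂ * (k + 1)) * Q := by positivity
      nlinarith [mul_le_mul_of_nonneg_left hpowlog h2]
    refine le_trans ?_ hscale
    rcases Nat.lt_or_ge N (k + 2) with hlt | hge
    · have hNk : N = k + 1 := by omega
      have h2 := hp.abs_bias_le_of_eq hMp hk hNk
      -- This is the origin of the factor k + 1 next to `C₂`: the denominator is at most N = k + 1.
      have h3 : Q ≤ k + 1 := by
        have h4 : (N : ℝ) ^ (1 / (d : ℝ)) ≤ N := by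
          refine (Real.rpow_le_rpow_of_exponent_le (by exact_mod_cast (by omega : 1 ≤ N))
            (y := 1 / (d : ℝ)) (z := 1) ?_).trans (Real.rpow_one _).le
          rw [div_le_one hd0]
          exact_mod_cast hd
        have h5 : TKSG.lowerConst p ^ (k + 1) ≤ 1 := pow_le_one₀ hc0.le hc1
        have h6 : (N : ℝ) = k + 1 := by rw [hNk]; push_cast; ring
        calc Q ≤ 1 * N := mul_le_mul h5 h4 (by positivity) zero_le_one
          _ = k + 1 := by rw [one_mul, h6]
      have h7 : C₂ ≤ (C₁ + C₂ * (k + 1)) * (1 / Q) := by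
        rw [mul_one_div, le_div_iff₀ hQ0]
        nlinarith
      rw [hNk] at h2
      subst hNk
      exact h2.trans h7
    · refine (hp.abs_bias_le hMp hd hk hge).trans ?_
      refine mul_le_mul_of_nonneg_right ?_ (by positivity)
      have : 0 ≤ C₂ * (k + 1) := by positivity
      linarith
  · have h1 : variance (fun ω => TKSG.estimator k fun i => X i ω) μ
        = variance (fun x => TKSG.estimator k x) (TKSG.sampleMeasure N p) := by
      rw [← hjoint, variance_map hest.aemeasurable hXm']
      rfl
    rw [h1]
    refine (hp.variance_estimator_le hMp hd hN2 k).trans ?_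
    have hS : 0 ≤ TKSG.stabilityConst d k * d * TKSG.momentConst M' := by
      unfold TKSG.stabilityConst
      positivity
    have h2 : Real.log N ^ 2 ≤ Real.log N ^ (k + 2) / Real.log 2 ^ k := by
      rw [le_div_iff₀ (by positivity), pow_add, mul_comm]
      gcongr
    calc TKSG.stabilityConst d k * d * TKSG.momentConst M' * (Real.log N ^ 2 / N)
        ≤ TKSG.stabilityConst d k * d * TKSG.momentConst M'
          * (Real.log N ^ (k + 2) / Real.log 2 ^ k / N) := by gcongr
      _ = _ := by ring
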